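/- Let $PVI_\mu$ ($\mu\in\mathbb C$) be the sixth Painlevé equation $$y''=\tfrac12\Big[\tfrac1y+\tfrac1{y-1}+\tfrac1{y-x}\Big](y')^2-\Big[\tfrac1x+\tfrac1{x-1}+\tfrac1{y-x}\Big]y'+\tfrac12\,\frac{y(y-1)(y-x)}{x^2(x-1)^2}\Big[(2\mu-1)^2+\frac{x(x-1)}{(y-x)^2}\Big].$$ Let $\nu>0$, $d\in\mathbb C$, $2\mu-1\ne\pm2i\nu$, $\varphi\in\mathbb R$ and $r>0$. Fix the determination $\varphi-\pi<\arg x<\varphi+\pi$ of the argument (for instance $\varphi=0$), and let $y(x)$ be a meromorphic solution of $PVI_\mu$ on the sheet $0<|x|<r$, $\varphi-\pi<\arg x<\varphi+\pi$ such that, with locally uniform convergence, $$\frac1{y(x)}=\sum_{n=1}^\infty x^{n-1}y_n(x),\qquad y_n(x)=\sum_{m=-n}^nA_{nm}\,e^{2imd}x^{2im\nu},\quad A_{nm}\in\mathbb C,$$ $$y_1(x)=\frac{(2\mu-1+2i\nu)^2e^{-2id}x^{-2i\nu}}{16\nu^2}-\frac{(2\mu-1)^2-4\nu^2}{8\nu^2}+\frac{(2\mu-1-2i\nu)^2e^{2id}x^{2i\nu}}{16\nu^2}.$$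 The function $y_1$ has the two sequences of zeros ($\ln$ being the principal logarithm) $$x_k(1)=\exp\Big\{-\frac d\nu-\frac{k\pi}\nu\Big\},\qquad x_k(2)=x_k(1)\exp\Big\{-\frac i\nu\ln\frac{2\mu-1+2i\nu}{2\mu-1-2i\nu}\Big\},\qquad k=0,1,2,\dots,$$ which lie along the rays $\arg x=\alpha_1:=-\frac{\Im d}\nu$ and $\arg x=\alpha_2:=-\frac1\nu\Big(\Im d+\ln\Big|\frac{2\mu-1+2i\nu}{2\mu-1-2i\nu}\Big|\Big)$. Let $k_0\ge0$ be such that $|x_k(j)|<r$ for all $k\ge k_0$ and $j=1,2$. Then there is $K$ such that, for each $j\in\{1,2\}$ whose ray lies in the sheet ($|\alpha_j-\varphi|<\pi$) and every $k\ge\max\{K,k_0\}$, the branch $y$ has a pole $\xi_k(j)$ in the sheet with $|\xi_k(j)-x_k(j)|<|x_k(j)|^2$, and as $k\to\infty$ these poles have the asymptotic representation $$\xi_k(j)\sim x_k(j)+\sum_{N=2}^\infty\Delta_N(j)\,x_k(j)^N,$$ that is, $\xi_k(j)-x_k(j)-\sum_{N=2}^M\Delta_N(j)x_k(j)^N=O\big(x_k(j)^{M+1}\big)$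 for every $M$. The coefficients $\Delta_N(j)$ do not depend on $k$; they are rational functions of $\mu$ and $\nu$ alone, with denominators that do not vanish for $\nu>0$, $2\mu-1\neq\pm2i\nu$. The first ones are $\Delta_2(1)=\Delta_2(2)=-\frac12$ and $$\Delta_3(1)=\frac{16\mu^4-8\mu^2+176\nu^4+352\nu^2+177}{1024(\nu^2+1)^2},\qquad \Delta_3(2)=\frac{16\mu^4-64\mu^3+88\mu^2-48\mu+176\nu^4+352\nu^2+185}{1024(\nu^2+1)^2},$$ $$\Delta_4(1)=-\frac{16\mu^4-8\mu^2+49+48\nu^4+96\nu^2}{1024(\nu^2+1)^2},\qquad \Delta_4(2)=-\frac{16\mu^4-64\mu^3+88\mu^2-48\mu+57+48\nu^4+96\nu^2}{1024(\nu^2+1)^2}.$$ For $\mu=\frac12$ one has $\Delta_N(1)=\Delta_N(2)$ for all $N\ge2$, and the poles $\xi_k(j)$ are double. In particular the poles accumulate at $0$, asymptotically along the rays: $\xi_k(j)\to0$ and $\xi_k(j)/|\xi_k(j)|\to e^{i\alpha_j}$ as $k\to\infty$. -/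

import Mathlib

open Filter Topology Asymptotics

namespace PainleveVI

noncomputable section

/-- The right-hand side of the sixth Painlevé equation with parameters
`α = (2μ-1)²/2`, `β = γ = 0`, `δ = 1/2`, at the point `x`, with `y` the value of the unknown
function and `y'` the value of its first derivative. -/
def pviRHS (μ x y y' : ℂ) : ℂ :=
  (1 / 2) * (1 / y + 1 / (y - 1) + 1 / (y - x)) * y' ^ 2
    - (1 / x + 1 / (x - 1) + 1 / (y - x)) * y'
    + (1 / 2) * (y * (y - 1) * (y - x) / (x ^ 2 * (x - 1) ^ 2))
        * ((2 * μ - 1) ^ 2 + x * (x - 1) / (y - x) ^ 2)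

/-- `y` is a (meromorphic) solution of the equation on the set `U`: it is meromorphic on `U` and
satisfies the equation wherever `y` is holomorphic and no denominator of the equation vanishes. -/
def SolvesPVI (μ : ℂ) (y : ℂ → ℂ) (U : Set ℂ) : Prop :=
  MeromorphicOn y U ∧
    ∀ x ∈ U, AnalyticAt ℂ y x → x ≠ 0 → x ≠ 1 → y x ≠ 0 → y x ≠ 1 → y x ≠ x →
      deriv (deriv y) x = pviRHS μ x (y x) (deriv y x)

/-- The punctured disc of radius `r` around `0` with a radial cut, carrying the determination
`φ - π < arg x < φ + π` of the argument. For `φ = 0` this is `0 < |x| < r`, `|arg x| < π`. -/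
def sheet (φ r : ℝ) : Set ℂ :=
  {x | ‖x‖ < r ∧ x * Complex.exp (-(Complex.I * φ)) ∈ Complex.slitPlane}

/-- The logarithm on the sheet: the determination with `φ - π < Im (ln x) < φ + π`. -/
def sheetLog (φ : ℝ) (x : ℂ) : ℂ :=
  Complex.log (x * Complex.exp (-(Complex.I * φ))) + Complex.I * φ

/-- `y_n(x) = ∑_{m=-n}^{n} A_{nm} e^{2imd} x^{2imν}`, with `x^{2imν} = exp (2imν ln x)`. -/
def yCoeff (A : ℕ → ℤ → ℂ) (ν : ℝ) (d : ℂ) (φ : ℝ) (n : ℕ) (x : ℂ) : ℂ :=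
  ∑ m ∈ Finset.Icc (-(n : ℤ)) (n : ℤ),
    A n m * Complex.exp (2 * Complex.I * m * d)
      * Complex.exp (2 * Complex.I * m * ν * sheetLog φ x)

/-- `y` is the branch `y(x, ν, d)` on the sheet `φ - π < arg x < φ + π`, `0 < |x| < r`: a solution
of the equation such that
`1 / y(x) = y_1(x) + x y_2(x) + x² y_3(x) + ⋯ = ∑_{n ≥ 1} x^{n-1} y_n(x)`,
a series converging locally uniformly on the sheet, with `y_n` as in `yCoeff` and
`y_1(x) = (2μ-1+2iν)² e^{-2id} x^{-2iν} / (16ν²) - ((2μ-1)² - 4ν²) / (8ν²)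
  + (2μ-1-2iν)² e^{2id} x^{2iν} / (16ν²)`.
Nothing is required of the value of the Lean function `y` at the zeros of the series. -/
structure IsBranch (μ : ℂ) (ν : ℝ) (d : ℂ) (φ r : ℝ) (y : ℂ → ℂ) : Prop where
  r_pos : 0 < r
  solves : SolvesPVI μ y (sheet φ r)
  expansion : ∃ A : ℕ → ℤ → ℂ,
    A 1 (-1) = (2 * μ - 1 + 2 * Complex.I * ν) ^ 2 / (16 * ν ^ 2) ∧
    A 1 0 = -(((2 * μ - 1) ^ 2 - 4 * ν ^ 2) / (8 * ν ^ 2)) ∧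
    A 1 1 = (2 * μ - 1 - 2 * Complex.I * ν) ^ 2 / (16 * ν ^ 2) ∧
    ∃ Y : ℂ → ℂ,
      TendstoLocallyUniformlyOn
        (fun (M : ℕ) (x : ℂ) => ∑ n ∈ Finset.Icc 1 M, x ^ (n - 1) * yCoeff A ν d φ n x)
        Y atTop (sheet φ r) ∧
      ∀ x ∈ sheet φ r, Y x ≠ 0 → y x = 1 / Y x

/-- The quotient `(2μ-1+2iν) / (2μ-1-2iν)`. -/
def ratio (μ : ℂ) (ν : ℝ) : ℂ :=
  (2 * μ - 1 + 2 * Complex.I * ν) / (2 * μ - 1 - 2 * Complex.I * ν)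

/-- The two sequences of zeros of `y_1`; the indices `0, 1 : Fin 2` stand for `j = 1, 2`:
`x_k(1) = exp (-d/ν - kπ/ν)` and `x_k(2) = x_k(1) exp (-(i/ν) ln ((2μ-1+2iν)/(2μ-1-2iν)))`, with
the principal logarithm. -/
def zeroPt (μ : ℂ) (ν : ℝ) (d : ℂ) : Fin 2 → ℕ → ℂ
  | 0, k => Complex.exp (-(d / ν) - k * Real.pi / ν)
  | 1, k => Complex.exp (-(d / ν) - k * Real.pi / ν)
      * Complex.exp (-(Complex.I / ν) * Complex.log (ratio μ ν))

/-- The angles of the two rays that carry the two sequences `zeroPt`, as real numbers (so that they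
also say to which sheet of the logarithm the zeros belong). -/
def rayAngle (μ : ℂ) (ν : ℝ) (d : ℂ) : Fin 2 → ℝ
  | 0 => -(d.im / ν)
  | 1 => -((1 / ν) * (d.im + Real.log ‖ratio μ ν‖))

/-- The standing assumptions on the parameters: `ν > 0` and `2μ - 1 ≠ ±2iν`. -/
def Admissible (μ : ℂ) (ν : ℝ) : Prop :=
  0 < ν ∧ 2 * μ - 1 ≠ 2 * Complex.I * ν ∧ 2 * μ - 1 ≠ -(2 * Complex.I * ν)

end

end PainleveVI

/-! ### Perturbation of the polynomial form of the equation at a given order. -/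

namespace PainleveVI

/-! Poles of y are zeros of u = 1/y, so the task is to follow the zeros of u near x_k(1). Put X =
x_k(1), x = X e^ω and l = 2iν. Then D = x d/dx is d/dω, and e^{2imd} x_k(1)^{2imν} = e^{-2πimk} = 1.
Hence u is a power series in X whose coefficients are functions of ω alone, independent of k
(`yCoeff_exp`, `exists_series`). With s = e^{lω} and ξ = x/s one has s u = ∑ ξ^i w_i(s), where the
w_i are polynomials and w_0 is quadratic.

Since infinitely many X tend to 0 with ω fixed, the differential equation holds coefficient by
coefficient: the w_i form a formal solution (`IsSeries.formalODE_eq_zero`). The recursion for w_i is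
triangular in powers of s, with pivots 2 w_0(0)² (i + (j - i) l)². These never vanish, because
w_0(0) is a nonzero multiple of (a + l)², where a = 2μ - 1, and i + (j - i) l has real part i. So
w_0 determines the formal solution (`formalODE_unique`), and its coefficients are rational in μ and
ν with harmless denominators (`formalSolution_mem`).

At X = 0 the function u has an isolated zero at ω = 0, and the open mapping theorem keeps a zero
nearby for small X. At a zero of u the equation reduces to ((x - 1) D u)² = a², and near ω = 0 the
sign must be (x - 1) D u = -a. Instead of u, whose zero is double when a = 0, one solves (x - 1) D u
+ a + l u = 0. At X = ω = 0 the derivative of this expression in ω is (a + l)²/2, which is never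
zero, so simple and double poles are treated alike (`IsJetFamily.exists_zeros`). The asymptotic
implicit function theorem (`exists_implicit_expansion`) then expands ω in powers of X, and the
exponential of ω gives ξ_k(1)/x_k(1).

The explicit coefficients need w_1, w_2, w_3. They come from the symmetry x → x/(x - 1), y → (x -
y)/(x - 1), which fixes E = (1 - x/2)/(y - x/2) and changes the sign of t = x/√(1 - x). This
suggests that E contains only even powers of t, so that up to order 3 a single unknown function
remains. The resulting polynomials are checked in the equation and identified with the w_i by
uniqueness (`coeff_formalODE_explicitSolution`, `FormalSolution.w_eq`).

The second sequence is the first one for the parameter 1 - μ and a shifted d (`IsBranch.reflect`),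
since the equation depends on μ only through a². This also gives equality of the coefficients at μ =
1/2. -/

/-- The homogenized polynomial form of the equation: at `s = 1` it is the equation for `u = 1 / y`
in terms of `ξ = x`, `u`, `D u`, `D² u`, where `D = x d/dx`. -/
def homODE {R : Type*} [CommRing R] (ξ s a2 W W1 W2 : R) : R :=
  2 * ((ξ * s - 1) ^ 2 * (W * (W - s) * ((1 - ξ * W) * W2)))
    - (ξ * s - 1) ^ 2 * (((2 * W - s) * (1 - ξ * W) - ξ * (W * (W - s))) * W1 ^ 2)
    - 2 * ((ξ * s - 1) * (ξ * (W * ((W - s) ^ 2 * W1))))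
    - (W - s) ^ 2 * (a2 * s * (1 - ξ * W) ^ 2 + (ξ * s - 1) * (ξ * W ^ 2))

/-- The linearization of `homODE` with respect to the last three arguments, at `ξ = 0`. -/
def linODE {R : Type*} [CommRing R] (s a2 W W1 W2 p p1 p2 : R) : R :=
  2 * ((2 * W - s) * W2) * p + 2 * (W * (W - s)) * p2 - 2 * W1 ^ 2 * p
    - 2 * ((2 * W - s) * W1) * p1 - 2 * (a2 * s * (W - s)) * p

/-- `f` and `g` agree below order `i`, and their coefficients of order `i` differ by `δ`. -/
def AgreeTo {R : Type*} [CommRing R] (i : ℕ) (f g : PowerSeries R) (δ : R) : Prop :=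
  ∃ P : PowerSeries R, f = g + PowerSeries.X ^ i * P ∧ PowerSeries.constantCoeff P = δ

namespace AgreeTo

variable {R : Type*} [CommRing R] {i : ℕ} {f f' g g' : PowerSeries R} {δ ε : R}

lemma refl (i : ℕ) (f : PowerSeries R) : AgreeTo i f f 0 := ⟨0, by simp, by simp⟩

lemma add (hf : AgreeTo i f f' δ) (hg : AgreeTo i g g' ε) :
    AgreeTo i (f + g) (f' + g') (δ + ε) := by
  obtain ⟨P, rfl, rfl⟩ := hf
  obtain ⟨Q, rfl, rfl⟩ := hg
  exact ⟨P + Q, by ring, by simp⟩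

lemma sub (hf : AgreeTo i f f' δ) (hg : AgreeTo i g g' ε) :
    AgreeTo i (f - g) (f' - g') (δ - ε) := by
  obtain ⟨P, rfl, rfl⟩ := hf
  obtain ⟨Q, rfl, rfl⟩ := hg
  exact ⟨P - Q, by ring, by simp⟩

lemma mul (hi : i ≠ 0) (hf : AgreeTo i f f' δ) (hg : AgreeTo i g g' ε) :
    AgreeTo i (f * g) (f' * g') (PowerSeries.constantCoeff f' * ε
      + δ * PowerSeries.constantCoeff g') := by
  obtain ⟨P, rfl, rfl⟩ := hf
  obtain ⟨Q, rfl, rfl⟩ := hg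
  exact ⟨f' * Q + P * g' + PowerSeries.X ^ i * (P * Q), by ring, by simp [hi]⟩

lemma coeff_sub (h : AgreeTo i f g δ) : PowerSeries.coeff i f - PowerSeries.coeff i g = δ := by
  obtain ⟨P, rfl, rfl⟩ := h
  have := PowerSeries.coeff_X_pow_mul P i 0
  simp only [zero_add] at this
  simp [this]

lemma of_coeff (h : ∀ j < i, PowerSeries.coeff j f = PowerSeries.coeff j g)
    (hδ : PowerSeries.coeff i f - PowerSeries.coeff i g = δ) : AgreeTo i f g δ := by
  have h1 : PowerSeries.X ^ i ∣ f - g := by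
    rw [PowerSeries.X_pow_dvd_iff]
    intro m hm
    simp [h m hm]
  obtain ⟨P, hP⟩ := h1
  refine ⟨P, by rw [← hP]; ring, ?_⟩
  have := PowerSeries.coeff_X_pow_mul P i 0
  simp only [zero_add] at this
  rw [← hδ, ← map_sub, hP, this]
  simp

/-- Products of two perturbations have order at least 2i > i, and the explicit factor ξ pushes a
perturbation to order i + 1. Only the linearization at ξ = 0, with coefficients taken from the
constant terms, is visible at order i. -/
lemma homODE (hi : i ≠ 0) {s a2 : R} {W W' W1 W1' W2 W2' : PowerSeries R} {p p1 p2 : R}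
    (h : AgreeTo i W W' p) (h1 : AgreeTo i W1 W1' p1) (h2 : AgreeTo i W2 W2' p2) :
    AgreeTo i
      (homODE PowerSeries.X (PowerSeries.C s) (PowerSeries.C a2) W W1 W2)
      (PainleveVI.homODE PowerSeries.X (PowerSeries.C s) (PowerSeries.C a2) W' W1' W2')
      (linODE s a2 (PowerSeries.constantCoeff W') (PowerSeries.constantCoeff W1')
        (PowerSeries.constantCoeff W2') p p1 p2) := by
  have X := refl i (PowerSeries.X : PowerSeries R)
  have s' := refl i (PowerSeries.C s)
  have a' := refl i (PowerSeries.C a2)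
  have one := refl i (1 : PowerSeries R)
  have two := refl i (2 : PowerSeries R)
  have x1 : AgreeTo i _ _ _ := (X.mul hi s').sub one
  have ws := h.sub s'
  have xw := one.sub (X.mul hi h)
  have key := (((two.mul hi ((x1.mul hi x1).mul hi ((h.mul hi ws).mul hi (xw.mul hi h2)))).sub
    ((x1.mul hi x1).mul hi (((((two.mul hi h).sub s').mul hi xw).sub
      (X.mul hi (h.mul hi ws))).mul hi (h1.mul hi h1)))).sub
    (two.mul hi (x1.mul hi (X.mul hi (h.mul hi ((ws.mul hi ws).mul hi h1)))))).sub
    ((ws.mul hi ws).mul hi (((a'.mul hi s').mul hi (xw.mul hi xw)).add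
      (x1.mul hi (X.mul hi (h.mul hi h)))))
  simp only [← pow_two] at key
  unfold PainleveVI.homODE
  convert key using 1
  have h2 : PowerSeries.constantCoeff (2 : PowerSeries R) = 2 := map_ofNat _ 2
  simp [linODE, h2]
  ring

end AgreeTo

/-! ### The recursion for formal solutions and its triangular structure. -/

section FormalSolution

open Polynomial

/-- The action of `D - λ` on the coefficient of `ξ ^ i`, where `D ξ = (1 - λ) ξ`, `D s = λ s`. -/
noncomputable def twist (l : ℂ) (i : ℕ) (p : ℂ[X]) : ℂ[X] :=
  C ((i : ℂ) - (i + 1) * l) * p + C l * (X * derivative p)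

lemma coeff_twist (l : ℂ) (i j : ℕ) (p : ℂ[X]) :
    (twist l i p).coeff j = (i + ((j : ℂ) - i - 1) * l) * p.coeff j := by
  rw [twist, coeff_add, coeff_C_mul, coeff_C_mul]
  rcases j with _ | j
  · rw [mul_coeff_zero, coeff_X_zero]
    push_cast
    ring
  · rw [coeff_X_mul, coeff_derivative]
    push_cast
    ring

/-- The coefficients `w i` of a formal solution `∑ ξ ^ i w_i(s)` of the homogenized equation. -/
noncomputable def formalODE (a l : ℂ) (w : ℕ → ℂ[X]) : PowerSeries ℂ[X] :=
  homODE PowerSeries.X (PowerSeries.C X) (PowerSeries.C (C (a ^ 2))) (PowerSeries.mk w)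
    (PowerSeries.mk fun i => twist l i (w i))
    (PowerSeries.mk fun i => twist l i (twist l i (w i)))

/-- The linear operator which the equation applies to the coefficient `w i`. -/
noncomputable def linOp (a l : ℂ) (w0 : ℂ[X]) (i : ℕ) (p : ℂ[X]) : ℂ[X] :=
  linODE X (C (a ^ 2)) w0 (twist l 0 w0) (twist l 0 (twist l 0 w0)) p (twist l i p)
    (twist l i (twist l i p))

/-- This is the recursion: at order i the unknown w_i enters linearly, and all remaining terms
depend on lower coefficients. -/
lemma coeff_formalODE_sub {a l : ℂ} {w w' : ℕ → ℂ[X]} {i : ℕ} (hi : i ≠ 0)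
    (h : ∀ j < i, w j = w' j) :
    PowerSeries.coeff i (formalODE a l w) - PowerSeries.coeff i (formalODE a l w')
      = linOp a l (w' 0) i (w i) - linOp a l (w' 0) i (w' i) := by
  have := (AgreeTo.homODE hi (s := X) (a2 := C (a ^ 2))
    (AgreeTo.of_coeff (f := PowerSeries.mk w) (g := PowerSeries.mk w') (i := i)
      (fun j hj => by simp [h j hj]) rfl)
    (AgreeTo.of_coeff (f := PowerSeries.mk fun i => twist l i (w i))
      (g := PowerSeries.mk fun i => twist l i (w' i)) (i := i) (fun j hj => by simp [h j hj]) rfl)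
    (AgreeTo.of_coeff (f := PowerSeries.mk fun i => twist l i (twist l i (w i)))
      (g := PowerSeries.mk fun i => twist l i (twist l i (w' i))) (i := i)
      (fun j hj => by simp [h j hj]) rfl)).coeff_sub
  unfold formalODE
  rw [this]
  simp only [linOp, linODE, PowerSeries.coeff_mk, ← PowerSeries.coeff_zero_eq_constantCoeff]
  ring

lemma coeff_mul_eq (f p : ℂ[X]) (j : ℕ) :
    (f * p).coeff j = f.coeff 0 * p.coeff j
      + ∑ k ∈ Finset.range j, p.coeff k * f.coeff (j - k) := by
  rw [mul_comm, coeff_mul, Finset.Nat.sum_antidiagonal_eq_sum_range_succ_mk,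
    Finset.sum_range_succ]
  simp
  ring

lemma coeff_mul_twist (f0 f1 f2 p : ℂ[X]) (l : ℂ) (i j : ℕ) :
    (f0 * p + f1 * twist l i p + f2 * twist l i (twist l i p)).coeff j
      = (f0.coeff 0 + f1.coeff 0 * (i + ((j : ℂ) - i - 1) * l)
          + f2.coeff 0 * (i + ((j : ℂ) - i - 1) * l) ^ 2) * p.coeff j
        + ∑ k ∈ Finset.range j, p.coeff k * (f0.coeff (j - k)
              + f1.coeff (j - k) * (i + ((k : ℂ) - i - 1) * l)
              + f2.coeff (j - k) * (i + ((k : ℂ) - i - 1) * l) ^ 2) := by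
  have e : ∑ k ∈ Finset.range j, p.coeff k * (f0.coeff (j - k)
              + f1.coeff (j - k) * (i + ((k : ℂ) - i - 1) * l)
              + f2.coeff (j - k) * (i + ((k : ℂ) - i - 1) * l) ^ 2)
      = ∑ k ∈ Finset.range j, p.coeff k * f0.coeff (j - k)
        + ∑ k ∈ Finset.range j, (twist l i p).coeff k * f1.coeff (j - k)
        + ∑ k ∈ Finset.range j, (twist l i (twist l i p)).coeff k * f2.coeff (j - k) := by
    rw [← Finset.sum_add_distrib, ← Finset.sum_add_distrib]
    refine Finset.sum_congr rfl fun k _ => ?_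
    simp only [coeff_twist]
    ring
  rw [e, coeff_add, coeff_add, coeff_mul_eq, coeff_mul_eq, coeff_mul_eq, coeff_twist, coeff_twist,
    coeff_twist]
  ring

/-- The coefficients of `linOp` as an operator in `twist`. -/
noncomputable def linCoef0 (a l : ℂ) (w0 : ℂ[X]) : ℂ[X] :=
  2 * ((2 * w0 - X) * twist l 0 (twist l 0 w0)) - 2 * twist l 0 w0 ^ 2
    - 2 * (C (a ^ 2) * X * (w0 - X))

/-- See `linCoef0`. -/
noncomputable def linCoef1 (l : ℂ) (w0 : ℂ[X]) : ℂ[X] := - (2 * ((2 * w0 - X) * twist l 0 w0))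

/-- See `linCoef0`. -/
noncomputable def linCoef2 (w0 : ℂ[X]) : ℂ[X] := 2 * (w0 * (w0 - X))

/-- Multiplication by a polynomial never lowers the power of s and `twist` is diagonal on powers of
s, so the operator is lower triangular. On the diagonal only the constant terms of the coefficients
count; they combine to 2 w_0(0)² (τ + l)², where τ = i + (j - i - 1) l is the eigenvalue of `twist`.
-/
lemma coeff_linOp (a l : ℂ) (w0 : ℂ[X]) (i j : ℕ) (p : ℂ[X]) :
    (linOp a l w0 i p).coeff j
        = 2 * w0.coeff 0 ^ 2 * (i + ((j : ℂ) - i) * l) ^ 2 * p.coeff j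
          + ∑ k ∈ Finset.range j, p.coeff k * ((linCoef0 a l w0).coeff (j - k)
              + (linCoef1 l w0).coeff (j - k) * (i + ((k : ℂ) - i - 1) * l)
              + (linCoef2 w0).coeff (j - k) * (i + ((k : ℂ) - i - 1) * l) ^ 2) := by
  have h : linOp a l w0 i p = linCoef0 a l w0 * p + linCoef1 l w0 * twist l i p
      + linCoef2 w0 * twist l i (twist l i p) := by
    simp only [linOp, linODE, linCoef0, linCoef1, linCoef2]
    ring
  rw [h, coeff_mul_twist]
  congr 2
  have e1 : (2 : ℂ[X]).coeff 0 = 2 := by simp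
  have t : ∀ q : ℂ[X], (twist l 0 q).coeff 0 = - l * q.coeff 0 := fun q => by
    rw [coeff_twist]; simp
  simp only [linCoef0, linCoef1, linCoef2, coeff_sub, coeff_neg, mul_coeff_zero, pow_two, e1, t,
    coeff_X_zero]
  ring

lemma linOp_injective {a l : ℂ} {w0 : ℂ[X]} {i : ℕ} (h0 : w0.coeff 0 ≠ 0)
    (hl : ∀ j : ℕ, (i : ℂ) + ((j : ℂ) - i) * l ≠ 0) {p q : ℂ[X]}
    (h : linOp a l w0 i p = linOp a l w0 i q) : p = q := by
  ext j
  induction j using Nat.strong_induction_on with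
  | _ j ih =>
    have hj := congrArg (fun f => coeff f j) h
    simp only [coeff_linOp] at hj
    rw [Finset.sum_congr rfl (fun k hk => by rw [ih k (Finset.mem_range.1 hk)])] at hj
    have := add_right_cancel hj
    have h2 := hl j
    exact mul_left_cancel₀ (mul_ne_zero (mul_ne_zero two_ne_zero (pow_ne_zero 2 h0))
      (pow_ne_zero 2 h2)) this

/-- Two formal solutions with the same leading coefficient coincide. -/
lemma formalODE_unique {a l : ℂ} {w w' : ℕ → ℂ[X]} {n : ℕ} (h0 : (w 0).coeff 0 ≠ 0)
    (hl : ∀ i j : ℕ, i ≠ 0 → (i : ℂ) + ((j : ℂ) - i) * l ≠ 0) (hw0 : w 0 = w' 0)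
    (hw : ∀ i < n, PowerSeries.coeff i (formalODE a l w) = 0)
    (hw' : ∀ i < n, PowerSeries.coeff i (formalODE a l w') = 0) : ∀ i < n, w i = w' i := by
  intro i
  induction i using Nat.strong_induction_on with
  | _ i ih =>
    intro hi
    rcases eq_or_ne i 0 with rfl | hi0
    · exact hw0
    have := coeff_formalODE_sub (a := a) (l := l) hi0 (fun j hj => ih j hj (hj.trans hi))
    rw [hw i hi, hw' i hi, sub_zero, eq_comm, sub_eq_zero] at this
    exact linOp_injective (hw0 ▸ h0) (fun j => hl i j hi0) this

end FormalSolution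

/-! ### Dependence of formal solutions on parameters. -/

section Regular

open Polynomial

/-- Stated for an arbitrary subring because it is used twice: for series with regular coefficients,
and for sequences paired with their asymptotic expansions. -/
lemma homODE_mem {R : Type*} [CommRing R] (T : Subring R) {ξ s a2 W W1 W2 : R} (hξ : ξ ∈ T)
    (hs : s ∈ T) (ha : a2 ∈ T) (h : W ∈ T) (h1 : W1 ∈ T) (h2 : W2 ∈ T) :
    homODE ξ s a2 W W1 W2 ∈ T := by
  have x1 : ξ * s - 1 ∈ T := T.sub_mem (T.mul_mem hξ hs) T.one_mem
  have ws : W - s ∈ T := T.sub_mem h hs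
  have xw : 1 - ξ * W ∈ T := T.sub_mem T.one_mem (T.mul_mem hξ h)
  have two : (2 : R) ∈ T := by rw [← one_add_one_eq_two]; exact T.add_mem T.one_mem T.one_mem
  refine T.sub_mem (T.sub_mem (T.sub_mem ?_ ?_) ?_) ?_
  · exact T.mul_mem two (T.mul_mem (T.pow_mem x1 2) (T.mul_mem (T.mul_mem h ws) (T.mul_mem xw h2)))
  · exact T.mul_mem (T.pow_mem x1 2) (T.mul_mem (T.sub_mem (T.mul_mem
      (T.sub_mem (T.mul_mem two h) hs) xw) (T.mul_mem hξ (T.mul_mem h ws))) (T.pow_mem h1 2))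
  · exact T.mul_mem two (T.mul_mem x1 (T.mul_mem hξ (T.mul_mem h (T.mul_mem (T.pow_mem ws 2) h1))))
  · exact T.mul_mem (T.pow_mem ws 2) (T.add_mem (T.mul_mem (T.mul_mem ha hs) (T.pow_mem xw 2))
      (T.mul_mem x1 (T.mul_mem hξ (T.pow_mem h 2))))

variable {ι : Type*} (S : Subalgebra ℂ (ι → ℂ))

/-- The families of polynomials whose coefficients belong to a given algebra of functions. -/
noncomputable def regPoly : Subring (ι → ℂ[X]) where
  carrier := {f | ∀ j, (fun x => (f x).coeff j) ∈ S}
  mul_mem' {f g} hf hg j := by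
    have : (fun x => ((f * g) x).coeff j) = ∑ p ∈ Finset.HasAntidiagonal.antidiagonal j,
        (fun x => (f x).coeff p.1) * (fun x => (g x).coeff p.2) := by
      ext x
      simp [coeff_mul]
    rw [this]
    exact S.sum_mem fun p _ => S.mul_mem (hf _) (hg _)
  one_mem' j := by
    have : (fun x : ι => ((1 : ι → ℂ[X]) x).coeff j) = algebraMap ℂ (ι → ℂ) (if j = 0 then 1 else 0) := by
      ext x
      simp [coeff_one]
    rw [this]
    exact S.algebraMap_mem _
  add_mem' {f g} hf hg j := by
    have : (fun x => ((f + g) x).coeff j) = (fun x => (f x).coeff j) + (fun x => (g x).coeff j) := by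
      ext x
      simp
    rw [this]
    exact S.add_mem (hf _) (hg _)
  zero_mem' j := by
    have : (fun x : ι => ((0 : ι → ℂ[X]) x).coeff j) = 0 := by
      ext x
      simp
    rw [this]
    exact S.zero_mem
  neg_mem' {f} hf j := by
    have : (fun x => ((-f) x).coeff j) = -(fun x => (f x).coeff j) := by
      ext x
      simp
    rw [this]
    exact S.neg_mem (hf _)

/-- The families of power series whose coefficients belong to `regPoly`. -/
noncomputable def regSeries : Subring (ι → PowerSeries ℂ[X]) where
  carrier := {f | ∀ j, (fun x => PowerSeries.coeff j (f x)) ∈ regPoly S}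
  mul_mem' {f g} hf hg j := by
    have : (fun x => PowerSeries.coeff j ((f * g) x)) = ∑ p ∈ Finset.HasAntidiagonal.antidiagonal j,
        (fun x => PowerSeries.coeff p.1 (f x)) * (fun x => PowerSeries.coeff p.2 (g x)) := by
      ext x
      simp [PowerSeries.coeff_mul]
    rw [this]
    exact (regPoly S).sum_mem fun p _ => (regPoly S).mul_mem (hf _) (hg _)
  one_mem' j := by
    rcases eq_or_ne j 0 with rfl | hj
    · (simp; exact (regPoly S).one_mem)
    · (simp [PowerSeries.coeff_one, hj]; exact (regPoly S).zero_mem)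
  add_mem' {f g} hf hg j := by simpa using! (regPoly S).add_mem (hf j) (hg j)
  zero_mem' j := by (simp; exact (regPoly S).zero_mem)
  neg_mem' {f} hf j := by (simp; exact (regPoly S).neg_mem (hf j))

variable {S}

lemma const_mem (c : ℂ) : (fun _ : ι => c) ∈ S := S.algebraMap_mem c

lemma C_mem_regPoly {f : ι → ℂ} (hf : f ∈ S) : (fun x => C (f x)) ∈ regPoly S := by
  intro j
  rcases eq_or_ne j 0 with rfl | hj
  · simpa using! hf
  · (simp [coeff_C, hj]; exact S.zero_mem)

lemma X_mem_regPoly : (fun _ : ι => (X : ℂ[X])) ∈ regPoly S := fun _ => const_mem _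

lemma twist_mem_regPoly {l : ι → ℂ} (hl : l ∈ S) (i : ℕ) {p : ι → ℂ[X]} (hp : p ∈ regPoly S) :
    (fun x => twist (l x) i (p x)) ∈ regPoly S := by
  intro j
  simp only [coeff_twist]
  exact S.mul_mem (S.add_mem (const_mem _) (S.mul_mem (const_mem _) hl)) (hp j)

lemma mk_mem_regSeries {f : ι → ℕ → ℂ[X]} (hf : ∀ i, (fun x => f x i) ∈ regPoly S) :
    (fun x => PowerSeries.mk (f x)) ∈ regSeries S := by
  intro i
  simpa using! hf i

lemma C_mem_regSeries {f : ι → ℂ[X]} (hf : f ∈ regPoly S) :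
    (fun x => PowerSeries.C (f x)) ∈ regSeries S := by
  intro i
  rcases eq_or_ne i 0 with rfl | hj
  · simpa using! hf
  · (simp [PowerSeries.coeff_C, hj]; exact (regPoly S).zero_mem)

lemma formalODE_mem {a l : ι → ℂ} (ha : a ∈ S) (hl : l ∈ S) {w : ι → ℕ → ℂ[X]}
    (hw : ∀ i, (fun x => w x i) ∈ regPoly S) :
    (fun x => formalODE (a x) (l x) (w x)) ∈ regSeries S := by
  refine homODE_mem (regSeries S) (ξ := fun _ => PowerSeries.X) (s := fun _ => PowerSeries.C X)
    (a2 := fun x => PowerSeries.C (C (a x ^ 2))) (W := fun x => PowerSeries.mk (w x))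
    (W1 := fun x => PowerSeries.mk fun i => twist (l x) i (w x i))
    (W2 := fun x => PowerSeries.mk fun i => twist (l x) i (twist (l x) i (w x i)))
    ?_ ?_ ?_ ?_ ?_ ?_
  · intro i
    rcases eq_or_ne i 1 with rfl | hj
    · (simp; exact (regPoly S).one_mem)
    · (simp [PowerSeries.coeff_X, hj]; exact (regPoly S).zero_mem)
  · exact C_mem_regSeries X_mem_regPoly
  · exact C_mem_regSeries (C_mem_regPoly (S.pow_mem ha 2))
  · exact mk_mem_regSeries hw
  · exact mk_mem_regSeries fun i => twist_mem_regPoly hl i (hw i)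
  · exact mk_mem_regSeries fun i => twist_mem_regPoly hl i (twist_mem_regPoly hl i (hw i))

/-- The coefficients of a family of formal solutions belong to every algebra of functions that
contains the leading coefficient, the parameters, and the inverses of the pivots. -/
theorem formalSolution_mem {a l : ι → ℂ} (ha : a ∈ S) (hl : l ∈ S) {w : ι → ℕ → ℂ[X]}
    (h0 : (fun x => w x 0) ∈ regPoly S)
    (hinv : ∀ i j : ℕ, i ≠ 0 →
      (fun x => (2 * (w x 0).coeff 0 ^ 2 * (i + ((j : ℂ) - i) * l x) ^ 2)⁻¹) ∈ S)
    (hne : ∀ x, ∀ i j : ℕ, i ≠ 0 → 2 * (w x 0).coeff 0 ^ 2 * (i + ((j : ℂ) - i) * l x) ^ 2 ≠ 0)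
    (hE : ∀ x, formalODE (a x) (l x) (w x) = 0) (i : ℕ) : (fun x => w x i) ∈ regPoly S := by
  induction i using Nat.strong_induction_on with
  | _ i ih =>
    rcases eq_or_ne i 0 with rfl | hi
    · exact h0
    -- Truncating below order i makes the linear term at order i vanish for w', so the defect of w'
    -- at order i is minus the operator applied to w_i, and it involves only coefficients already
    -- known to be regular.
    set w' : ι → ℕ → ℂ[X] := fun x j => if j < i then w x j else 0 with hw'
    have hw'S : ∀ j, (fun x => w' x j) ∈ regPoly S := by
      intro j
      by_cases hj : j < i
      · simpa [hw', hj] using! ih j hj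
      · (simp [hw', hj]; exact (regPoly S).zero_mem)
    have hlin : (fun x => linOp (a x) (l x) (w x 0) i (w x i)) ∈ regPoly S := by
      have : (fun x => linOp (a x) (l x) (w x 0) i (w x i))
          = - fun x => PowerSeries.coeff i (formalODE (a x) (l x) (w' x)) := by
        ext1 x
        have h := coeff_formalODE_sub (a := a x) (l := l x) (w := w x) (w' := w' x) hi
          (fun j hj => by simp [hw', hj])
        have z : linOp (a x) (l x) (w' x 0) i (w' x i) = 0 := by
          simp [hw', linOp, linODE, twist]
        have z0 : w' x 0 = w x 0 := by simp [hw', Nat.pos_of_ne_zero hi]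
        rw [hE x, z, z0] at h
        simpa using h.symm
      rw [this]
      exact (regPoly S).neg_mem (formalODE_mem ha hl hw'S i)
    have t0 := twist_mem_regPoly hl 0 h0
    have t00 := twist_mem_regPoly hl 0 t0
    have two : (2 : ι → ℂ[X]) ∈ regPoly S := by
      rw [← one_add_one_eq_two]
      exact (regPoly S).add_mem (regPoly S).one_mem (regPoly S).one_mem
    have wX : (fun x => w x 0) - (fun _ => X) ∈ regPoly S := (regPoly S).sub_mem h0 X_mem_regPoly
    have w2X : 2 * (fun x => w x 0) - (fun _ => X) ∈ regPoly S :=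
      (regPoly S).sub_mem ((regPoly S).mul_mem two h0) X_mem_regPoly
    have c0 : (fun x => linCoef0 (a x) (l x) (w x 0)) ∈ regPoly S :=
      (regPoly S).sub_mem ((regPoly S).sub_mem ((regPoly S).mul_mem two
        ((regPoly S).mul_mem w2X t00)) ((regPoly S).mul_mem two ((regPoly S).pow_mem t0 2)))
        ((regPoly S).mul_mem two ((regPoly S).mul_mem ((regPoly S).mul_mem
          (C_mem_regPoly (S.pow_mem ha 2)) X_mem_regPoly) wX))
    have c1 : (fun x => linCoef1 (l x) (w x 0)) ∈ regPoly S :=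
      (regPoly S).neg_mem ((regPoly S).mul_mem two ((regPoly S).mul_mem w2X t0))
    have c2 : (fun x => linCoef2 (w x 0)) ∈ regPoly S :=
      (regPoly S).mul_mem two ((regPoly S).mul_mem h0 wX)
    intro j
    induction j using Nat.strong_induction_on with
    | _ j ihj =>
      -- Forward substitution: `coeff_linOp` solved for its diagonal term.
      have key : (fun x => (w x i).coeff j) =
          (fun x => (2 * (w x 0).coeff 0 ^ 2 * (i + ((j : ℂ) - i) * l x) ^ 2)⁻¹)
          * ((fun x => (linOp (a x) (l x) (w x 0) i (w x i)).coeff j)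
            - ∑ k ∈ Finset.range j, (fun x => (w x i).coeff k)
              * ((fun x => (linCoef0 (a x) (l x) (w x 0)).coeff (j - k))
              + (fun x => (linCoef1 (l x) (w x 0)).coeff (j - k))
                * (fun x => (i + ((k : ℂ) - i - 1) * l x))
              + (fun x => (linCoef2 (w x 0)).coeff (j - k))
                * (fun x => (i + ((k : ℂ) - i - 1) * l x)) ^ 2)) := by
        ext x
        have hx := hne x i j hi
        simp only [coeff_linOp, Pi.mul_apply, Pi.sub_apply, Finset.sum_apply, Pi.add_apply,
          Pi.pow_apply, add_sub_cancel_right]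
        rw [inv_mul_cancel_left₀ hx]
      rw [key]
      have e : ∀ k : ℕ, (fun x => (i + ((k : ℂ) - i - 1) * l x)) ∈ S := fun k =>
        S.add_mem (const_mem _) (S.mul_mem (const_mem _) hl)
      exact S.mul_mem (hinv i j hi) (S.sub_mem (hlin j) (S.sum_mem fun k hk =>
        S.mul_mem (ihj k (Finset.mem_range.1 hk)) (S.add_mem (S.add_mem (c0 _)
          (S.mul_mem (c1 _) (e k))) (S.mul_mem (c2 _) (S.pow_mem (e k) 2)))))

end Regular

/-! ### Asymptotic expansions along null sequences. -/

section Expansion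

open Polynomial

/-- `f` has the asymptotic expansion `F` in powers of the null sequence `t`. -/
def HasExpansion (t f : ℕ → ℂ) (F : PowerSeries ℂ) : Prop :=
  ∀ M : ℕ, (fun k => f k - (F.trunc M).eval (t k)) =O[atTop] fun k => t k ^ M

lemma eval_trunc (F : PowerSeries ℂ) (M : ℕ) (z : ℂ) :
    (F.trunc M).eval z = ∑ i ∈ Finset.range M, PowerSeries.coeff i F * z ^ i :=
  PowerSeries.eval₂_trunc_eq_sum_range z (RingHom.id ℂ) M F

lemma eval_isBigO {t : ℕ → ℂ} (ht : Tendsto t atTop (𝓝 0)) {p : ℂ[X]} {M : ℕ}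
    (hp : ∀ j < M, p.coeff j = 0) : (fun k => p.eval (t k)) =O[atTop] fun k => t k ^ M := by
  obtain ⟨q, rfl⟩ := X_pow_dvd_iff.2 hp
  have h : (fun k => q.eval (t k)) =O[atTop] fun _ => (1 : ℂ) :=
    ((q.continuous.tendsto 0).comp ht).isBigO_one ℂ
  simpa using (isBigO_refl (fun k => t k ^ M) atTop).mul h

lemma pow_isBigO_pow {t : ℕ → ℂ} (ht : Tendsto t atTop (𝓝 0)) {m n : ℕ} (h : m ≤ n) :
    (fun k => t k ^ n) =O[atTop] fun k => t k ^ m := by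
  simpa using eval_isBigO ht (p := (X : ℂ[X]) ^ n) (M := m)
    (fun j hj => by rw [coeff_X_pow, if_neg (by omega)])

namespace HasExpansion

variable {t f g : ℕ → ℂ} {F G : PowerSeries ℂ}

lemma isBigO_one (h : HasExpansion t f F) : f =O[atTop] fun _ => (1 : ℂ) := by
  simpa using h 0

lemma of_poly (ht : Tendsto t atTop (𝓝 0)) (p : ℂ[X]) :
    HasExpansion t (fun k => p.eval (t k)) (p : PowerSeries ℂ) := fun M => by
  have := eval_isBigO ht (p := p - (p : PowerSeries ℂ).trunc M) (M := M)
    (fun j hj => by simp [PowerSeries.coeff_trunc, hj])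
  simpa using this

lemma const (ht : Tendsto t atTop (𝓝 0)) (c : ℂ) :
    HasExpansion t (fun _ => c) (PowerSeries.C c) := by
  simpa using of_poly ht (C c)

lemma id (ht : Tendsto t atTop (𝓝 0)) : HasExpansion t t PowerSeries.X := by
  simpa using of_poly ht X

lemma add (hf : HasExpansion t f F) (hg : HasExpansion t g G) :
    HasExpansion t (f + g) (F + G) := fun M => by
  refine ((hf M).add (hg M)).congr_left fun k => ?_
  simp only [map_add, eval_add, Pi.add_apply]
  ring

lemma neg (hf : HasExpansion t f F) : HasExpansion t (-f) (-F) := fun M => by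
  refine (hf M).neg_left.congr_left fun k => ?_
  have : (-F).trunc M = -(F.trunc M) := by
    ext n
    simp [PowerSeries.coeff_trunc]
  simp only [this, eval_neg, Pi.neg_apply]
  ring

lemma mul (ht : Tendsto t atTop (𝓝 0)) (hf : HasExpansion t f F) (hg : HasExpansion t g G) :
    HasExpansion t (f * g) (F * G) := fun M => by
  have h1 := (hf M).mul hg.isBigO_one
  have h2 := (((F.trunc M).continuous.tendsto 0).comp ht).isBigO_one ℂ |>.mul (hg M)
  have h3 := eval_isBigO ht (p := F.trunc M * G.trunc M - (F * G).trunc M) (M := M)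
    (fun j hj => by
      rw [coeff_sub, PowerSeries.coeff_trunc, if_pos hj, coeff_mul, PowerSeries.coeff_mul,
        sub_eq_zero]
      refine Finset.sum_congr rfl fun p hp => ?_
      have := Finset.HasAntidiagonal.mem_antidiagonal.1 hp
      rw [PowerSeries.coeff_trunc, PowerSeries.coeff_trunc, if_pos (by omega), if_pos (by omega)])
  simp only [mul_one, one_mul] at h1 h2
  refine ((h1.add h2).add h3).congr_left fun k => ?_
  simp only [eval_sub, eval_mul, Pi.mul_apply, Function.comp]
  ring

/-- A first nonzero coefficient at order j < M would give t^j = O(t^(j+1)), which is impossible for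
a null sequence that is eventually nonzero. -/
lemma eq_zero (ht : Tendsto t atTop (𝓝 0)) (ht0 : ∀ᶠ k in atTop, t k ≠ 0)
    (h : HasExpansion t f F) {M : ℕ} (hf : f =O[atTop] fun k => t k ^ M) :
    ∀ j < M, PowerSeries.coeff j F = 0 := by
  intro j
  induction j using Nat.strong_induction_on with
  | _ j ih =>
    intro hj
    have h1 := (hf.trans (pow_isBigO_pow ht (Nat.succ_le_of_lt hj))).sub (h (j + 1))
    have e : F.trunc (j + 1) = monomial j (PowerSeries.coeff j F) := by
      ext n
      rw [PowerSeries.coeff_trunc, coeff_monomial]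
      rcases lt_trichotomy n j with hn | rfl | hn
      · rw [if_pos (by omega), if_neg (by omega), ih n hn (hn.trans hj)]
      · simp
      · rw [if_neg (by omega), if_neg (by omega)]
    simp only [e, eval_monomial, sub_sub_cancel] at h1
    by_contra hc
    have h2 : (fun k => t k ^ j) =O[atTop] fun k => t k ^ (j + 1) :=
      (isBigO_const_mul_left_iff hc).1 h1
    obtain ⟨B, hB⟩ := h2.bound
    have h3 : Tendsto (fun k => B * ‖t k‖) atTop (𝓝 0) := by
      simpa using (tendsto_norm_zero.comp ht).const_mul B
    obtain ⟨k, hk, hk0, hk1⟩ := (hB.and (ht0.and (h3.eventually_lt_const one_pos))).exists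
    rw [norm_pow, norm_pow, pow_succ] at hk
    have hp : 0 < ‖t k‖ ^ j := pow_pos (norm_pos_iff.2 hk0) j
    nlinarith

lemma eq_zero' (ht : Tendsto t atTop (𝓝 0)) (ht0 : ∀ᶠ k in atTop, t k ≠ 0)
    (h : HasExpansion t f F) (hf : ∀ᶠ k in atTop, f k = 0) : F = 0 := by
  ext j
  have : f =O[atTop] fun k => t k ^ (j + 1) :=
    (isBigO_zero (fun k => t k ^ (j + 1)) atTop).congr' (hf.mono fun k hk => by simp [hk])
      EventuallyEq.rfl
  simpa using h.eq_zero ht ht0 this j (Nat.lt_succ_self j)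

end HasExpansion

/-- The ring of sequences with an asymptotic expansion, paired with their expansions. -/
def expansionRing {t : ℕ → ℂ} (ht : Tendsto t atTop (𝓝 0)) :
    Subring ((ℕ → ℂ) × PowerSeries ℂ) where
  carrier := {p | HasExpansion t p.1 p.2}
  mul_mem' hf hg := HasExpansion.mul ht hf hg
  one_mem' := by simpa using! HasExpansion.const ht 1
  add_mem' hf hg := HasExpansion.add hf hg
  zero_mem' := by simpa using! HasExpansion.const ht 0
  neg_mem' hf := HasExpansion.neg hf

lemma HasExpansion.homODE {t ξ s a2 W W1 W2 : ℕ → ℂ} {ξ' s' a2' W' W1' W2' : PowerSeries ℂ}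
    (ht : Tendsto t atTop (𝓝 0)) (hξ : HasExpansion t ξ ξ') (hs : HasExpansion t s s')
    (ha : HasExpansion t a2 a2') (h : HasExpansion t W W') (h1 : HasExpansion t W1 W1')
    (h2 : HasExpansion t W2 W2') :
    HasExpansion t (fun k => PainleveVI.homODE (ξ k) (s k) (a2 k) (W k) (W1 k) (W2 k))
      (PainleveVI.homODE ξ' s' a2' W' W1' W2') :=
  homODE_mem (expansionRing ht) (ξ := (ξ, ξ')) (s := (s, s')) (a2 := (a2, a2')) (W := (W, W'))
    (W1 := (W1, W1')) (W2 := (W2, W2')) hξ hs ha h h1 h2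

lemma summable_of_geometric {c : ℕ → ℂ} {B ρ : ℝ} (hρ : 0 < ρ) (hc : ∀ i, ‖c i‖ * ρ ^ i ≤ B) {z : ℂ}
    (hz : ‖z‖ < ρ) : Summable fun i => c i * z ^ i := by
  refine Summable.of_norm_bounded ((summable_geometric_of_lt_one (r := ‖z‖ / ρ) (by positivity)
    ((div_lt_one hρ).2 hz)).mul_left B) fun i => ?_
  rw [norm_mul, norm_pow, div_pow, ← mul_div_assoc, le_div_iff₀ (by positivity)]
  nlinarith [hc i, pow_nonneg (norm_nonneg z) i]

lemma norm_tsum_sub_le {c : ℕ → ℂ} {B ρ : ℝ} (hρ : 0 < ρ) (hc : ∀ i, ‖c i‖ * ρ ^ i ≤ B) {z : ℂ}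
    (hz : ‖z‖ ≤ ρ / 2) (M : ℕ) :
    ‖∑' i, c i * z ^ i - ∑ i ∈ Finset.range M, c i * z ^ i‖ ≤ 2 * B * (‖z‖ / ρ) ^ M := by
  have hs := summable_of_geometric hρ hc (z := z) (by linarith)
  rw [← hs.sum_add_tsum_nat_add M, add_sub_cancel_left]
  set q := ‖z‖ / ρ
  have hq0 : 0 ≤ q := by positivity
  have hq : q ≤ 1 / 2 := by
    rw [div_le_iff₀ hρ]
    linarith
  have hB : 0 ≤ B := (by positivity : 0 ≤ ‖c 0‖ * ρ ^ 0).trans (hc 0)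
  refine tsum_of_norm_bounded (g := fun i => B * q ^ M * (1 / 2) ^ i) ?_ fun i => ?_
  · have := (hasSum_geometric_two).mul_left (B * q ^ M)
    rwa [show B * q ^ M * 2 = 2 * B * q ^ M by ring] at this
  · have h1 : ‖c (i + M) * z ^ (i + M)‖ ≤ B * q ^ (i + M) := by
      rw [norm_mul, norm_pow, div_pow, ← mul_div_assoc, le_div_iff₀ (by positivity)]
      nlinarith [hc (i + M), pow_nonneg (norm_nonneg z) (i + M)]
    refine h1.trans ?_
    rw [pow_add, mul_assoc, mul_comm (q ^ M)]
    have := pow_le_pow_left₀ hq0 hq i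
    gcongr

lemma HasExpansion.of_tsum {t : ℕ → ℂ} (ht : Tendsto t atTop (𝓝 0)) {c : ℕ → ℂ} {B ρ : ℝ}
    (hρ : 0 < ρ) (hc : ∀ i, ‖c i‖ * ρ ^ i ≤ B) :
    HasExpansion t (fun k => ∑' i, c i * t k ^ i) (PowerSeries.mk c) := fun M => by
  refine IsBigO.of_bound (2 * B / ρ ^ M) ?_
  have h : ∀ᶠ k in atTop, ‖t k‖ < ρ / 2 :=
    (tendsto_norm_zero.comp ht).eventually_lt_const (by positivity)
  filter_upwards [h] with k hk
  rw [eval_trunc]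
  simp only [PowerSeries.coeff_mk]
  refine (norm_tsum_sub_le hρ hc hk.le M).trans (le_of_eq ?_)
  rw [norm_pow, div_pow]
  ring

end Expansion

/-! ### Re-expansion of the branch around the points x_k(1). -/

section Series

open Polynomial

lemma exp_mem_sheet {φ r : ℝ} {c : ℂ} (hr : Real.exp c.re < r) (hφ : |c.im - φ| < Real.pi) :
    Complex.exp c ∈ sheet φ r ∧ sheetLog φ (Complex.exp c) = c := by
  have him : (c + -(Complex.I * φ)).im = c.im - φ := by simp; ring
  obtain ⟨h1, h2⟩ := abs_lt.1 hφ
  have hlog : Complex.log (Complex.exp (c + -(Complex.I * φ))) = c + -(Complex.I * φ) :=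
    Complex.log_exp (by rw [him]; exact h1) (by rw [him]; exact h2.le)
  refine ⟨⟨by rwa [Complex.norm_exp], ?_⟩, ?_⟩
  · rw [← Complex.exp_add, Complex.mem_slitPlane_iff_arg]
    refine ⟨?_, Complex.exp_ne_zero _⟩
    rw [← Complex.log_im, hlog, him]
    exact h2.ne
  · rw [sheetLog, ← Complex.exp_add, hlog]
    ring

lemma isOpen_sheet (φ r : ℝ) : IsOpen (sheet φ r) := by
  have h1 : IsOpen {x : ℂ | ‖x‖ < r} := isOpen_lt continuous_norm continuous_const
  have h2 : IsOpen {x : ℂ | x * Complex.exp (-(Complex.I * φ)) ∈ Complex.slitPlane} :=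
    Complex.isOpen_slitPlane.preimage (by fun_prop)
  exact h1.inter h2

lemma differentiableOn_yCoeff (A : ℕ → ℤ → ℂ) (ν : ℝ) (d : ℂ) (φ r : ℝ) (n : ℕ) :
    DifferentiableOn ℂ (yCoeff A ν d φ n) (sheet φ r) := by
  have h : DifferentiableOn ℂ (sheetLog φ) (sheet φ r) := by
    unfold sheetLog
    refine DifferentiableOn.add_const _ (DifferentiableOn.clog (by fun_prop) fun x hx => hx.2)
  unfold yCoeff
  refine DifferentiableOn.fun_sum fun m _ => ?_
  exact (h.const_mul _).cexp.const_mul _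

/-- The exponential polynomial in `ω` which is the coefficient of `z ^ i` in the expansion of
`1 / y (z e^ω)`, written through the polynomial `p` in `s = e^{lω}`. -/
noncomputable def expo (l : ℂ) (i : ℕ) (p : ℂ[X]) (ω : ℂ) : ℂ :=
  Complex.exp ((i - (i + 1) * l) * ω) * p.eval (Complex.exp (l * ω))

lemma hasDerivAt_expo (l : ℂ) (i : ℕ) (p : ℂ[X]) (ω : ℂ) :
    HasDerivAt (expo l i p) (expo l i (twist l i p) ω) ω := by
  have h1 : HasDerivAt (fun ω => Complex.exp ((i - (i + 1) * l) * ω))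
      (Complex.exp ((i - (i + 1) * l) * ω) * ((i - (i + 1) * l) * 1)) ω :=
    ((hasDerivAt_id ω).const_mul _).cexp
  have h2 : HasDerivAt (fun ω => Complex.exp (l * ω)) (Complex.exp (l * ω) * (l * 1)) ω :=
    ((hasDerivAt_id ω).const_mul _).cexp
  have h3 := (p.hasDerivAt (Complex.exp (l * ω))).comp ω h2
  refine (h1.mul h3).congr_deriv ?_
  simp only [expo, twist, eval_add, eval_mul, eval_C, eval_X, Function.comp]
  ring

/-- The polynomials `s ^ (i + 1) y_{i + 1}` attached to the coefficients `A`. -/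
noncomputable def coeffPoly (A : ℕ → ℤ → ℂ) (i : ℕ) : ℂ[X] :=
  ∑ m ∈ Finset.Icc (-((i + 1 : ℕ) : ℤ)) ((i + 1 : ℕ) : ℤ),
    C (A (i + 1) m) * X ^ (m + (i + 1 : ℕ)).toNat

lemma natDegree_coeffPoly_le (A : ℕ → ℤ → ℂ) (i : ℕ) :
    (coeffPoly A i).natDegree ≤ 2 * (i + 1) := by
  refine natDegree_sum_le_of_forall_le _ _ fun m hm => (natDegree_C_mul_X_pow_le _ _).trans ?_
  rw [Finset.mem_Icc] at hm
  omega

/-- The centre `ln x_k(1)`. -/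
noncomputable def logZero (ν : ℝ) (d : ℂ) (k : ℕ) : ℂ := -(d / ν) - k * Real.pi / ν

/-- At x_k(1) the factors e^{2imd} x^{2imν} become e^{-2πimk} = 1. The index k survives only through
the power x_k(1)^i, and this is why the coefficients found later are independent of k. -/
lemma yCoeff_exp {A : ℕ → ℤ → ℂ} {ν : ℝ} (hν : 0 < ν) {d : ℂ} {φ : ℝ} (i k : ℕ) {ω : ℂ}
    (h : sheetLog φ (Complex.exp (logZero ν d k + ω)) = logZero ν d k + ω) :
    Complex.exp (logZero ν d k + ω) ^ i * yCoeff A ν d φ (i + 1) (Complex.exp (logZero ν d k + ω))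
      = Complex.exp (logZero ν d k) ^ i * expo (2 * Complex.I * ν) i (coeffPoly A i) ω := by
  have hν' : (ν : ℂ) ≠ 0 := by exact_mod_cast hν.ne'
  rw [yCoeff, h, expo, coeffPoly, eval_finsetSum, Complex.exp_add, mul_pow, mul_assoc]
  congr 1
  rw [Finset.mul_sum, Finset.mul_sum]
  refine Finset.sum_congr rfl fun m hm => ?_
  rw [Finset.mem_Icc] at hm
  simp only [eval_mul, eval_C, eval_pow, eval_X]
  have e1 : ((m + (i + 1 : ℕ)).toNat : ℂ) = m + (i + 1) := by
    have : ((m + (i + 1 : ℕ)).toNat : ℤ) = m + (i + 1 : ℕ) := Int.toNat_of_nonneg (by omega)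
    have := congrArg (Int.cast : ℤ → ℂ) this
    push_cast at this
    exact_mod_cast this
  have e2 : Complex.exp (2 * Complex.I * m * d)
      * Complex.exp (2 * Complex.I * m * ν * (logZero ν d k + ω))
      = Complex.exp (m * (2 * Complex.I * ν) * ω) := by
    rw [← Complex.exp_add, Complex.exp_eq_exp_iff_exists_int]
    -- The two exponents differ by -mk periods 2πi.
    refine ⟨-(m * k), ?_⟩
    rw [logZero]
    field_simp
    push_cast
    ring
  rw [mul_assoc (A (i + 1) m), e2, ← Complex.exp_nat_mul, ← Complex.exp_nat_mul, mul_left_comm,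
    ← Complex.exp_add, mul_left_comm (Complex.exp ((i - (i + 1) * (2 * Complex.I * ν)) * ω)),
    ← Complex.exp_add, e1]
  congr 2
  ring

/-- The quadratic polynomial `s y_1`. -/
noncomputable def leadPoly (μ : ℂ) (ν : ℝ) : ℂ[X] :=
  C ((2 * μ - 1 + 2 * Complex.I * ν) ^ 2 / (16 * ν ^ 2))
    + C (-(((2 * μ - 1) ^ 2 - 4 * ν ^ 2) / (8 * ν ^ 2))) * X
    + C ((2 * μ - 1 - 2 * Complex.I * ν) ^ 2 / (16 * ν ^ 2)) * X ^ 2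

/-- The expansion of `Y = 1 / y` around the points `x_k(1)`, in terms of the polynomials `w i`. -/
structure IsSeries (μ : ℂ) (ν : ℝ) (d : ℂ) (φ r : ℝ) (y : ℂ → ℂ) (w : ℕ → ℂ[X]) (Y : ℂ → ℂ)
    (η ρ B : ℝ) : Prop where
  η_pos : 0 < η
  ρ_pos : 0 < ρ
  lead : w 0 = leadPoly μ ν
  natDegree_le : ∀ i, (w i).natDegree ≤ 2 * (i + 1)
  bound : ∀ i ω, ‖ω‖ ≤ η → ‖expo (2 * Complex.I * ν) i (w i) ω‖ * ρ ^ i ≤ B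
  hasSum : ∀ᶠ k in atTop, ∀ ω : ℂ, ‖ω‖ ≤ η →
    Complex.exp (logZero ν d k) * Complex.exp ω ∈ sheet φ r ∧
    HasSum (fun i => expo (2 * Complex.I * ν) i (w i) ω * Complex.exp (logZero ν d k) ^ i)
      (Y (Complex.exp (logZero ν d k) * Complex.exp ω))
  differentiableOn : DifferentiableOn ℂ Y (sheet φ r)
  eq_inv : ∀ x ∈ sheet φ r, Y x ≠ 0 → y x = 1 / Y x

/-- Uniform convergence on one compact neighbourhood of a single point x_{k₁}(1) bounds the terms of
the series there. Because the coefficients are the same for all k, this gives bounds of Cauchy type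
with ρ = |x_{k₁}(1)|, and geometric convergence at every later x_k(1), uniformly in ω. -/
lemma exists_series {μ : ℂ} {ν : ℝ} {d : ℂ} {φ r : ℝ} {y : ℂ → ℂ} (hν : 0 < ν)
    (hb : IsBranch μ ν d φ r y) (hα : |rayAngle μ ν d 0 - φ| < Real.pi) :
    ∃ (w : ℕ → ℂ[X]) (Y : ℂ → ℂ) (η ρ B : ℝ), IsSeries μ ν d φ r y w Y η ρ B := by
  obtain ⟨hr, -, A, hA1, hA2, hA3, Y, hY, hy⟩ := hb
  set l : ℂ := 2 * Complex.I * ν with hl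
  set T : ℕ → ℂ → ℂ := fun n x => x ^ (n - 1) * yCoeff A ν d φ n x
  have hYd : DifferentiableOn ℂ Y (sheet φ r) := by
    refine hY.differentiableOn (Eventually.of_forall fun M => ?_) (isOpen_sheet φ r)
    exact DifferentiableOn.fun_sum fun n _ =>
      DifferentiableOn.mul (by fun_prop) (differentiableOn_yCoeff A ν d φ r n)
  -- Half the angular gap between the ray and the cut: a shift |ω| ≤ η stays on the sheet, where the
  -- logarithm takes the expected value.
  set η := (Real.pi - |rayAngle μ ν d 0 - φ|) / 2 with hη
  have hη0 : 0 < η := by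
    rw [hη]
    linarith
  have him : ∀ k, (logZero ν d k).im = rayAngle μ ν d 0 := by
    intro k
    have : ((k : ℂ) * Real.pi / ν) = ((k * Real.pi / ν : ℝ) : ℂ) := by push_cast; rfl
    rw [logZero, this, Complex.sub_im, Complex.ofReal_im]
    simp [rayAngle]
  have hre : ∀ k, (logZero ν d k).re = -(d.re / ν) - k * (Real.pi / ν) := by
    intro k
    have : ((k : ℂ) * Real.pi / ν) = ((k * Real.pi / ν : ℝ) : ℂ) := by push_cast; rfl
    rw [logZero, this, Complex.sub_re, Complex.ofReal_re]
    simp [mul_div_assoc]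
  have hpν : 0 < Real.pi / ν := div_pos Real.pi_pos hν
  have hsm : ∀ᶠ k : ℕ in atTop, (logZero ν d k).re + η < Real.log r := by
    have : Tendsto (fun k : ℕ => (k : ℝ) * (Real.pi / ν)) atTop atTop :=
      tendsto_natCast_atTop_atTop.atTop_mul_const hpν
    filter_upwards [this.eventually_gt_atTop (-(d.re / ν) + η - Real.log r)] with k hk
    rw [hre]
    linarith
  obtain ⟨k₁, hk₁⟩ := eventually_atTop.1 hsm
  have hsheet : ∀ k ≥ k₁, ∀ ω : ℂ, ‖ω‖ ≤ η → Complex.exp (logZero ν d k + ω) ∈ sheet φ r ∧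
      sheetLog φ (Complex.exp (logZero ν d k + ω)) = logZero ν d k + ω := by
    intro k hk ω hω
    refine exp_mem_sheet ?_ ?_
    · rw [← Real.lt_log_iff_exp_lt hr, Complex.add_re]
      linarith [hk₁ k hk, (Complex.abs_re_le_norm ω).trans hω, le_abs_self ω.re]
    · rw [Complex.add_im, him]
      have h1 := (Complex.abs_im_le_norm ω).trans hω
      have h2 : |rayAngle μ ν d 0 + ω.im - φ| ≤ |rayAngle μ ν d 0 - φ| + |ω.im| := by
        rw [show rayAngle μ ν d 0 + ω.im - φ = (rayAngle μ ν d 0 - φ) + ω.im by ring]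
        exact abs_add_le _ _
      have h3 : |rayAngle μ ν d 0 - φ| + 2 * η = Real.pi := by rw [hη]; ring
      linarith
  have hterm : ∀ k ≥ k₁, ∀ ω : ℂ, ‖ω‖ ≤ η → ∀ i, T (i + 1) (Complex.exp (logZero ν d k + ω))
      = Complex.exp (logZero ν d k) ^ i * expo l i (coeffPoly A i) ω := fun k hk ω hω i =>
    yCoeff_exp hν i k (hsheet k hk ω hω).2
  have hpart : ∀ M x, ∑ n ∈ Finset.Icc 1 M, x ^ (n - 1) * yCoeff A ν d φ n x
      = ∑ i ∈ Finset.range M, T (i + 1) x := by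
    intro M x
    rw [Finset.range_eq_Ico, Finset.sum_Ico_add' (fun n => T n x) 0 M 1]
    rfl
  set ρ := ‖Complex.exp (logZero ν d k₁)‖ with hρ
  have hρ0 : 0 < ρ := norm_pos_iff.2 (Complex.exp_ne_zero _)
  have hbound : ∃ B, ∀ i ω, ‖ω‖ ≤ η → ‖expo l i (coeffPoly A i) ω‖ * ρ ^ i ≤ B := by
    set K := (fun ω => Complex.exp (logZero ν d k₁ + ω)) '' Metric.closedBall 0 η
    have hK : IsCompact K := (isCompact_closedBall 0 η).image (by fun_prop)
    have hKs : K ⊆ sheet φ r := by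
      rintro _ ⟨ω, hω, rfl⟩
      exact (hsheet k₁ le_rfl ω (by simpa using hω)).1
    have hU := (tendstoLocallyUniformlyOn_iff_forall_isCompact (isOpen_sheet φ r)).1 hY K hKs hK
    obtain ⟨M₀, hM₀⟩ := eventually_atTop.1 (Metric.tendstoUniformlyOn_iff.1 hU 1 one_pos)
    have hcont : ∀ i, Continuous (expo l i (coeffPoly A i)) := fun i =>
      continuous_iff_continuousAt.2 fun ω => (hasDerivAt_expo l i _ ω).continuousAt
    choose b hb using fun i => (isCompact_closedBall (0 : ℂ) η).exists_bound_of_continuousOn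
      (hcont i).continuousOn
    have hb0 : ∀ i, 0 ≤ b i := fun i => (norm_nonneg _).trans (hb i 0 (by simp [hη0.le]))
    -- From index M₀ on, a term is the difference of two partial sums that are both within 1 of the
    -- limit, hence is bounded by 2; the finitely many earlier terms are bounded by compactness.
    refine ⟨2 + ∑ i ∈ Finset.range M₀, b i * ρ ^ i, fun i ω hω => ?_⟩
    have hω' : ω ∈ Metric.closedBall (0 : ℂ) η := by simpa using hω
    have hnn : ∀ j, 0 ≤ b j * ρ ^ j := fun j => mul_nonneg (hb0 j) (by positivity)
    rcases lt_or_ge i M₀ with hi | hi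
    · have h1 := Finset.single_le_sum (f := fun j => b j * ρ ^ j) (fun j _ => hnn j)
        (Finset.mem_range.2 hi)
      have h2 : ‖expo l i (coeffPoly A i) ω‖ * ρ ^ i ≤ b i * ρ ^ i := by
        gcongr
        exact hb i ω hω'
      linarith
    · have hx : Complex.exp (logZero ν d k₁ + ω) ∈ K := ⟨ω, hω', rfl⟩
      have h1 := hM₀ (i + 1) (by omega) _ hx
      have h2 := hM₀ i hi _ hx
      rw [hpart] at h1 h2
      rw [Finset.sum_range_succ] at h1
      have h3 : T (i + 1) (Complex.exp (logZero ν d k₁ + ω)) =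
          (Y (Complex.exp (logZero ν d k₁ + ω))
            - ∑ j ∈ Finset.range i, T (j + 1) (Complex.exp (logZero ν d k₁ + ω)))
          - (Y (Complex.exp (logZero ν d k₁ + ω))
            - (∑ j ∈ Finset.range i, T (j + 1) (Complex.exp (logZero ν d k₁ + ω))
              + T (i + 1) (Complex.exp (logZero ν d k₁ + ω)))) := by ring
      have h4 := norm_sub_le (Y (Complex.exp (logZero ν d k₁ + ω))
            - ∑ j ∈ Finset.range i, T (j + 1) (Complex.exp (logZero ν d k₁ + ω)))
          (Y (Complex.exp (logZero ν d k₁ + ω))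
            - (∑ j ∈ Finset.range i, T (j + 1) (Complex.exp (logZero ν d k₁ + ω))
              + T (i + 1) (Complex.exp (logZero ν d k₁ + ω))))
      rw [← h3, hterm k₁ le_rfl ω hω, norm_mul, norm_pow, ← hρ] at h4
      rw [dist_eq_norm] at h1 h2
      have h5 : 0 ≤ ∑ i ∈ Finset.range M₀, b i * ρ ^ i := Finset.sum_nonneg fun j _ => hnn j
      rw [hterm k₁ le_rfl ω hω] at h1
      rw [mul_comm]
      linarith
  obtain ⟨B, hB⟩ := hbound
  refine ⟨coeffPoly A, Y, η, ρ, B, hη0, hρ0, ?_, natDegree_coeffPoly_le A, hB, ?_, hYd, hy⟩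
  · have e : Finset.Icc (-((0 + 1 : ℕ) : ℤ)) ((0 + 1 : ℕ) : ℤ) = {-1, 0, 1} := by decide
    rw [coeffPoly, e, Finset.sum_insert (by decide), Finset.sum_insert (by decide),
      Finset.sum_singleton]
    rw [leadPoly, ← hA1, ← hA2, ← hA3]
    simp
    ring
  · filter_upwards [eventually_gt_atTop k₁] with k hk ω hω
    rw [← Complex.exp_add]
    have hs := hsheet k hk.le ω hω
    refine ⟨hs.1, ?_⟩
    have hlt : ‖Complex.exp (logZero ν d k)‖ < ρ := by
      rw [hρ, Complex.norm_exp, Complex.norm_exp, Real.exp_lt_exp, hre, hre]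
      have : (k₁ : ℝ) < k := by exact_mod_cast hk
      nlinarith
    have hsum := summable_of_geometric hρ0 (fun i => hB i ω hω) hlt
    have ht := (hY.tendsto_at hs.1)
    simp only [hpart] at ht
    have ht' := hsum.hasSum.tendsto_sum_nat
    have : (fun M => ∑ i ∈ Finset.range M, T (i + 1) (Complex.exp (logZero ν d k + ω)))
        = fun M => ∑ i ∈ Finset.range M,
          expo l i (coeffPoly A i) ω * Complex.exp (logZero ν d k) ^ i := by
      ext M
      refine Finset.sum_congr rfl fun i _ => ?_
      rw [hterm k hk.le ω hω, mul_comm]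
    rw [this] at ht
    rw [tendsto_nhds_unique ht ht']
    exact hsum.hasSum

end Series

/-! ### The equation for 1/y and its transfer to the series. -/

section Transform

open Polynomial

lemma homODE_scale {R : Type*} [CommRing R] (ξ s a2 u u1 u2 : R) :
    homODE ξ s a2 (s * u) (s * u1) (s * u2) = s ^ 3 * homODE (ξ * s) 1 a2 u u1 u2 := by
  unfold homODE
  ring

lemma homODE_of_pviRHS {μ x u u1 u2 : ℂ} (hx0 : x ≠ 0) (hx1 : x ≠ 1) (h0 : u ≠ 0) (h1 : u ≠ 1)
    (h2 : x * u ≠ 1)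
    (h : (-u2 * u ^ 2 + u1 * (2 * u * u1)) / u ^ 4 = pviRHS μ x u⁻¹ (-u1 / u ^ 2)) :
    homODE x 1 ((2 * μ - 1) ^ 2) u (x * u1) (x ^ 2 * u2 + x * u1) = 0 := by
  have n1 : (1 : ℂ) - u ≠ 0 := sub_ne_zero.2 (Ne.symm h1)
  have n2 : (1 : ℂ) - x * u ≠ 0 := sub_ne_zero.2 (Ne.symm h2)
  have n3 : x - 1 ≠ 0 := sub_ne_zero.2 hx1
  have n4 : u⁻¹ - 1 = (1 - u) / u := by field_simp
  have n5 : u⁻¹ - x = (1 - x * u) / u := by field_simp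
  -- The polynomial form is the equation for y cleared of denominators; the cofactor shows which
  -- ones.
  have key : homODE x 1 ((2 * μ - 1) ^ 2) u (x * u1) (x ^ 2 * u2 + x * u1)
      = 2 * u ^ 3 * x ^ 2 * (1 - u) * (1 - x * u) * (x - 1) ^ 2
        * ((-u2 * u ^ 2 + u1 * (2 * u * u1)) / u ^ 4 - pviRHS μ x u⁻¹ (-u1 / u ^ 2)) := by
    unfold homODE pviRHS
    rw [n4, n5]
    field_simp
    ring
  rw [key, h, sub_self, mul_zero]

/-- The equation for `Y = 1 / y`, in terms of `Y`, `x Y'` and `x² Y'' + x Y'`. -/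
lemma homODE_of_pvi {μ : ℂ} {y Y : ℂ → ℂ} {U : Set ℂ} (hU : IsOpen U) (hy : SolvesPVI μ y U)
    (hY : DifferentiableOn ℂ Y U) (hyY : ∀ x ∈ U, Y x ≠ 0 → y x = 1 / Y x) {x : ℂ} (hx : x ∈ U)
    (hx0 : x ≠ 0) (hx1 : x ≠ 1) (h0 : Y x ≠ 0) (h1 : Y x ≠ 1) (h2 : x * Y x ≠ 1) :
    homODE x 1 ((2 * μ - 1) ^ 2) (Y x) (x * deriv Y x)
      (x ^ 2 * deriv (deriv Y) x + x * deriv Y x) = 0 := by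
  have hYa : ∀ᶠ z in 𝓝 x, AnalyticAt ℂ Y z ∧ Y z ≠ 0 ∧ y z = 1 / Y z := by
    have hc : ContinuousAt Y x := (hY.analyticAt (hU.mem_nhds hx)).continuousAt
    filter_upwards [hU.mem_nhds hx, hc.eventually_ne h0] with z hz hz0
    exact ⟨hY.analyticAt (hU.mem_nhds hz), hz0, hyY z hz hz0⟩
  have ey : y =ᶠ[𝓝 x] fun z => (Y z)⁻¹ := hYa.mono fun z hz => by rw [hz.2.2, one_div]
  have hd1 : ∀ᶠ z in 𝓝 x, deriv y z = -deriv Y z / Y z ^ 2 := by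
    filter_upwards [ey.eventuallyEq_nhds, hYa] with z hz hz'
    rw [hz.deriv_eq]
    exact (hz'.1.differentiableAt.hasDerivAt.inv hz'.2.1).deriv
  obtain ⟨hYx, -, hyx⟩ := hYa.self_of_nhds
  have hd2 : deriv (deriv y) x
      = (-deriv (deriv Y) x * Y x ^ 2 + deriv Y x * (2 * Y x * deriv Y x)) / Y x ^ 4 := by
    rw [EventuallyEq.deriv_eq hd1]
    have a1 := hYx.differentiableAt.hasDerivAt
    have a2 := hYx.deriv.differentiableAt.hasDerivAt
    have := (a2.neg.div (a1.pow 2) (pow_ne_zero 2 h0)).deriv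
    refine Eq.trans this ?_
    simp only [Pi.neg_apply, Pi.pow_apply]
    congr 1
    · push_cast
      ring
    · ring
  have hA : AnalyticAt ℂ y x := (hYx.inv h0).congr ey.symm
  have hyx' : y x = (Y x)⁻¹ := by rw [hyx, one_div]
  have hode := hy.2 x hx hA hx0 hx1 (by rw [hyx']; exact inv_ne_zero h0)
    (by rw [hyx']; intro h; exact h1 (inv_eq_one.1 h))
    (by
      rw [hyx']
      intro h
      exact h2 ((congrArg (· * Y x) h.symm).trans (inv_mul_cancel₀ h0)))
  rw [hd2, hd1.self_of_nhds, hyx'] at hode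
  exact homODE_of_pviRHS hx0 hx1 h0 h1 h2 hode

/-- The sum of the series `∑ z ^ i q_i(ω)`, where `q_i` is the exponential polynomial of `p i`. -/
noncomputable def ser (l : ℂ) (p : ℕ → ℂ[X]) (z ω : ℂ) : ℂ := ∑' i, expo l i (p i) ω * z ^ i

/-- A Cauchy bound for the coefficients of `ser`. -/
def SerBound (l : ℂ) (p : ℕ → ℂ[X]) (η ρ B : ℝ) : Prop :=
  ∀ i ω, ‖ω‖ ≤ η → ‖expo l i (p i) ω‖ * ρ ^ i ≤ B

lemma differentiable_expo (l : ℂ) (i : ℕ) (p : ℂ[X]) : Differentiable ℂ (expo l i p) :=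
  fun ω => (hasDerivAt_expo l i p ω).differentiableAt

namespace SerBound

variable {l : ℂ} {p : ℕ → ℂ[X]} {η ρ B : ℝ}

/-- Cauchy's estimate on a circle of radius η/2, at the price of half the domain in ω. -/
lemma twist (hη : 0 < η) (hρ : 0 < ρ) (h : SerBound l p η ρ B) :
    SerBound l (fun i => twist l i (p i)) (η / 2) ρ (B / (η / 2)) := by
  intro i ω hω
  have h1 := Complex.norm_deriv_le_of_forall_mem_sphere_norm_le (c := ω) (R := η / 2)
    (C := B / ρ ^ i) (f := expo l i (p i)) (by positivity)
    (differentiable_expo l i (p i)).diffContOnCl (fun z hz => by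
      rw [le_div_iff₀ (by positivity)]
      refine h i z ?_
      have h2 : ‖z - ω‖ = η / 2 := by simpa [dist_eq_norm] using hz
      have h3 := norm_add_le (z - ω) ω
      rw [sub_add_cancel] at h3
      linarith)
  rw [(hasDerivAt_expo l i (p i) ω).deriv] at h1
  calc _ ≤ B / ρ ^ i / (η / 2) * ρ ^ i := by gcongr
    _ = _ := by field_simp

lemma hasDerivAt (hρ : 0 < ρ) (h : SerBound l p η ρ B) {z ω : ℂ} (hz : ‖z‖ < ρ) (hω : ‖ω‖ < η) :
    HasDerivAt (ser l p z) (ser l (fun i => PainleveVI.twist l i (p i)) z ω) ω := by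
  set u : ℕ → ℝ := fun i => B * (‖z‖ / ρ) ^ i
  have hu : Summable u := (summable_geometric_of_lt_one (by positivity)
    ((div_lt_one hρ).2 hz)).mul_left B
  have hd : ∀ i, DifferentiableOn ℂ (fun ω => expo l i (p i) ω * z ^ i) (Metric.ball 0 η) :=
    fun i => ((differentiable_expo l i (p i)).mul_const _).differentiableOn
  have hle : ∀ i w, w ∈ Metric.ball (0 : ℂ) η → ‖expo l i (p i) w * z ^ i‖ ≤ u i := by
    intro i w hw
    have h1 := h i w (by simpa using (Metric.mem_ball.1 hw).le)
    show _ ≤ B * (‖z‖ / ρ) ^ i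
    rw [norm_mul, norm_pow, div_pow, ← mul_div_assoc, le_div_iff₀ (by positivity)]
    nlinarith [pow_nonneg (norm_nonneg z) i]
  have hω' : ω ∈ Metric.ball (0 : ℂ) η := by simpa using hω
  have h1 := Complex.hasSum_deriv_of_summable_norm hu hd Metric.isOpen_ball hle hω'
  have h2 := (Complex.differentiableOn_tsum_of_summable_norm hu hd Metric.isOpen_ball hle)
    |>.differentiableAt (Metric.isOpen_ball.mem_nhds hω')
  have h3 : ser l (fun i => PainleveVI.twist l i (p i)) z ω
      = deriv (fun w => ∑' i, expo l i (p i) w * z ^ i) ω := by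
    rw [← h1.tsum_eq, ser]
    congr 1
    ext i
    exact (((hasDerivAt_expo l i (p i) ω).mul_const (z ^ i)).deriv).symm
  rw [h3]
  exact h2.hasDerivAt

lemma norm_sub_le (hρ : 0 < ρ) (h : SerBound l p η ρ B) {z ω : ℂ} (hz : ‖z‖ ≤ ρ / 2)
    (hω : ‖ω‖ ≤ η) (M : ℕ) :
    ‖ser l p z ω - ∑ i ∈ Finset.range M, expo l i (p i) ω * z ^ i‖ ≤ 2 * B * (‖z‖ / ρ) ^ M :=
  norm_tsum_sub_le hρ (fun i => h i ω hω) hz M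

lemma mono {η' : ℝ} (hη : η' ≤ η) (h : SerBound l p η ρ B) : SerBound l p η' ρ B :=
  fun i ω hω => h i ω (hω.trans hη)

end SerBound

section Branch

variable {μ : ℂ} {ν : ℝ} {d : ℂ} {φ r : ℝ} {y : ℂ → ℂ} {w : ℕ → ℂ[X]} {Y : ℂ → ℂ} {η ρ B : ℝ}

lemma tendsto_exp_logZero (hν : 0 < ν) (d : ℂ) :
    Tendsto (fun k => Complex.exp (logZero ν d k)) atTop (𝓝 0) := by
  rw [Complex.tendsto_exp_nhds_zero_iff]
  have h : ∀ k, (logZero ν d k).re = -(d.re / ν) - k * (Real.pi / ν) := by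
    intro k
    have : ((k : ℂ) * Real.pi / ν) = ((k * Real.pi / ν : ℝ) : ℂ) := by push_cast; rfl
    rw [logZero, this, Complex.sub_re, Complex.ofReal_re]
    simp [mul_div_assoc]
  simp only [h]
  exact tendsto_atBot_add_const_left _ _ (tendsto_neg_atTop_atBot.comp
    (tendsto_natCast_atTop_atTop.atTop_mul_const (div_pos Real.pi_pos hν)))

/-- Near `x_k(1)`, the function `Y` is the sum of the series, and so are its derivatives. -/
lemma IsSeries.eventually_eq (h : IsSeries μ ν d φ r y w Y η ρ B) (hν : 0 < ν) :
    ∀ᶠ k in atTop, ∀ ω : ℂ, ‖ω‖ < η / 2 →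
      let x := Complex.exp (logZero ν d k) * Complex.exp ω
      let l := 2 * Complex.I * ν
      x ∈ sheet φ r ∧ Y x = ser l w (Complex.exp (logZero ν d k)) ω ∧
      x * deriv Y x = ser l (fun i => twist l i (w i)) (Complex.exp (logZero ν d k)) ω ∧
      x ^ 2 * deriv (deriv Y) x + x * deriv Y x
        = ser l (fun i => twist l i (twist l i (w i))) (Complex.exp (logZero ν d k)) ω := by
  have hlt := (tendsto_norm_zero.comp (tendsto_exp_logZero hν d)).eventually_lt_const h.ρ_pos
  filter_upwards [h.hasSum, hlt] with k hk hkρ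
  have hη := h.η_pos
  set l := 2 * Complex.I * ν
  set X := Complex.exp (logZero ν d k)
  have b0 : SerBound l w η ρ B := h.bound
  have b1 := b0.twist h.η_pos h.ρ_pos
  have hx : ∀ ω : ℂ, HasDerivAt (fun ω => X * Complex.exp ω) (X * Complex.exp ω) ω := fun ω =>
    (Complex.hasDerivAt_exp ω).const_mul X
  have hball : ∀ ω : ℂ, ‖ω‖ < η / 2 → ∀ᶠ ω' in 𝓝 ω, ‖ω'‖ < η / 2 := fun ω hω =>
    continuous_norm.continuousAt.eventually_lt continuousAt_const hω
  have hY : ∀ x ∈ sheet φ r, AnalyticAt ℂ Y x := fun x hx =>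
    h.differentiableOn.analyticAt ((isOpen_sheet φ r).mem_nhds hx)
  have e0 : ∀ ω : ℂ, ‖ω‖ < η / 2 → Y (X * Complex.exp ω) = ser l w X ω := fun ω hω =>
    (hk ω (by linarith)).2.tsum_eq.symm
  have e1 : ∀ ω : ℂ, ‖ω‖ < η / 2 → X * Complex.exp ω * deriv Y (X * Complex.exp ω)
      = ser l (fun i => twist l i (w i)) X ω := by
    intro ω hω
    have d1 := b0.hasDerivAt h.ρ_pos hkρ (by linarith : ‖ω‖ < η)
    have d2 := (hY _ (hk ω (by linarith)).1).differentiableAt.hasDerivAt.comp ω (hx ω)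
    have := (d1.congr_of_eventuallyEq ((hball ω hω).mono fun ω' h' => e0 ω' h')).unique d2
    rw [this, mul_comm]
  intro ω hω
  refine ⟨(hk ω (by linarith)).1, e0 ω hω, e1 ω hω, ?_⟩
  have d1 := b1.hasDerivAt h.ρ_pos hkρ hω
  have d2 := (hx ω).mul
    ((hY _ (hk ω (by linarith)).1).deriv.differentiableAt.hasDerivAt.comp ω (hx ω))
  have := (d1.congr_of_eventuallyEq ((hball ω hω).mono fun ω' h' => e1 ω' h')).unique d2
  rw [this, Function.comp]
  ring

/-- The equation in terms of the series. -/
lemma IsSeries.homODE_eq_zero (h : IsSeries μ ν d φ r y w Y η ρ B) (hν : 0 < ν)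
    (hy : SolvesPVI μ y (sheet φ r)) :
    ∀ᶠ k in atTop, ∀ ω : ℂ, ‖ω‖ < η / 2 →
      let X := Complex.exp (logZero ν d k)
      let l := 2 * Complex.I * ν
      ser l w X ω ≠ 0 → ser l w X ω ≠ 1 → X * Complex.exp ω * ser l w X ω ≠ 1 →
      homODE (X * Complex.exp ω) 1 ((2 * μ - 1) ^ 2) (ser l w X ω)
        (ser l (fun i => twist l i (w i)) X ω)
        (ser l (fun i => twist l i (twist l i (w i))) X ω) = 0 := by
  -- The threshold e^{-η/2} forces |x| < 1, which rules out the singular point x = 1.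
  have hlt := (tendsto_norm_zero.comp (tendsto_exp_logZero hν d)).eventually_lt_const
    (Real.exp_pos (-(η / 2)))
  filter_upwards [h.eventually_eq hν, hlt] with k hk hk1 ω hω
  obtain ⟨hx, e0, e1, e2⟩ := hk ω hω
  intro X l h0 h1 h2
  rw [← e0] at h0 h1 h2 ⊢
  rw [← e1, ← e2]
  refine homODE_of_pvi (isOpen_sheet φ r) hy h.differentiableOn h.eq_inv hx
    (mul_ne_zero (Complex.exp_ne_zero _) (Complex.exp_ne_zero _)) ?_ h0 h1 h2
  intro h3
  have h4 := congrArg norm h3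
  have h5 : ‖Complex.exp ω‖ ≤ Real.exp (η / 2) := by
    rw [Complex.norm_exp, Real.exp_le_exp]
    exact (Complex.re_le_norm ω).trans hω.le
  rw [norm_mul, norm_one] at h4
  have h6 : ‖X‖ * ‖Complex.exp ω‖ < Real.exp (-(η / 2)) * Real.exp (η / 2) :=
    mul_lt_mul hk1 h5 (norm_pos_iff.2 (Complex.exp_ne_zero _)) (Real.exp_pos _).le
  rw [← Real.exp_add, neg_add_cancel, Real.exp_zero] at h6
  linarith

end Branch

end Transform

/-! ### From the analytic branch to the formal solution. -/

section Formal

open Polynomial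

lemma expo_zero (l : ℂ) (i : ℕ) (p : ℂ[X]) : expo l i p 0 = p.eval 1 := by simp [expo]

lemma eval_twist (l : ℂ) (i : ℕ) (p : ℂ[X]) (s : ℂ) :
    (twist l i p).eval s = (i - (i + 1) * l) * p.eval s + l * (s * (derivative p).eval s) := by
  simp [twist]

lemma expo_eq (l : ℂ) (i : ℕ) (p : ℂ[X]) (ω z : ℂ) :
    Complex.exp (l * ω) * (expo l i p ω * z ^ i)
      = p.eval (Complex.exp (l * ω)) * (z * Complex.exp ω / Complex.exp (l * ω)) ^ i := by
  have h : Complex.exp ((i - (i + 1) * l) * ω) * Complex.exp (l * ω)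
      = (Complex.exp ω / Complex.exp (l * ω)) ^ i := by
    rw [← Complex.exp_sub, ← Complex.exp_nat_mul, ← Complex.exp_add]
    congr 1
    ring
  rw [expo, mul_div_assoc, mul_pow, ← h]
  ring

/-- `leadPoly` in terms of `a = 2μ - 1` and `l = 2iν`. -/
noncomputable def quadPoly (a l : ℂ) : ℂ[X] :=
  C (-(a + l) ^ 2 / (4 * l ^ 2)) + C ((a ^ 2 + l ^ 2) / (2 * l ^ 2)) * X
    + C (-(a - l) ^ 2 / (4 * l ^ 2)) * X ^ 2

lemma leadPoly_eq (μ : ℂ) {ν : ℝ} (hν : 0 < ν) :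
    leadPoly μ ν = quadPoly (2 * μ - 1) (2 * Complex.I * ν) := by
  have hν' : (ν : ℂ) ≠ 0 := by exact_mod_cast hν.ne'
  have h2 : (2 * Complex.I * ν : ℂ) ^ 2 = -(4 * ν ^ 2) := by
    rw [mul_pow, mul_pow, Complex.I_sq]
    ring
  have e1 : (2 * μ - 1 + 2 * Complex.I * ν) ^ 2 / (16 * (ν : ℂ) ^ 2)
      = -(2 * μ - 1 + 2 * Complex.I * ν) ^ 2 / (4 * -(4 * ν ^ 2)) := by
    field_simp
    norm_num
  have e2 : -(((2 * μ - 1) ^ 2 - 4 * (ν : ℂ) ^ 2) / (8 * ν ^ 2))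
      = ((2 * μ - 1) ^ 2 + -(4 * ν ^ 2)) / (2 * -(4 * ν ^ 2)) := by
    field_simp
    ring
  have e3 : (2 * μ - 1 - 2 * Complex.I * ν) ^ 2 / (16 * (ν : ℂ) ^ 2)
      = -(2 * μ - 1 - 2 * Complex.I * ν) ^ 2 / (4 * -(4 * ν ^ 2)) := by
    field_simp
    norm_num
  rw [leadPoly, quadPoly, h2, e1, e2, e3]

section Quad

variable {a l : ℂ}

lemma eval_quadPoly_one (hl : l ≠ 0) : (quadPoly a l).eval 1 = 0 := by
  simp only [quadPoly, eval_add, eval_mul, eval_C, eval_X, eval_pow]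
  field_simp
  ring

lemma eval_twist_quadPoly_one (hl : l ≠ 0) : (twist l 0 (quadPoly a l)).eval 1 = a := by
  rw [eval_twist, eval_quadPoly_one hl]
  simp [quadPoly]
  field_simp
  ring

lemma eval_twist_twist_quadPoly_one (hl : l ≠ 0) :
    (twist l 0 (twist l 0 (quadPoly a l))).eval 1 = -(a ^ 2 + l ^ 2) / 2 := by
  rw [eval_twist, eval_twist_quadPoly_one hl, twist, quadPoly]
  simp
  field_simp
  ring

/-- If the function vanished near 0, so would its first two derivatives there, which are a and -(a²
+ l²)/2; this would force l = 0. -/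
lemma eventually_expo_quadPoly_ne_zero (hl : l ≠ 0) :
    ∀ᶠ ω in 𝓝[≠] (0 : ℂ), expo l 0 (quadPoly a l) ω ≠ 0 := by
  refine ((differentiable_expo l 0 (quadPoly a l)).analyticAt 0).eventually_eq_zero_or_eventually_ne_zero.resolve_left
    fun h => ?_
  have step : ∀ p : ℂ[X], (∀ᶠ ω in 𝓝 (0 : ℂ), expo l 0 p ω = 0) →
      ∀ᶠ ω in 𝓝 (0 : ℂ), expo l 0 (twist l 0 p) ω = 0 := by
    intro p hp
    filter_upwards [hp.eventually_nhds] with ω hω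
    rw [← (hasDerivAt_expo l 0 p ω).deriv, EventuallyEq.deriv_eq (f := fun _ => (0 : ℂ)) hω]
    simp
  have h1 := (step _ h).self_of_nhds
  have h2 := (step _ (step _ h)).self_of_nhds
  rw [expo_zero, eval_twist_quadPoly_one hl] at h1
  rw [expo_zero, eval_twist_twist_quadPoly_one hl, h1] at h2
  simp [hl] at h2

end Quad

/-- The map ω ↦ e^{lω} has nonzero derivative at 0, so it carries punctured neighbourhoods of 0 to
points accumulating at 1, where a nonzero polynomial has only isolated roots. -/
lemma eq_zero_of_eval_exp {l : ℂ} (hl : l ≠ 0) {p : ℂ[X]}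
    (h : ∀ᶠ ω in 𝓝[≠] (0 : ℂ), p.eval (Complex.exp (l * ω)) = 0) : p = 0 := by
  have h1 : HasDerivAt (fun ω => Complex.exp (l * ω)) (Complex.exp (l * 0) * (l * 1)) 0 :=
    ((hasDerivAt_id (0 : ℂ)).const_mul _).cexp
  have h2 := h1.tendsto_nhdsNE (by simpa using hl)
  rw [mul_zero, Complex.exp_zero] at h2
  have h3 : ∃ᶠ s in 𝓝[≠] (1 : ℂ), p.eval s = 0 := h2.frequently h.frequently
  have h4 : ∀ᶠ s in 𝓝 (1 : ℂ), p.eval s = 0 :=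
    (p.differentiable.analyticAt 1).frequently_zero_iff_eventually_zero.1 h3
  exact p.eq_zero_of_infinite_isRoot (infinite_of_mem_nhds (1 : ℂ) h4)

section Branch

variable {μ : ℂ} {ν : ℝ} {d : ℂ} {φ r : ℝ} {y : ℂ → ℂ} {w : ℕ → ℂ[X]} {Y : ℂ → ℂ} {η ρ B : ℝ}

lemma expo_mul_pow_bound {l : ℂ} {p : ℕ → ℂ[X]} (hρ : 0 < ρ) (h : SerBound l p η ρ B) {ω : ℂ}
    (hω : ‖ω‖ ≤ η) (i : ℕ) :
    ‖(p i).eval (Complex.exp (l * ω))‖ * (ρ * ‖Complex.exp ω / Complex.exp (l * ω)‖) ^ i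
      ≤ ‖Complex.exp (l * ω)‖ * B := by
  have h1 := congrArg norm (expo_eq l i (p i) ω ρ)
  rw [norm_mul, norm_mul, norm_mul, norm_pow, norm_pow, mul_div_assoc, norm_mul,
    Complex.norm_real, Real.norm_of_nonneg hρ.le] at h1
  rw [← h1]
  have := h i ω hω
  gcongr

lemma exp_mul_ser {l : ℂ} {p : ℕ → ℂ[X]} (ω z : ℂ) :
    Complex.exp (l * ω) * ser l p z ω = ∑' i, (p i).eval (Complex.exp (l * ω))
      * (z * Complex.exp ω / Complex.exp (l * ω)) ^ i := by
  rw [ser, ← tsum_mul_left]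
  congr 1
  ext i
  exact expo_eq l i (p i) ω z

/-- The polynomials `w i` form a formal solution. -/
theorem IsSeries.formalODE_eq_zero (h : IsSeries μ ν d φ r y w Y η ρ B) (hν : 0 < ν)
    (hy : SolvesPVI μ y (sheet φ r)) : formalODE (2 * μ - 1) (2 * Complex.I * ν) w = 0 := by
  have hν' : (ν : ℂ) ≠ 0 := by exact_mod_cast hν.ne'
  have hη := h.η_pos
  set l := 2 * Complex.I * ν with hl
  set a := 2 * μ - 1
  have hl0 : l ≠ 0 := mul_ne_zero (mul_ne_zero two_ne_zero Complex.I_ne_zero) hν'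
  have b0 : SerBound l w η ρ B := h.bound
  have b1 := b0.twist h.η_pos h.ρ_pos
  have b2 := b1.twist (by positivity) h.ρ_pos
  have hX := tendsto_exp_logZero hν d
  have hw0 : w 0 = quadPoly a l := h.lead.trans (leadPoly_eq μ hν)
  have key : ∀ᶠ ω in 𝓝[≠] (0 : ℂ), ∀ i,
      (PowerSeries.coeff i (formalODE a l w)).eval (Complex.exp (l * ω)) = 0 := by
    have e1 : ∀ᶠ ω in 𝓝[≠] (0 : ℂ), expo l 0 (w 0) ω ≠ 1 := by
      have : Tendsto (expo l 0 (w 0)) (𝓝[≠] 0) (𝓝 0) := by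
        have := ((differentiable_expo l 0 (w 0)).continuous.tendsto 0)
        rw [expo_zero, hw0, eval_quadPoly_one hl0] at this
        exact (hw0 ▸ this).mono_left nhdsWithin_le_nhds
      exact this.eventually_ne zero_ne_one
    have e2 : ∀ᶠ ω in 𝓝[≠] (0 : ℂ), ‖ω‖ < η / 4 :=
      (continuous_norm.tendsto' (0 : ℂ) 0 norm_zero).eventually_lt_const (by positivity)
        |>.filter_mono nhdsWithin_le_nhds
    filter_upwards [hw0 ▸ eventually_expo_quadPoly_ne_zero (a := a) hl0, e1, e2] with ω h0 h1 hω
    set s := Complex.exp (l * ω) with hs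
    have hs0 : s ≠ 0 := Complex.exp_ne_zero _
    -- With ω fixed and k → ∞ this is the variable ξ = x/s. Along it the equation becomes an
    -- asymptotic identity between power series with coefficients evaluated at s.
    set t : ℕ → ℂ := fun k => Complex.exp (logZero ν d k) * Complex.exp ω / s with ht
    have htt : Tendsto t atTop (𝓝 0) := by
      have := hX.mul_const (Complex.exp ω / s)
      simpa [ht, mul_div_assoc] using this
    have ht0 : ∀ᶠ k in atTop, t k ≠ 0 := Eventually.of_forall fun k =>
      div_ne_zero (mul_ne_zero (Complex.exp_ne_zero _) (Complex.exp_ne_zero _)) hs0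
    have hρ' : 0 < ρ * ‖Complex.exp ω / s‖ :=
      mul_pos h.ρ_pos (norm_pos_iff.2 (div_ne_zero (Complex.exp_ne_zero _) hs0))
    have x0 := HasExpansion.of_tsum htt hρ' (expo_mul_pow_bound h.ρ_pos b0 (by linarith : ‖ω‖ ≤ η))
    have x1 := HasExpansion.of_tsum htt hρ'
      (expo_mul_pow_bound h.ρ_pos b1 (by linarith : ‖ω‖ ≤ η / 2))
    have x2 := HasExpansion.of_tsum htt hρ'
      (expo_mul_pow_bound h.ρ_pos b2 (by linarith : ‖ω‖ ≤ η / 2 / 2))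
    have hE := HasExpansion.homODE htt (HasExpansion.id htt) (HasExpansion.const htt s)
      (HasExpansion.const htt (a ^ 2)) x0 x1 x2
    have hzero := hE.eq_zero' htt ht0 ?_
    · intro i
      have hmap : PowerSeries.map (evalRingHom s) (formalODE a l w) = 0 := by
        rw [← hzero, formalODE]
        simp only [homODE, map_sub, map_mul, map_pow, map_add, map_one, map_ofNat,
          PowerSeries.map_X, PowerSeries.map_C, coe_evalRingHom, eval_X, eval_C]
        congr
      have := congrArg (PowerSeries.coeff i) hmap
      simpa using this
    -- The excluded values u = 0, u = 1 and x u = 1 do not occur for large k, because u tends to its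
    -- leading term and x tends to 0.
    · have lim : Tendsto (fun k => ser l w (Complex.exp (logZero ν d k)) ω) atTop
          (𝓝 (expo l 0 (w 0) ω)) := by
        rw [tendsto_iff_norm_sub_tendsto_zero]
        have h2 : Tendsto (fun k => 2 * B * (‖Complex.exp (logZero ν d k)‖ / ρ) ^ 1) atTop (𝓝 0) := by
          simpa using ((tendsto_norm_zero.comp hX).div_const ρ).const_mul (2 * B)
        refine squeeze_zero' (Eventually.of_forall fun _ => norm_nonneg _) ?_ h2
        filter_upwards [(tendsto_norm_zero.comp hX).eventually_lt_const
          (half_pos h.ρ_pos)] with k hk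
        have := b0.norm_sub_le h.ρ_pos hk.le (by linarith : ‖ω‖ ≤ η) 1
        simpa using this
      have lim2 : Tendsto (fun k => Complex.exp (logZero ν d k) * Complex.exp ω
          * ser l w (Complex.exp (logZero ν d k)) ω) atTop (𝓝 0) := by
        simpa using (hX.mul_const (Complex.exp ω)).mul lim
      filter_upwards [h.homODE_eq_zero hν hy, lim.eventually_ne h0, lim.eventually_ne h1,
        lim2.eventually_ne zero_ne_one] with k hk k0 k1 k2
      have hk' := hk ω (by linarith) k0 k1 k2
      have e : ∀ p : ℕ → ℂ[X], ∑' i, (p i).eval s * t k ^ i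
          = s * ser l p (Complex.exp (logZero ν d k)) ω := fun p => (exp_mul_ser ω _).symm
      rw [e, e, e, homODE_scale, ht, div_mul_cancel₀ _ hs0, hk', mul_zero]
  ext1 i
  rw [map_zero]
  exact eq_zero_of_eval_exp hl0 (key.mono fun ω hω => hω i)

end Branch

end Formal

/-! ### Existence and location of the zeros of u near ω = 0. -/

section Zeros

/-- A family of holomorphic functions `s0 z` of `ω` near `0`, with first and second derivatives
`s1 z`, `s2 z`, depending continuously on `z`, such that `s0 0` has at `0` the 2-jet
`(0, a, -(a² + l²) / 2)`. -/
structure IsJetFamily (a l : ℂ) (s0 s1 s2 : ℂ → ℂ → ℂ) (R C : ℝ) : Prop where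
  pos : 0 < R
  deriv0 : ∀ z ω, ‖z‖ < R → ‖ω‖ < R → HasDerivAt (s0 z) (s1 z ω) ω
  deriv1 : ∀ z ω, ‖z‖ < R → ‖ω‖ < R → HasDerivAt (s1 z) (s2 z ω) ω
  cont2 : ∀ z ω, ‖z‖ < R → ‖ω‖ < R → ContinuousAt (s2 z) ω
  bound0 : ∀ z ω, ‖z‖ < R → ‖ω‖ < R → ‖s0 z ω - s0 0 ω‖ ≤ C * ‖z‖
  bound1 : ∀ z ω, ‖z‖ < R → ‖ω‖ < R → ‖s1 z ω - s1 0 ω‖ ≤ C * ‖z‖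
  bound2 : ∀ z ω, ‖z‖ < R → ‖ω‖ < R → ‖s2 z ω - s2 0 ω‖ ≤ C * ‖z‖
  value0 : s0 0 0 = 0
  value1 : s1 0 0 = a
  value2 : s2 0 0 = -(a ^ 2 + l ^ 2) / 2
  ne_zero : ∀ᶠ ω in 𝓝[≠] (0 : ℂ), s0 0 ω ≠ 0

lemma continuousAt_of_bound {s : ℂ → ℂ → ℂ} {R C : ℝ} (hR : 0 < R)
    (hb : ∀ z ω, ‖z‖ < R → ‖ω‖ < R → ‖s z ω - s 0 ω‖ ≤ C * ‖z‖) (hc : ContinuousAt (s 0) 0) :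
    Tendsto (fun p : ℂ × ℂ => s p.1 p.2) (𝓝 0) (𝓝 (s 0 0)) := by
  have h1 : Tendsto (fun p : ℂ × ℂ => s p.1 p.2 - s 0 p.2) (𝓝 0) (𝓝 0) := by
    have h2 : Tendsto (fun p : ℂ × ℂ => C * ‖p.1‖) (𝓝 0) (𝓝 0) := by
      have : Continuous fun p : ℂ × ℂ => C * ‖p.1‖ := by fun_prop
      simpa using this.tendsto 0
    refine squeeze_zero_norm' ?_ h2
    have h3 : ∀ᶠ p : ℂ × ℂ in 𝓝 0, ‖p‖ < R := (continuous_norm.tendsto' _ _ norm_zero).eventually_lt_const hR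
    filter_upwards [h3] with p hp
    exact hb _ _ ((norm_fst_le p).trans_lt hp) ((norm_snd_le p).trans_lt hp)
  have h4 : Tendsto (fun p : ℂ × ℂ => s 0 p.2) (𝓝 0) (𝓝 (s 0 0)) :=
    hc.tendsto.comp (continuous_snd.tendsto' (0 : ℂ × ℂ) 0 rfl)
  simpa using h1.add h4

namespace IsJetFamily

variable {a l : ℂ} {s0 s1 s2 : ℂ → ℂ → ℂ} {R C : ℝ}

lemma tendsto (h : IsJetFamily a l s0 s1 s2 R C) :
    Tendsto (fun p : ℂ × ℂ => s0 p.1 p.2) (𝓝 0) (𝓝 0) ∧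
    Tendsto (fun p : ℂ × ℂ => s1 p.1 p.2) (𝓝 0) (𝓝 a) ∧
    Tendsto (fun p : ℂ × ℂ => s2 p.1 p.2) (𝓝 0) (𝓝 (-(a ^ 2 + l ^ 2) / 2)) := by
  have hR := h.pos
  have z : ‖(0 : ℂ)‖ < R := by simpa using hR
  refine ⟨?_, ?_, ?_⟩
  · rw [← h.value0]
    exact continuousAt_of_bound hR h.bound0 (h.deriv0 0 0 z z).continuousAt
  · rw [← h.value1]
    exact continuousAt_of_bound hR h.bound1 (h.deriv1 0 0 z z).continuousAt
  · rw [← h.value2]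
    exact continuousAt_of_bound hR h.bound2 (h.cont2 0 0 z z)

/-- All the conditions on the pair `(z, ω)` near `(0, 0)` that are used below. -/
lemma exists_radius (h : IsJetFamily a l s0 s1 s2 R C) (hl : l ≠ 0) (hal : a + l ≠ 0) :
    ∃ ε > 0, ε < R ∧ (∀ ω, ‖ω‖ ≤ ε → ω ≠ 0 → s0 0 ω ≠ 0) ∧ ∀ z ω, ‖z‖ ≤ ε → ‖ω‖ ≤ ε →
      (s1 z ω ≠ 0 ∨ s2 z ω ≠ 0) ∧ (a = 0 → s2 z ω ≠ 0) ∧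
      (a ≠ 0 → (z * Complex.exp ω - 1) * s1 z ω ≠ a) ∧ z * Complex.exp ω ≠ 1 ∧
      ‖z * Complex.exp ω * s1 z ω + (z * Complex.exp ω - 1) * s2 z ω + l * s1 z ω
        - (a + l) ^ 2 / 2‖ ≤ ‖(a + l) ^ 2 / 2‖ / 2 := by
  obtain ⟨t0, t1, t2⟩ := h.tendsto
  have tx : Tendsto (fun p : ℂ × ℂ => p.1 * Complex.exp p.2) (𝓝 0) (𝓝 0) := by
    have : Continuous fun p : ℂ × ℂ => p.1 * Complex.exp p.2 := by fun_prop
    simpa using this.tendsto 0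
  have n2 : a = 0 → -(a ^ 2 + l ^ 2) / 2 ≠ 0 := by
    rintro rfl
    simpa using hl
  have e1 : ∀ᶠ p : ℂ × ℂ in 𝓝 0, s1 p.1 p.2 ≠ 0 ∨ s2 p.1 p.2 ≠ 0 := by
    by_cases ha : a = 0
    · exact (t2.eventually_ne (n2 ha)).mono fun p hp => Or.inr hp
    · exact (t1.eventually_ne ha).mono fun p hp => Or.inl hp
  have e2 : ∀ᶠ p : ℂ × ℂ in 𝓝 0, a = 0 → s2 p.1 p.2 ≠ 0 := by
    by_cases ha : a = 0
    · exact (t2.eventually_ne (n2 ha)).mono fun p hp _ => hp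
    · exact Eventually.of_forall fun p h => absurd h ha
  have e3 : ∀ᶠ p : ℂ × ℂ in 𝓝 0, a ≠ 0 → (p.1 * Complex.exp p.2 - 1) * s1 p.1 p.2 ≠ a := by
    by_cases ha : a = 0
    · exact Eventually.of_forall fun p h => absurd ha h
    · have : (0 - 1) * a ≠ a := by
        intro h
        apply ha
        linear_combination (-1 / 2) * h
      exact (((tx.sub_const 1).mul t1).eventually_ne this).mono fun p hp _ => hp
  have e4 : ∀ᶠ p : ℂ × ℂ in 𝓝 0, ‖p.1 * Complex.exp p.2 * s1 p.1 p.2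
      + (p.1 * Complex.exp p.2 - 1) * s2 p.1 p.2 + l * s1 p.1 p.2
        - (a + l) ^ 2 / 2‖ < ‖(a + l) ^ 2 / 2‖ / 2 := by
    have := ((((tx.mul t1).add ((tx.sub_const 1).mul t2)).add (t1.const_mul l)).sub_const
      ((a + l) ^ 2 / 2)).norm
    rw [show 0 * a + (0 - 1) * (-(a ^ 2 + l ^ 2) / 2) + l * a - (a + l) ^ 2 / 2 = 0 by ring,
      norm_zero] at this
    exact this.eventually_lt_const
      (half_pos (norm_pos_iff.2 (div_ne_zero (pow_ne_zero 2 hal) two_ne_zero)))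
  obtain ⟨ε₁, hε₁, H₁⟩ := Metric.eventually_nhds_iff.1 (e1.and (e2.and (e3.and
    ((tx.eventually_ne zero_ne_one).and e4))))
  obtain ⟨ε₂, hε₂, H₂⟩ := Metric.eventually_nhds_iff.1 (eventually_nhdsWithin_iff.1 h.ne_zero)
  have hR := h.pos
  refine ⟨min ε₁ (min ε₂ R) / 2, by positivity, ?_, ?_, ?_⟩
  · have := min_le_right ε₁ (min ε₂ R)
    have := min_le_right ε₂ R
    have : 0 < min ε₁ (min ε₂ R) := by positivity
    linarith
  · intro ω hω hω0
    have := min_le_right ε₁ (min ε₂ R)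
    have := min_le_left ε₂ R
    exact H₂ (by rw [dist_zero_right]; linarith) hω0
  · intro z ω hz hω
    have := min_le_left ε₁ (min ε₂ R)
    have : 0 < min ε₁ (min ε₂ R) := by positivity
    have hp : ‖((z, ω) : ℂ × ℂ)‖ < ε₁ := by
      rw [Prod.norm_mk, max_lt_iff]
      constructor <;> linarith
    obtain ⟨a1, a2, a3, a5, a4⟩ := H₁ (y := (z, ω)) (by rwa [dist_zero_right])
    exact ⟨a1, a2, a3, a5, a4.le⟩

/-- A quantitative open mapping argument: on the circle |ω| = ε the limit function is bounded below
by some m > 0. For small z the perturbed function stays away from its value at the centre on that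
circle, while this central value is small, so its image contains 0. No multiplicity count is needed,
which matters when a = 0. -/
lemma exists_zero (h : IsJetFamily a l s0 s1 s2 R C) {ε : ℝ} (hε : 0 < ε) (hεR : ε < R)
    (hne : ∀ ω, ‖ω‖ ≤ ε → ω ≠ 0 → s0 0 ω ≠ 0)
    (hjet : ∀ z ω, ‖z‖ ≤ ε → ‖ω‖ ≤ ε → s1 z ω ≠ 0 ∨ s2 z ω ≠ 0) :
    ∀ᶠ z in 𝓝 (0 : ℂ), ∃ ω, ‖ω‖ ≤ ε ∧ s0 z ω = 0 := by
  have z0 : ‖(0 : ℂ)‖ < R := by simpa using h.pos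
  have hcont : ContinuousOn (fun ω => ‖s0 0 ω‖) (Metric.sphere 0 ε) := fun ω hω =>
    (h.deriv0 0 ω z0 (by
      rw [mem_sphere_zero_iff_norm.1 hω]
      exact hεR)).continuousAt.norm.continuousWithinAt
  obtain ⟨ω₀, hω₀, hmin⟩ := (isCompact_sphere (0 : ℂ) ε).exists_isMinOn
    (NormedSpace.sphere_nonempty.2 hε.le) hcont
  set m := ‖s0 0 ω₀‖
  have hn0 := mem_sphere_zero_iff_norm.1 hω₀
  have hm : 0 < m := norm_pos_iff.2 (hne ω₀ hn0.le (by
    rintro rfl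
    rw [norm_zero] at hn0
    exact hε.ne hn0))
  have e1 : ∀ᶠ z in 𝓝 (0 : ℂ), ‖z‖ < ε := (continuous_norm.tendsto' _ _ norm_zero).eventually_lt_const hε
  have e2 : ∀ᶠ z in 𝓝 (0 : ℂ), C * ‖z‖ < m / 8 :=
    ((continuous_const.mul continuous_norm).tendsto' (0 : ℂ) (0 : ℝ) (by simp)).eventually_lt_const
      (by positivity)
  filter_upwards [e1, e2] with z hz hzm
  have hzR : ‖z‖ < R := hz.trans hεR
  have hb : ∀ ω, ‖ω‖ ≤ ε → ‖s0 z ω - s0 0 ω‖ < m / 8 := fun ω hω =>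
    (h.bound0 z ω hzR (hω.trans_lt hεR)).trans_lt hzm
  have hs0 : ‖s0 z 0‖ < m / 8 := by
    have := hb 0 (by simpa using hε.le)
    rwa [h.value0, sub_zero] at this
  have hd : ∀ ω, ‖ω‖ < R → HasDerivAt (s0 z) (s1 z ω) ω := fun ω hω => h.deriv0 z ω hzR hω
  have hdiff : DiffContOnCl ℂ (s0 z) (Metric.ball 0 ε) := by
    refine DifferentiableOn.diffContOnCl fun ω hω => ?_
    rw [closure_ball _ hε.ne', mem_closedBall_zero_iff] at hω
    exact (hd ω (hω.trans_lt hεR)).differentiableAt.differentiableWithinAt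
  have hsub := hdiff.ball_subset_image_closedBall (ε := m / 2) hε ?_ ?_
  · obtain ⟨ω, hω, h0⟩ := hsub (by
      rw [Metric.mem_ball, dist_zero_left]
      linarith : (0 : ℂ) ∈ Metric.ball (s0 z 0) (m / 2 / 2))
    exact ⟨ω, mem_closedBall_zero_iff.1 hω, h0⟩
  · intro ω hω
    have h1 : m ≤ ‖s0 0 ω‖ := hmin hω
    have h2 := hb ω (mem_sphere_zero_iff_norm.1 hω).le
    have h3 := norm_sub_norm_le (s0 0 ω) (s0 0 ω - s0 z ω + s0 z 0)
    have h4 := norm_add_le (s0 0 ω - s0 z ω) (s0 z 0)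
    rw [norm_sub_rev] at h2
    rw [show s0 0 ω - (s0 0 ω - s0 z ω + s0 z 0) = s0 z ω - s0 z 0 by ring] at h3
    linarith
  · intro hcon
    have hcon : ∀ᶠ ω in 𝓝 (0 : ℂ), s0 z ω = s0 z 0 := by simpa using hcon
    have hball : ∀ᶠ ω in 𝓝 (0 : ℂ), ‖ω‖ < R :=
      (continuous_norm.tendsto' _ _ norm_zero).eventually_lt_const h.pos
    have k1 : ∀ᶠ ω in 𝓝 (0 : ℂ), s1 z ω = 0 := by
      filter_upwards [hcon.eventually_nhds, hball] with ω hω hωR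
      rw [← (hd ω hωR).deriv, EventuallyEq.deriv_eq (f := fun _ => s0 z 0) hω]
      simp
    have k2 : s2 z 0 = 0 := by
      rw [← (h.deriv1 z 0 hzR z0).deriv, EventuallyEq.deriv_eq (f := fun _ => (0 : ℂ)) k1]
      simp
    rcases hjet z 0 hz.le (by simpa using hε.le) with hj | hj
    · exact hj k1.self_of_nhds
    · exact hj k2

/-- At a zero, the equation gives `((x - 1) D u)² = a²`. -/
lemma sq_eq_of_zero (h : IsJetFamily a l s0 s1 s2 R C) {z ω : ℂ} (hz : ‖z‖ < R) (hω : ‖ω‖ < R)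
    (hjet : s1 z ω ≠ 0 ∨ s2 z ω ≠ 0) (h0 : s0 z ω = 0)
    (hode : ∀ ω, ‖ω‖ < R → s0 z ω ≠ 0 → s0 z ω ≠ 1 → z * Complex.exp ω * s0 z ω ≠ 1 →
      homODE (z * Complex.exp ω) 1 (a ^ 2) (s0 z ω) (s1 z ω) (s2 z ω) = 0) :
    ((z * Complex.exp ω - 1) * s1 z ω) ^ 2 = a ^ 2 := by
  have hball : ∀ᶠ ω' in 𝓝 ω, ‖ω'‖ < R := continuous_norm.continuousAt.eventually_lt continuousAt_const hω
  have hd : ∀ᶠ ω' in 𝓝 ω, HasDerivAt (s0 z) (s1 z ω') ω' := hball.mono fun ω' h' => h.deriv0 z ω' hz h'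
  have hA : AnalyticAt ℂ (s0 z) ω :=
    Complex.analyticAt_iff_eventually_differentiableAt.2 (hd.mono fun ω' h' => h'.differentiableAt)
  have hne : ∀ᶠ ω' in 𝓝[≠] ω, s0 z ω' ≠ 0 := by
    refine hA.eventually_eq_zero_or_eventually_ne_zero.resolve_left fun hcon => ?_
    have k1 : ∀ᶠ ω' in 𝓝 ω, s1 z ω' = 0 := by
      filter_upwards [hcon.eventually_nhds, hd] with ω' h1 h2
      rw [← h2.deriv, EventuallyEq.deriv_eq (f := fun _ => (0 : ℂ)) h1]
      simp
    have k2 : s2 z ω = 0 := by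
      rw [← (h.deriv1 z ω hz hω).deriv, EventuallyEq.deriv_eq (f := fun _ => (0 : ℂ)) k1]
      simp
    rcases hjet with hj | hj
    · exact hj k1.self_of_nhds
    · exact hj k2
  have c0 : ContinuousAt (s0 z) ω := (h.deriv0 z ω hz hω).continuousAt
  have c1 : ContinuousAt (s1 z) ω := (h.deriv1 z ω hz hω).continuousAt
  have c2 : ContinuousAt (s2 z) ω := h.cont2 z ω hz hω
  have cx : ContinuousAt (fun ω => z * Complex.exp ω) ω := by fun_prop
  -- The equation is not available at the zero itself, where y has a pole. It holds on a punctured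
  -- neighbourhood, and its polynomial form extends by continuity.
  have hlim : ContinuousAt (fun ω => homODE (z * Complex.exp ω) 1 (a ^ 2) (s0 z ω) (s1 z ω)
      (s2 z ω)) ω := by
    unfold homODE
    fun_prop
  have hev : ∀ᶠ ω' in 𝓝[≠] ω,
      homODE (z * Complex.exp ω') 1 (a ^ 2) (s0 z ω') (s1 z ω') (s2 z ω') = 0 := by
    have n1 : ∀ᶠ ω' in 𝓝 ω, s0 z ω' ≠ 1 := c0.eventually_ne (by rw [h0]; exact zero_ne_one)
    have n2 : ∀ᶠ ω' in 𝓝 ω, z * Complex.exp ω' * s0 z ω' ≠ 1 :=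
      (cx.mul c0).eventually_ne (by simp [h0])
    filter_upwards [hne, n1.filter_mono nhdsWithin_le_nhds, n2.filter_mono nhdsWithin_le_nhds,
      hball.filter_mono nhdsWithin_le_nhds] with ω' h1 h2 h3 h4
    exact hode ω' h4 h1 h2 h3
  have hz0 := tendsto_nhds_unique (hlim.tendsto.mono_left nhdsWithin_le_nhds)
    ((tendsto_const_nhds (x := (0 : ℂ))).congr' (hev.mono fun ω' h' => h'.symm))
  rw [h0] at hz0
  unfold homODE at hz0
  linear_combination hz0

/-- The zeros near `ω = 0` for small `z` in a sequence along which the equation holds. -/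
theorem exists_zeros (h : IsJetFamily a l s0 s1 s2 R C) (hl : l ≠ 0) (hal : a + l ≠ 0)
    {X : ℕ → ℂ} (hX : Tendsto X atTop (𝓝 0))
    (hode : ∀ᶠ k in atTop, ∀ ω, ‖ω‖ < R → s0 (X k) ω ≠ 0 → s0 (X k) ω ≠ 1 →
      X k * Complex.exp ω * s0 (X k) ω ≠ 1 →
      homODE (X k * Complex.exp ω) 1 (a ^ 2) (s0 (X k) ω) (s1 (X k) ω) (s2 (X k) ω) = 0) :
    ∃ ω : ℕ → ℂ, ω =O[atTop] X ∧ ∀ᶠ k in atTop, s0 (X k) (ω k) = 0 ∧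
      (s1 (X k) (ω k) ≠ 0 ∨ s2 (X k) (ω k) ≠ 0) ∧
      (a = 0 → s1 (X k) (ω k) = 0 ∧ s2 (X k) (ω k) ≠ 0) ∧
      (X k * Complex.exp (ω k) - 1) * s1 (X k) (ω k) + a + l * s0 (X k) (ω k) = 0 := by
  obtain ⟨ε, hε, hεR, hne, H⟩ := h.exists_radius hl hal
  have hX0 : ∀ᶠ k in atTop, ‖X k‖ < ε := (tendsto_norm_zero.comp hX).eventually_lt_const hε
  have hex := hX.eventually (h.exists_zero hε hεR hne fun z ω hz hω => (H z ω hz hω).1)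
  choose! ω hω using fun (k : ℕ) (hk : ∃ ω, ‖ω‖ ≤ ε ∧ s0 (X k) ω = 0) => hk
  have hfin : ∀ᶠ k in atTop, ‖X k‖ < ε ∧ ‖ω k‖ ≤ ε ∧ s0 (X k) (ω k) = 0 ∧
      (X k * Complex.exp (ω k) - 1) * s1 (X k) (ω k) + a + l * s0 (X k) (ω k) = 0 := by
    filter_upwards [hex, hX0, hode] with k hk hkX hkode
    obtain ⟨w1, w2⟩ := hω k hk
    refine ⟨hkX, w1, w2, ?_⟩
    obtain ⟨j1, j2, j3, -, -⟩ := H (X k) (ω k) hkX.le w1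
    have hsq := h.sq_eq_of_zero (hkX.trans hεR) (w1.trans_lt hεR) j1 w2 hkode
    rw [w2, mul_zero, add_zero]
    rcases sq_eq_sq_iff_eq_or_eq_neg.1 hsq with e | e
    · by_cases ha : a = 0
      · rw [e, ha, add_zero]
      · exact absurd e (j3 ha)
    · rw [e, neg_add_cancel]
  refine ⟨ω, ?_, ?_⟩
  · set c := (a + l) ^ 2 / 2 with hc
    have hc0 : 0 < ‖c‖ := norm_pos_iff.2 (div_ne_zero (pow_ne_zero 2 hal) two_ne_zero)
    -- The derivative of V in ω stays within |c|/2 of c = (a + l)²/2. The mean value inequality for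
    -- V - cω then gives |V(z, ω) - V(z, 0)| ≥ |c||ω|/2, and V(z, 0) = O(z), so a zero of V
    -- satisfies ω = O(z).
    set V : ℂ → ℂ → ℂ := fun z ω => (z * Complex.exp ω - 1) * s1 z ω + a + l * s0 z ω with hV
    have hVd : ∀ z ω, ‖z‖ < R → ‖ω‖ < R → HasDerivAt (V z)
        (z * Complex.exp ω * s1 z ω + (z * Complex.exp ω - 1) * s2 z ω + l * s1 z ω) ω := by
      intro z ω hz hω
      exact (((((Complex.hasDerivAt_exp ω).const_mul z).sub_const 1).mul
        (h.deriv1 z ω hz hω)).add_const a).add ((h.deriv0 z ω hz hω).const_mul l)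
    have hmv : ∀ z ω, ‖z‖ ≤ ε → ‖ω‖ ≤ ε → ‖ω‖ * (‖c‖ / 2) ≤ ‖V z ω - V z 0‖ := by
      intro z ω hz hω
      have := (convex_closedBall (0 : ℂ) ε).norm_image_sub_le_of_norm_hasDerivWithin_le
        (f := fun ω => V z ω - c * ω) (C := ‖c‖ / 2)
        (f' := fun ω => z * Complex.exp ω * s1 z ω + (z * Complex.exp ω - 1) * s2 z ω + l * s1 z ω
          - c * 1)
        (fun x hx => by
          have hx' := mem_closedBall_zero_iff.1 hx
          exact ((hVd z x (hz.trans_lt hεR) (hx'.trans_lt hεR)).sub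
            ((hasDerivAt_id x).const_mul c)).hasDerivWithinAt)
        (fun x hx => by
          rw [mul_one]
          exact (H z x hz (mem_closedBall_zero_iff.1 hx)).2.2.2.2)
        (Metric.mem_closedBall_self hε.le) (mem_closedBall_zero_iff.2 hω)
      have h2 := norm_sub_norm_le (c * ω) (V z ω - V z 0)
      have h3 : ‖c * ω - (V z ω - V z 0)‖ = ‖V z ω - c * ω - (V z 0 - c * 0)‖ := by
        rw [norm_sub_rev]
        congr 1
        ring
      rw [h3, norm_mul] at h2
      rw [sub_zero] at this
      nlinarith
    have hV0 : ∀ z, ‖z‖ ≤ ε → ‖V z 0‖ ≤ (2 * C + ‖a‖ + ‖l‖ * C + C * ε) * ‖z‖ := by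
      intro z hz
      have z0 : ‖(0 : ℂ)‖ < R := by simpa using h.pos
      have b0 := h.bound0 z 0 (hz.trans_lt hεR) z0
      have b1 := h.bound1 z 0 (hz.trans_lt hεR) z0
      rw [h.value0, sub_zero] at b0
      rw [h.value1] at b1
      have e : V z 0 = z * (s1 z 0 - a) + z * a - (s1 z 0 - a) + l * s0 z 0 := by
        simp only [hV, Complex.exp_zero]
        ring
      rw [e]
      have n1 := norm_add_le (z * (s1 z 0 - a) + z * a - (s1 z 0 - a)) (l * s0 z 0)
      have n2 := norm_sub_le (z * (s1 z 0 - a) + z * a) (s1 z 0 - a)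
      have n3 := norm_add_le (z * (s1 z 0 - a)) (z * a)
      rw [norm_mul] at n1
      rw [norm_mul, norm_mul] at n3
      have n4 : ‖z‖ * ‖s1 z 0 - a‖ ≤ ε * (C * ‖z‖) := by gcongr
      have n5 : ‖l‖ * ‖s0 z 0‖ ≤ ‖l‖ * (C * ‖z‖) := by gcongr
      have n6 : 0 ≤ C * ‖z‖ := (norm_nonneg _).trans b1
      nlinarith
    refine IsBigO.of_bound ((2 * C + ‖a‖ + ‖l‖ * C + C * ε) / (‖c‖ / 2)) ?_
    filter_upwards [hfin] with k ⟨k1, k2, k3, k4⟩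
    have h1 := hmv (X k) (ω k) k1.le k2
    have h2 : V (X k) (ω k) = 0 := k4
    rw [h2, zero_sub, norm_neg] at h1
    rw [div_mul_eq_mul_div, le_div_iff₀ (by positivity)]
    exact h1.trans (hV0 _ k1.le)
  · filter_upwards [hfin] with k ⟨k1, k2, k3, k4⟩
    obtain ⟨j1, j2, -, j5, -⟩ := H (X k) (ω k) k1.le k2
    refine ⟨k3, j1, fun ha => ⟨?_, j2 ha⟩, k4⟩
    rw [k3, ha, mul_zero, add_zero, add_zero] at k4
    exact (mul_eq_zero.1 k4).resolve_left (sub_ne_zero.2 j5)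

end IsJetFamily

end Zeros

/-! ### Pole orders, and the double series of the implicit equation. -/

section Poles

open Polynomial

/-- Only the behaviour on a punctured neighbourhood counts, so the unspecified value of y at the
zero of Y is irrelevant. -/
lemma meromorphicOrderAt_of_inv {y Y : ℂ → ℂ} {U : Set ℂ} (hU : IsOpen U)
    (hY : DifferentiableOn ℂ Y U) (hyY : ∀ x ∈ U, Y x ≠ 0 → y x = 1 / Y x) {x : ℂ} (hx : x ∈ U)
    (h0 : Y x = 0) (hne : deriv Y x ≠ 0 ∨ deriv (deriv Y) x ≠ 0) :
    meromorphicOrderAt y x < 0 ∧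
      (deriv Y x = 0 → meromorphicOrderAt y x = ((-2 : ℤ) : WithTop ℤ)) := by
  have hA : AnalyticAt ℂ Y x := hY.analyticAt (hU.mem_nhds hx)
  have h1 : deriv Y x ≠ 0 → analyticOrderAt Y x = 1 := fun h =>
    hA.analyticOrderAt_eq_one_of_zero_deriv_ne_zero h0 h
  have h2 : deriv Y x = 0 → analyticOrderAt Y x = 2 := by
    intro h
    have e1 := hA.deriv.analyticOrderAt_eq_one_of_zero_deriv_ne_zero h
      (hne.resolve_left (not_not.2 h))
    have e2 := hA.analyticOrderAt_deriv_add_one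
    simp only [h0, sub_zero, e1] at e2
    rw [← e2]
    rfl
  have hfin : analyticOrderAt Y x = 1 ∨ analyticOrderAt Y x = 2 := by
    by_cases h : deriv Y x = 0
    · exact Or.inr (h2 h)
    · exact Or.inl (h1 h)
  have hYne : ∀ᶠ z in 𝓝[≠] x, Y z ≠ 0 := by
    refine hA.eventually_eq_zero_or_eventually_ne_zero.resolve_left fun h => ?_
    rw [analyticOrderAt_eq_top.2 h] at hfin
    rcases hfin with h | h <;> exact absurd h (by decide)
  have hcongr : y =ᶠ[𝓝[≠] x] Y⁻¹ := by
    filter_upwards [hYne, mem_nhdsWithin_of_mem_nhds (hU.mem_nhds hx)] with z hz hzU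
    rw [hyY z hzU hz, Pi.inv_apply, one_div]
  rw [meromorphicOrderAt_congr hcongr, meromorphicOrderAt_inv, hA.meromorphicOrderAt_eq]
  constructor
  · rcases hfin with h | h <;> rw [h] <;> decide
  · intro h
    rw [h2 h]
    rfl

section Series

variable {l : ℂ} {p : ℕ → ℂ[X]} {η ρ B : ℝ}

lemma ser_zero_left (l : ℂ) (p : ℕ → ℂ[X]) (ω : ℂ) : ser l p 0 ω = expo l 0 (p 0) ω := by
  rw [ser, tsum_eq_single 0 (fun i hi => by simp [hi])]
  simp

lemma SerBound.nonneg (hη : 0 < η) (h : SerBound l p η ρ B) : 0 ≤ B := by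
  have := h 0 0 (by simpa using hη.le)
  simp only [pow_zero, mul_one] at this
  exact (norm_nonneg _).trans this

lemma SerBound.norm_sub_zero_le (hρ : 0 < ρ) (h : SerBound l p η ρ B) {z ω : ℂ} (hz : ‖z‖ ≤ ρ / 2)
    (hω : ‖ω‖ ≤ η) : ‖ser l p z ω - ser l p 0 ω‖ ≤ 2 * B / ρ * ‖z‖ := by
  have := h.norm_sub_le hρ hz hω 1
  rw [ser_zero_left]
  simp only [Finset.range_one, Finset.sum_singleton, pow_zero, mul_one, pow_one] at this
  refine this.trans (le_of_eq (by ring))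

/-- The coefficient of `z ^ i ω ^ j` in `ser l p z ω`. -/
noncomputable def serCoeff (l : ℂ) (p : ℕ → ℂ[X]) (i j : ℕ) : ℂ :=
  ((twist l i)^[j] (p i)).eval 1 / j.factorial

lemma iteratedDeriv_expo (l : ℂ) (i j : ℕ) (q : ℂ[X]) :
    iteratedDeriv j (expo l i q) = expo l i ((twist l i)^[j] q) := by
  induction j generalizing q with
  | zero => simp
  | succ j ih =>
    rw [iteratedDeriv_succ', Function.iterate_succ_apply, ← ih]
    congr 1
    ext ω
    exact (hasDerivAt_expo l i q ω).deriv

/-- Because ω = O(X), truncating at order M in X and in ω separately already leaves an error O(X^M).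
-/
lemma SerBound.isBigO (hη : 0 < η) (hρ : 0 < ρ) (h : SerBound l p η ρ B) {X ω : ℕ → ℂ}
    (hX : Tendsto X atTop (𝓝 0)) (hω : ω =O[atTop] X) (M : ℕ) :
    (fun k => ser l p (X k) (ω k) - ∑ i ∈ Finset.range M, ∑ j ∈ Finset.range M,
      serCoeff l p i j * X k ^ i * ω k ^ j) =O[atTop] fun k => X k ^ M := by
  have hω0 : Tendsto ω atTop (𝓝 0) := hω.trans_tendsto hX
  have h1 : (fun k => ser l p (X k) (ω k)
      - ∑ i ∈ Finset.range M, expo l i (p i) (ω k) * X k ^ i) =O[atTop] fun k => X k ^ M := by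
    refine IsBigO.of_bound (2 * B / ρ ^ M) ?_
    filter_upwards [(tendsto_norm_zero.comp hX).eventually_lt_const (half_pos hρ),
      (tendsto_norm_zero.comp hω0).eventually_lt_const hη] with k hk hk'
    refine (h.norm_sub_le hρ hk.le hk'.le M).trans (le_of_eq ?_)
    rw [norm_pow, div_pow]
    ring
  have h2 : ∀ i, (fun k => expo l i (p i) (ω k) * X k ^ i
      - ∑ j ∈ Finset.range M, serCoeff l p i j * X k ^ i * ω k ^ j) =O[atTop] fun k => X k ^ M := by
    intro i
    obtain ⟨F, hF, hFe⟩ := ((differentiable_expo l i (p i)).analyticAt 0).exists_eq_sum_add_pow_mul M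
    have e : ∀ k, expo l i (p i) (ω k) * X k ^ i
        - ∑ j ∈ Finset.range M, serCoeff l p i j * X k ^ i * ω k ^ j
        = ω k ^ M * (F (ω k) * X k ^ i) := by
      intro k
      rw [hFe (ω k), add_mul, Finset.sum_mul]
      have : ∑ j ∈ Finset.range M, (ω k ^ j / (j.factorial : ℂ)) •
          iteratedDeriv j (expo l i (p i)) 0 * X k ^ i
          = ∑ j ∈ Finset.range M, serCoeff l p i j * X k ^ i * ω k ^ j := by
        refine Finset.sum_congr rfl fun j _ => ?_
        rw [iteratedDeriv_expo, expo_zero, serCoeff, smul_eq_mul]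
        ring
      rw [this, smul_eq_mul]
      ring
    simp only [e]
    have b1 : (fun k => F (ω k) * X k ^ i) =O[atTop] fun _ => (1 : ℂ) :=
      ((hF.continuousAt.tendsto.comp hω0).mul (hX.pow i)).isBigO_one ℂ
    simpa using (hω.pow M).mul b1
  have h3 := IsBigO.sum (s := Finset.range M) fun i _ => h2 i
  refine (h1.add h3).congr_left fun k => ?_
  rw [Finset.sum_apply, Finset.sum_sub_distrib]
  ring

/-- The polynomials of the series `(x - 1) D u + a + l u`. -/
noncomputable def zeroPoly (a l : ℂ) (w : ℕ → ℂ[X]) (i : ℕ) : ℂ[X] :=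
  C l * w i - twist l i (w i)
    + if i = 0 then C a * X else X * twist l (i - 1) (w (i - 1))

/-- The identity x = ξ s in terms of coefficients: the factor e^ω raises the order in ξ by one and
multiplies the polynomial by s. -/
lemma expo_X_mul (l : ℂ) (i : ℕ) (q : ℂ[X]) (ω : ℂ) :
    expo l (i + 1) (X * q) ω = Complex.exp ω * expo l i q ω := by
  simp only [expo, eval_mul, eval_X]
  rw [← mul_assoc, ← mul_assoc, ← Complex.exp_add, ← Complex.exp_add]
  congr 2
  push_cast
  ring

lemma expo_zeroPoly_zero (a l : ℂ) (w : ℕ → ℂ[X]) (ω : ℂ) :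
    expo l 0 (zeroPoly a l w 0) ω = l * expo l 0 (w 0) ω - expo l 0 (twist l 0 (w 0)) ω + a := by
  have h : Complex.exp ((((0 : ℕ) : ℂ) - (((0 : ℕ) : ℂ) + 1) * l) * ω) * Complex.exp (l * ω) = 1 := by
    rw [← Complex.exp_add]
    simp
  simp only [zeroPoly, expo, if_true, eval_add, eval_sub, eval_mul, eval_C, eval_X]
  linear_combination a * h

lemma expo_zeroPoly_succ (a l : ℂ) (w : ℕ → ℂ[X]) (i : ℕ) (ω : ℂ) :
    expo l (i + 1) (zeroPoly a l w (i + 1)) ω = l * expo l (i + 1) (w (i + 1)) ω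
      - expo l (i + 1) (twist l (i + 1) (w (i + 1))) ω
      + Complex.exp ω * expo l i (twist l i (w i)) ω := by
  rw [← expo_X_mul]
  simp only [zeroPoly, expo, Nat.add_eq_zero_iff, one_ne_zero, and_false, if_false, eval_add,
    eval_sub, eval_mul, eval_C, eval_X, Nat.add_sub_cancel]
  ring

lemma serBound_zeroPoly {B₁ : ℝ} (hη : 0 < η) (hρ : 0 < ρ) (a : ℂ) (h : SerBound l p η ρ B)
    (h₁ : SerBound l (fun i => twist l i (p i)) η ρ B₁) :
    SerBound l (zeroPoly a l p) η ρ (‖l‖ * B + B₁ + (‖a‖ + Real.exp η * ρ * B₁)) := by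
  intro i ω hω
  have hB₁ := h₁.nonneg hη
  have key : ∀ c : ℂ, ‖c‖ * ρ ^ i ≤ ‖a‖ + Real.exp η * ρ * B₁ →
      ‖l * expo l i (p i) ω - expo l i (twist l i (p i)) ω + c‖ * ρ ^ i
        ≤ ‖l‖ * B + B₁ + (‖a‖ + Real.exp η * ρ * B₁) := by
    intro c hc
    have n1 := norm_add_le (l * expo l i (p i) ω - expo l i (twist l i (p i)) ω) c
    have n2 := norm_sub_le (l * expo l i (p i) ω) (expo l i (twist l i (p i)) ω)
    rw [norm_mul] at n2
    have n3 := h i ω hω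
    have n4 := h₁ i ω hω
    have n5 : ‖l‖ * (‖expo l i (p i) ω‖ * ρ ^ i) ≤ ‖l‖ * B := by gcongr
    calc _ ≤ (‖l‖ * ‖expo l i (p i) ω‖ + ‖expo l i (twist l i (p i)) ω‖ + ‖c‖) * ρ ^ i := by
          gcongr
          linarith
      _ ≤ _ := by linarith
  rcases i with _ | i
  · rw [expo_zeroPoly_zero]
    refine key a ?_
    have : 0 ≤ Real.exp η * ρ * B₁ := by positivity
    simpa using this
  · rw [expo_zeroPoly_succ]
    refine key _ ?_
    have n1 := h₁ i ω hω
    have n2 : ‖Complex.exp ω‖ ≤ Real.exp η := by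
      rw [Complex.norm_exp, Real.exp_le_exp]
      exact (Complex.re_le_norm ω).trans hω
    rw [norm_mul]
    calc _ = ‖Complex.exp ω‖ * ρ * (‖expo l i (twist l i (p i)) ω‖ * ρ ^ i) := by ring
      _ ≤ Real.exp η * ρ * B₁ := by gcongr
      _ ≤ _ := by linarith [norm_nonneg a]

lemma ser_zeroPoly {B₁ : ℝ} (hρ : 0 < ρ) (a : ℂ) (h : SerBound l p η ρ B)
    (h₁ : SerBound l (fun i => twist l i (p i)) η ρ B₁) {z ω : ℂ} (hz : ‖z‖ < ρ) (hω : ‖ω‖ ≤ η) :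
    ser l (zeroPoly a l p) z ω = (z * Complex.exp ω - 1) * ser l (fun i => twist l i (p i)) z ω
      + a + l * ser l p z ω := by
  have s0 := (summable_of_geometric hρ (fun i => h i ω hω) hz).hasSum
  have s1 := (summable_of_geometric hρ (fun i => h₁ i ω hω) hz).hasSum
  set c : ℕ → ℂ := fun i => Nat.casesOn i a
    fun i => z * Complex.exp ω * (expo l i (twist l i (p i)) ω * z ^ i)
  have s2 : HasSum c (a + z * Complex.exp ω * ser l (fun i => twist l i (p i)) z ω) := by
    have := (hasSum_nat_add_iff (f := c) 1).1 (s1.mul_left (z * Complex.exp ω))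
    simpa [add_comm, c] using! this
  have := ((s0.mul_left l).sub s1).add s2
  rw [ser]
  refine (HasSum.tsum_eq (a := l * ser l p z ω - ser l (fun i => twist l i (p i)) z ω
    + (a + z * Complex.exp ω * ser l (fun i => twist l i (p i)) z ω)) ?_).trans (by ring)
  have e : (fun i => expo l i (zeroPoly a l p i) ω * z ^ i) = fun i =>
      l * (expo l i (p i) ω * z ^ i) - expo l i (twist l i (p i)) ω * z ^ i + c i := by
    ext1 i
    rcases i with _ | i
    · rw [expo_zeroPoly_zero]
      simp only [pow_zero, mul_one]
      rfl
    · rw [expo_zeroPoly_succ]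
      simp only [c]
      ring
  rw [e]
  exact this

end Series

end Poles

/-! ### The implicit function theorem for asymptotic expansions. -/

section Implicit

open Polynomial

/-- Asymptotic version of the implicit function theorem, one order at a time. -/
lemma implicit_step {v : ℕ → ℕ → ℂ} (h01 : v 0 1 ≠ 0) {X ω : ℕ → ℂ}
    (hX : Tendsto X atTop (𝓝 0)) (hX0 : ∀ᶠ k in atTop, X k ≠ 0) (hω : ω =O[atTop] X)
    {n : ℕ} (hv : (fun k => ∑ i ∈ Finset.range (n + 2), ∑ j ∈ Finset.range (n + 2),
      v i j * X k ^ i * ω k ^ j) =O[atTop] fun k => X k ^ (n + 2))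
    {h : ℂ[X]} (h0 : h.coeff 0 = 0)
    (he : (fun k => ω k - h.eval (X k)) =O[atTop] fun k => X k ^ (n + 1)) :
    (fun k => ω k - (h + C (-(v 0 1)⁻¹ * (∑ i ∈ Finset.range (n + 2), ∑ j ∈ Finset.range (n + 2),
      C (v i j) * Polynomial.X ^ i * h ^ j).coeff (n + 1)) * Polynomial.X ^ (n + 1)).eval (X k))
      =O[atTop] fun k => X k ^ (n + 2) := by
  set p : ℂ[X] := ∑ i ∈ Finset.range (n + 2), ∑ j ∈ Finset.range (n + 2),
    C (v i j) * Polynomial.X ^ i * h ^ j with hp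
  have hh : (fun k => h.eval (X k)) =O[atTop] X := by
    simpa using eval_isBigO hX (p := h) (M := 1) (fun j hj => by
      rw [Nat.lt_one_iff.1 hj, h0])
  have hpow : ∀ j : ℕ, (fun k => ω k ^ (j + 1) - h.eval (X k) ^ (j + 1))
      =O[atTop] fun k => X k ^ (n + 1 + j) := by
    intro j
    induction j with
    | zero => simpa using he
    | succ j ih =>
      have a1 := hω.mul ih
      have a2 := he.mul (hh.pow (j + 1))
      refine ((a1.congr_right (g₂ := fun k => X k ^ (n + 1 + (j + 1))) fun k => by ring).add
        (a2.congr_right (g₂ := fun k => X k ^ (n + 1 + (j + 1))) fun k => by ring)).congr_left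
        fun k => by ring
  -- Replacing ω by its approximation h in X^i ω^j, j ≥ 1, costs O(X^(n+i+j)). Below order n + 2
  -- only the monomial ω itself feels the replacement, so the correction is obtained by dividing by
  -- v 0 1.
  have hterm : ∀ i j : ℕ, (fun k => v i j * X k ^ i * ω k ^ j - v i j * X k ^ i * h.eval (X k) ^ j
      - if i = 0 ∧ j = 1 then v 0 1 * (ω k - h.eval (X k)) else 0)
      =O[atTop] fun k => X k ^ (n + 2) := by
    intro i j
    rcases j with _ | j
    · simpa using isBigO_zero (fun k => X k ^ (n + 2)) atTop
    · by_cases hij : i = 0 ∧ j = 0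
      · obtain ⟨rfl, rfl⟩ := hij
        have : (fun k => v 0 (0 + 1) * X k ^ 0 * ω k ^ (0 + 1)
            - v 0 (0 + 1) * X k ^ 0 * h.eval (X k) ^ (0 + 1)
            - if 0 = 0 ∧ 0 + 1 = 1 then v 0 1 * (ω k - h.eval (X k)) else 0) = fun _ => 0 := by
          ext k
          simp
          ring
        rw [this]
        exact isBigO_zero _ _
      · have hle : n + 2 ≤ i + (n + 1 + j) := by omega
        have a1 := ((isBigO_refl (fun k => X k ^ i) atTop).mul (hpow j)).const_mul_left (v i (j + 1))
        have a2 : (fun k => X k ^ i * X k ^ (n + 1 + j)) =O[atTop] fun k => X k ^ (n + 2) := by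
          simpa only [← pow_add] using pow_isBigO_pow hX hle
        refine (a1.trans a2).congr_left fun k => ?_
        rw [if_neg (by omega)]
        ring
  have hsum : (fun k => p.eval (X k) + v 0 1 * (ω k - h.eval (X k)))
      =O[atTop] fun k => X k ^ (n + 2) := by
    have a1 := IsBigO.sum (s := Finset.range (n + 2)) fun i _ =>
      IsBigO.sum (s := Finset.range (n + 2)) fun j _ => hterm i j
    refine (hv.sub a1).congr_left fun k => ?_
    simp only [Finset.sum_apply, Finset.sum_sub_distrib]
    have e1 : ∑ i ∈ Finset.range (n + 2), ∑ j ∈ Finset.range (n + 2),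
        (if i = 0 ∧ j = 1 then v 0 1 * (ω k - h.eval (X k)) else 0)
        = v 0 1 * (ω k - h.eval (X k)) := by
      rw [Finset.sum_eq_single 0 (fun i _ hi => by simp [hi]) (by simp),
        Finset.sum_eq_single 1 (fun j _ hj => by simp [hj]) (by simp)]
      simp
    have e2 : p.eval (X k) = ∑ i ∈ Finset.range (n + 2), ∑ j ∈ Finset.range (n + 2),
        v i j * X k ^ i * h.eval (X k) ^ j := by
      rw [hp, eval_finsetSum]
      refine Finset.sum_congr rfl fun i _ => ?_
      rw [eval_finsetSum]
      simp
    rw [e1, e2]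
    ring
  -- That h already solves the equation below order n + 1 is read off from the sequences by
  -- uniqueness of expansions; it is not carried along in the induction.
  have hp0 : ∀ j < n + 1, p.coeff j = 0 := by
    have a1 : (fun k => p.eval (X k)) =O[atTop] fun k => X k ^ (n + 1) := by
      refine ((hsum.trans (pow_isBigO_pow hX (Nat.le_succ (n + 1)))).sub
        (he.const_mul_left (v 0 1))).congr_left fun k => by ring
    intro j hj
    simpa using (HasExpansion.of_poly hX p).eq_zero hX hX0 a1 j hj
  have hp1 : (fun k => (p - C (p.coeff (n + 1)) * Polynomial.X ^ (n + 1)).eval (X k))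
      =O[atTop] fun k => X k ^ (n + 2) := by
    refine eval_isBigO hX fun j hj => ?_
    rw [coeff_sub, coeff_C_mul, coeff_X_pow]
    rcases Nat.lt_succ_iff_lt_or_eq.1 hj with hj | rfl
    · rw [hp0 j hj, if_neg hj.ne]
      simp
    · simp
  refine ((hsum.sub hp1).const_mul_left (v 0 1)⁻¹).congr_left fun k => ?_
  simp only [eval_sub, eval_add, eval_mul, eval_C, eval_pow, eval_X]
  field_simp
  ring

variable {ι : Type*} {S : Subalgebra ℂ (ι → ℂ)}

/-- The asymptotic expansion of the implicit function defined by a double series has coefficients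
in every algebra of functions which contains the coefficients of the series. -/
theorem exists_implicit_expansion {v : ι → ℕ → ℕ → ℂ} (hv : ∀ i j, (fun x => v x i j) ∈ S)
    (h01 : ∀ x, v x 0 1 ≠ 0) (hinv : (fun x => (v x 0 1)⁻¹) ∈ S) :
    ∃ δ : ι → PowerSeries ℂ, (∀ x, PowerSeries.coeff 0 (δ x) = 0) ∧
      (∀ n, (fun x => PowerSeries.coeff n (δ x)) ∈ S) ∧
      ∀ x (X ω : ℕ → ℂ), Tendsto X atTop (𝓝 0) → (∀ᶠ k in atTop, X k ≠ 0) → ω =O[atTop] X →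
        (∀ M, (fun k => ∑ i ∈ Finset.range M, ∑ j ∈ Finset.range M,
          v x i j * X k ^ i * ω k ^ j) =O[atTop] fun k => X k ^ M) → HasExpansion X ω (δ x) := by
  -- Successive approximations starting from 0, built from v alone before any sequence is chosen.
  -- This makes the expansion independent of the sequence and its coefficients members of S.
  set H : ℕ → ι → ℂ[X] := fun n => Nat.rec (fun _ => 0) (fun n h x =>
    h x + C (-(v x 0 1)⁻¹ * (∑ i ∈ Finset.range (n + 2), ∑ j ∈ Finset.range (n + 2),
      C (v x i j) * Polynomial.X ^ i * h x ^ j).coeff (n + 1)) * Polynomial.X ^ (n + 1)) n with hH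
  have Hs : ∀ n x, H (n + 1) x = H n x + C (-(v x 0 1)⁻¹ * (∑ i ∈ Finset.range (n + 2),
      ∑ j ∈ Finset.range (n + 2), C (v x i j) * Polynomial.X ^ i * H n x ^ j).coeff (n + 1))
      * Polynomial.X ^ (n + 1) := fun n x => rfl
  have Hreg : ∀ n, H n ∈ regPoly S := by
    intro n
    induction n with
    | zero => exact (regPoly S).zero_mem
    | succ n ih =>
      have e : (fun x => ∑ i ∈ Finset.range (n + 2), ∑ j ∈ Finset.range (n + 2),
          C (v x i j) * Polynomial.X ^ i * H n x ^ j) ∈ regPoly S := by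
        have : (fun x => ∑ i ∈ Finset.range (n + 2), ∑ j ∈ Finset.range (n + 2),
            C (v x i j) * Polynomial.X ^ i * H n x ^ j)
            = ∑ i ∈ Finset.range (n + 2), ∑ j ∈ Finset.range (n + 2),
              (fun x => C (v x i j)) * (fun _ => (Polynomial.X : ℂ[X])) ^ i * H n ^ j := by
          ext1 x
          simp [Finset.sum_apply]
        rw [this]
        exact (regPoly S).sum_mem fun i _ => (regPoly S).sum_mem fun j _ => (regPoly S).mul_mem
          ((regPoly S).mul_mem (C_mem_regPoly (hv i j)) ((regPoly S).pow_mem X_mem_regPoly i))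
          ((regPoly S).pow_mem ih j)
      exact (regPoly S).add_mem ih ((regPoly S).mul_mem
        (C_mem_regPoly (S.mul_mem (S.neg_mem hinv) (e (n + 1))))
        ((regPoly S).pow_mem X_mem_regPoly (n + 1)))
  have Hcoeff : ∀ n x m, m ≤ n → (H (n + 1) x).coeff m = (H n x).coeff m := by
    intro n x m hm
    rw [Hs, coeff_add, coeff_C_mul, coeff_X_pow, if_neg (by omega), mul_zero, add_zero]
  have Hle : ∀ n m x, m ≤ n → (H n x).coeff m = (H m x).coeff m := by
    intro n m x hm
    induction n, hm using Nat.le_induction with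
    | base => rfl
    | succ n hn ih => rw [Hcoeff n x m hn, ih]
  have Hdeg : ∀ n m x, n < m → (H n x).coeff m = 0 := by
    intro n
    induction n with
    | zero => intro m x _; exact coeff_zero m
    | succ n ih =>
      intro m x hm
      rw [Hs, coeff_add, ih m x (by omega), coeff_C_mul, coeff_X_pow, if_neg (by omega)]
      simp
  have H0 : ∀ n x, (H n x).coeff 0 = 0 := fun n x => by
    rw [Hle n 0 x (Nat.zero_le n)]
    exact coeff_zero 0
  refine ⟨fun x => PowerSeries.mk fun n => (H n x).coeff n, fun x => by simp [H0],
    fun n => by simpa using! Hreg n n, ?_⟩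
  intro x X ω hX hX0 hω hV
  have key : ∀ n, (fun k => ω k - (H n x).eval (X k)) =O[atTop] fun k => X k ^ (n + 1) := by
    intro n
    induction n with
    | zero => simpa [hH] using hω
    | succ n ih => exact implicit_step (h01 x) hX hX0 hω (hV (n + 2)) (H0 n x) ih
  intro M
  rcases M with _ | n
  · simpa using (hω.trans_tendsto hX).isBigO_one ℂ
  · have : (PowerSeries.mk fun n => (H n x).coeff n).trunc (n + 1) = H n x := by
      ext m
      rw [PowerSeries.coeff_trunc]
      split_ifs with hm
      · rw [PowerSeries.coeff_mk, Hle n m x (by omega)]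
      · rw [Hdeg n m x (by omega)]
    rw [this]
    exact key n

/-- The composition of the exponential with a power series without constant term. -/
noncomputable def expSeries (F : PowerSeries ℂ) : PowerSeries ℂ :=
  PowerSeries.mk fun n => ∑ m ∈ Finset.range (n + 1), PowerSeries.coeff n (F ^ m) / m.factorial

lemma HasExpansion.exp {X ω : ℕ → ℂ} {F : PowerSeries ℂ} (hX : Tendsto X atTop (𝓝 0))
    (hω : ω =O[atTop] X) (h : HasExpansion X ω F) (h0 : PowerSeries.coeff 0 F = 0) :
    HasExpansion X (fun k => Complex.exp (ω k)) (expSeries F) := by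
  intro M
  have hω0 : Tendsto ω atTop (𝓝 0) := hω.trans_tendsto hX
  have h1 : (fun k => Complex.exp (ω k) - ∑ m ∈ Finset.range M, ω k ^ m / m.factorial)
      =O[atTop] fun k => X k ^ M :=
    ((Complex.exp_sub_sum_range_isBigO_pow M).comp_tendsto hω0).trans (hω.pow M)
  set G : PowerSeries ℂ := ∑ m ∈ Finset.range M, PowerSeries.C ((m.factorial : ℂ)⁻¹) * F ^ m with hG
  have h2 : HasExpansion X (∑ m ∈ Finset.range M, (fun _ => (m.factorial : ℂ)⁻¹) * ω ^ m) G := by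
    have := (expansionRing hX).sum_mem (t := Finset.range M)
      (f := fun m => ((fun _ => (m.factorial : ℂ)⁻¹, PowerSeries.C ((m.factorial : ℂ)⁻¹))
        * (ω, F) ^ m : (ℕ → ℂ) × PowerSeries ℂ)) fun m _ =>
      (expansionRing hX).mul_mem (HasExpansion.const hX _)
        ((expansionRing hX).pow_mem (x := (ω, F)) h m)
    have h3 : HasExpansion X _ _ := this
    simpa [Prod.fst_sum, Prod.snd_sum] using! h3
  have h3 : G.trunc M = (expSeries F).trunc M := by
    ext n
    rw [PowerSeries.coeff_trunc, PowerSeries.coeff_trunc]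
    split_ifs with hn
    · rw [hG, expSeries, PowerSeries.coeff_mk, map_sum,
        ← Finset.sum_subset (Finset.range_subset_range.2 (Nat.succ_le_of_lt hn))]
      · refine Finset.sum_congr rfl fun m _ => ?_
        rw [PowerSeries.coeff_C_mul, div_eq_inv_mul]
      · intro m _ hm
        rw [Finset.mem_range, not_lt] at hm
        -- Without constant term, F^m starts at order m, so the powers m > n do not contribute to
        -- the coefficient of order n.
        obtain ⟨Q, hQ⟩ := PowerSeries.X_dvd_iff.2
          ((PowerSeries.coeff_zero_eq_constantCoeff_apply F).symm.trans h0)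
        rw [PowerSeries.coeff_C_mul, hQ, mul_pow, PowerSeries.coeff_X_pow_mul', if_neg (by omega),
          mul_zero]
    · rfl
  have h4 := h2 M
  rw [h3] at h4
  refine (h1.add h4).congr_left fun k => ?_
  simp only [Finset.sum_apply, Pi.mul_apply, Pi.pow_apply, div_eq_inv_mul]
  ring

lemma coeff_expSeries_mem {F : ι → PowerSeries ℂ} (hF : ∀ n, (fun x => PowerSeries.coeff n (F x)) ∈ S)
    (n : ℕ) : (fun x => PowerSeries.coeff n (expSeries (F x))) ∈ S := by
  have hpow : ∀ m n, (fun x => PowerSeries.coeff n (F x ^ m)) ∈ S := by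
    intro m
    induction m with
    | zero =>
      intro n
      simp only [pow_zero, PowerSeries.coeff_one]
      exact const_mem _
    | succ m ih =>
      intro n
      have : (fun x => PowerSeries.coeff n (F x ^ (m + 1)))
          = ∑ p ∈ Finset.HasAntidiagonal.antidiagonal n, (fun x => PowerSeries.coeff p.1 (F x ^ m))
            * (fun x => PowerSeries.coeff p.2 (F x)) := by
        ext x
        simp [pow_succ, PowerSeries.coeff_mul]
      rw [this]
      exact S.sum_mem fun p _ => S.mul_mem (ih _) (hF _)
  have : (fun x => PowerSeries.coeff n (expSeries (F x))) = ∑ m ∈ Finset.range (n + 1),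
      (fun x => PowerSeries.coeff n (F x ^ m)) * (fun _ => ((m.factorial : ℂ))⁻¹) := by
    ext x
    simp [expSeries, div_eq_mul_inv]
  rw [this]
  exact S.sum_mem fun m _ => S.mul_mem (hpow m n) (const_mem _)

end Implicit

/-! ### Poles of the branch near x_k(1). -/

section Poles

open Polynomial

variable {μ : ℂ} {ν : ℝ} {d : ℂ} {φ r : ℝ} {y : ℂ → ℂ} {w : ℕ → ℂ[X]} {Y : ℂ → ℂ} {η ρ B : ℝ}

lemma IsSeries.isJetFamily (h : IsSeries μ ν d φ r y w Y η ρ B) (hν : 0 < ν) :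
    ∃ R C, R ≤ η / 2 ∧ IsJetFamily (2 * μ - 1) (2 * Complex.I * ν) (ser (2 * Complex.I * ν) w)
      (ser (2 * Complex.I * ν) fun i => twist (2 * Complex.I * ν) i (w i))
      (ser (2 * Complex.I * ν) fun i =>
        twist (2 * Complex.I * ν) i (twist (2 * Complex.I * ν) i (w i))) R C := by
  have hη := h.η_pos
  have hρ := h.ρ_pos
  have hν' : (ν : ℂ) ≠ 0 := by exact_mod_cast hν.ne'
  have hw0 : w 0 = quadPoly (2 * μ - 1) (2 * Complex.I * ν) := h.lead.trans (leadPoly_eq μ hν)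
  have b0 : SerBound (2 * Complex.I * ν) w η ρ B := h.bound
  set l : ℂ := 2 * Complex.I * ν with hl
  have hl0 : l ≠ 0 := mul_ne_zero (mul_ne_zero two_ne_zero Complex.I_ne_zero) hν'
  have b1 := b0.twist hη hρ
  have b2 := b1.twist (half_pos hη) hρ
  have n0 := b0.nonneg hη
  have n1 := b1.nonneg (half_pos hη)
  have n2 := b2.nonneg (half_pos (half_pos hη))
  set B₁ := B / (η / 2)
  set B₂ := B₁ / (η / 2 / 2)
  have hR1 : min (η / 4) (ρ / 2) ≤ η / 4 := min_le_left _ _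
  have hR2 : min (η / 4) (ρ / 2) ≤ ρ / 2 := min_le_right _ _
  have hle : ∀ {b : ℝ}, b ≤ B + B₁ + B₂ → ∀ z : ℂ,
      2 * b / ρ * ‖z‖ ≤ 2 * (B + B₁ + B₂) / ρ * ‖z‖ := fun hb z => by gcongr
  refine ⟨min (η / 4) (ρ / 2), 2 * (B + B₁ + B₂) / ρ, by linarith, by positivity, ?_, ?_, ?_, ?_, ?_,
    ?_, ?_, ?_, ?_, ?_⟩
  · exact fun z ω hz hω => b0.hasDerivAt hρ (by linarith) (by linarith)
  · exact fun z ω hz hω => b1.hasDerivAt hρ (by linarith) (by linarith)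
  · exact fun z ω hz hω => (b2.hasDerivAt hρ (by linarith) (by linarith)).continuousAt
  · exact fun z ω hz hω => (b0.norm_sub_zero_le hρ (by linarith) (by linarith)).trans
      (hle (by linarith) z)
  · exact fun z ω hz hω => (b1.norm_sub_zero_le hρ (by linarith) (by linarith)).trans
      (hle (by linarith) z)
  · exact fun z ω hz hω => (b2.norm_sub_zero_le hρ (by linarith) (by linarith)).trans
      (hle (by linarith) z)
  · rw [ser_zero_left, expo_zero, hw0, eval_quadPoly_one hl0]
  · rw [ser_zero_left, expo_zero, hw0, eval_twist_quadPoly_one hl0]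
  · rw [ser_zero_left, expo_zero, hw0, eval_twist_twist_quadPoly_one hl0]
  · simp only [ser_zero_left, hw0]
    exact eventually_expo_quadPoly_ne_zero hl0

lemma Admissible.add_ne_zero (h : Admissible μ ν) : 2 * μ - 1 + 2 * Complex.I * ν ≠ 0 :=
  fun e => h.2.2 (eq_neg_of_add_eq_zero_left e)

/-- The poles near `x_k(1)`, with the implicit equation for `ω = ln ξ_k(1) - ln x_k(1)`. -/
theorem IsSeries.exists_poles (h : IsSeries μ ν d φ r y w Y η ρ B) (hμ : Admissible μ ν)
    (hy : SolvesPVI μ y (sheet φ r)) :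
    ∃ ω : ℕ → ℂ, (ω =O[atTop] fun k => Complex.exp (logZero ν d k)) ∧
      (∀ᶠ k in atTop, Complex.exp (logZero ν d k) * Complex.exp (ω k) ∈ sheet φ r ∧
        meromorphicOrderAt y (Complex.exp (logZero ν d k) * Complex.exp (ω k)) < 0 ∧
        (μ = 1 / 2 → meromorphicOrderAt y (Complex.exp (logZero ν d k) * Complex.exp (ω k))
          = ((-2 : ℤ) : WithTop ℤ))) ∧
      ∀ M, (fun k => ∑ i ∈ Finset.range M, ∑ j ∈ Finset.range M,
        serCoeff (2 * Complex.I * ν) (zeroPoly (2 * μ - 1) (2 * Complex.I * ν) w) i j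
          * Complex.exp (logZero ν d k) ^ i * ω k ^ j)
        =O[atTop] fun k => Complex.exp (logZero ν d k) ^ M := by
  have hν := hμ.1
  have hη := h.η_pos
  have hρ := h.ρ_pos
  have hν' : (ν : ℂ) ≠ 0 := by exact_mod_cast hν.ne'
  have hX := tendsto_exp_logZero hν d
  obtain ⟨R, C, hR, hJ⟩ := h.isJetFamily hν
  obtain ⟨ω, hω, hz⟩ := hJ.exists_zeros
    (mul_ne_zero (mul_ne_zero two_ne_zero Complex.I_ne_zero) hν') hμ.add_ne_zero hX
    ((h.homODE_eq_zero hν hy).mono fun k hk ω hω => hk ω (by linarith))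
  have hω0 : Tendsto ω atTop (𝓝 0) := hω.trans_tendsto hX
  have hωη := (tendsto_norm_zero.comp hω0).eventually_lt_const (half_pos hη)
  have hXρ := (tendsto_norm_zero.comp hX).eventually_lt_const hρ
  refine ⟨ω, hω, ?_, fun M => ?_⟩
  · filter_upwards [hz, hωη, h.eventually_eq hν] with k hk hkη he
    obtain ⟨k0, k12, ka, -⟩ := hk
    obtain ⟨hx, e0, e1, e2⟩ := he (ω k) hkη
    set x := Complex.exp (logZero ν d k) * Complex.exp (ω k) with hxdef
    have hx0 : x ≠ 0 := mul_ne_zero (Complex.exp_ne_zero _) (Complex.exp_ne_zero _)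
    obtain ⟨o1, o2⟩ := meromorphicOrderAt_of_inv (isOpen_sheet φ r) h.differentiableOn h.eq_inv hx
      (e0.trans k0) (by
        rw [← e1, ← e2] at k12
        by_contra! hc
        simp [hc.1, hc.2] at k12)
    refine ⟨hx, o1, fun hμ2 => o2 ?_⟩
    have := (ka (by rw [hμ2]; norm_num)).1
    rw [← e1] at this
    exact (mul_eq_zero.1 this).resolve_left hx0
  · have b0 : SerBound (2 * Complex.I * ν) w η ρ B := h.bound
    have b1 := b0.twist hη hρ
    have b0' := b0.mono (half_le_self hη.le)
    have bz := serBound_zeroPoly (half_pos hη) hρ (2 * μ - 1) b0' b1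
    have := bz.isBigO (half_pos hη) hρ hX hω M
    refine this.neg_left.congr' ?_ EventuallyEq.rfl
    filter_upwards [hz, hωη, hXρ] with k hk hkη hkρ
    rw [ser_zeroPoly hρ _ b0' b1 hkρ (le_of_lt hkη), hk.2.2.2]
    ring

end Poles

/-! ### Rational functions of μ and ν regular at admissible values. -/

section Rational

open Polynomial

variable {ι : Type*}

section Eval

variable {S : Subalgebra ℂ (ι → ℂ)}

lemma natDegree_twist_le (l : ℂ) (i : ℕ) {p : ℂ[X]} {N : ℕ} (h : p.natDegree ≤ N) :
    (twist l i p).natDegree ≤ N := by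
  rw [natDegree_le_iff_coeff_eq_zero] at h ⊢
  intro n hn
  rw [coeff_twist, h n hn, mul_zero]

/-- A degree bound uniform in the parameters makes the value at s = 1, that is at ω = 0, a finite
sum of regular coefficients. -/
lemma eval_one_mem {p : ι → ℂ[X]} (hp : p ∈ regPoly S) {N : ℕ} (hN : ∀ x, (p x).natDegree ≤ N) :
    (fun x => (p x).eval 1) ∈ S := by
  have : (fun x => (p x).eval 1) = ∑ j ∈ Finset.range (N + 1), fun x => (p x).coeff j := by
    ext x
    rw [eval_eq_sum_range' (Nat.lt_succ_of_le (hN x))]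
    simp
  rw [this]
  exact S.sum_mem fun j _ => hp j

lemma serCoeff_mem {l : ι → ℂ} (hl : l ∈ S) {p : ι → ℕ → ℂ[X]} {i N : ℕ}
    (hp : (fun x => p x i) ∈ regPoly S) (hN : ∀ x, (p x i).natDegree ≤ N) (j : ℕ) :
    (fun x => serCoeff (l x) (p x) i j) ∈ S := by
  have h : (fun x => (twist (l x) i)^[j] (p x i)) ∈ regPoly S ∧
      ∀ x, ((twist (l x) i)^[j] (p x i)).natDegree ≤ N := by
    induction j with
    | zero => exact ⟨hp, hN⟩
    | succ j ih =>
      simp only [Function.iterate_succ_apply']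
      exact ⟨twist_mem_regPoly hl i ih.1, fun x => natDegree_twist_le _ _ (ih.2 x)⟩
  have := S.mul_mem (eval_one_mem h.1 h.2) (const_mem ((j.factorial : ℂ)⁻¹))
  simpa only [serCoeff, div_eq_mul_inv] using! this

lemma zeroPoly_mem {a l : ι → ℂ} (ha : a ∈ S) (hl : l ∈ S) {w : ι → ℕ → ℂ[X]}
    (hw : ∀ i, (fun x => w x i) ∈ regPoly S) (i : ℕ) :
    (fun x => zeroPoly (a x) (l x) (w x) i) ∈ regPoly S := by
  have h1 := (regPoly S).sub_mem ((regPoly S).mul_mem (C_mem_regPoly hl) (hw i))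
    (twist_mem_regPoly hl i (hw i))
  rcases i with _ | i
  · exact (regPoly S).add_mem h1 ((regPoly S).mul_mem (C_mem_regPoly ha) X_mem_regPoly)
  · have := (regPoly S).add_mem h1 ((regPoly S).mul_mem X_mem_regPoly (twist_mem_regPoly hl i (hw i)))
    simpa [zeroPoly] using! this

lemma natDegree_zeroPoly_le (a l : ℂ) {w : ℕ → ℂ[X]} (hw : ∀ i, (w i).natDegree ≤ 2 * (i + 1))
    (i : ℕ) : (zeroPoly a l w i).natDegree ≤ 2 * (i + 1) := by
  have h1 : (C l * w i - twist l i (w i)).natDegree ≤ 2 * (i + 1) :=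
    (natDegree_sub_le _ _).trans (max_le ((natDegree_C_mul_le _ _).trans (hw i))
      (natDegree_twist_le _ _ (hw i)))
  refine natDegree_add_le_of_degree_le h1 ?_
  rcases i with _ | i
  · exact (natDegree_C_mul_le _ _).trans (natDegree_X_le.trans (by norm_num))
  · have h2 := natDegree_twist_le l i (hw i)
    have h3 := natDegree_mul_le (p := (X : ℂ[X])) (q := twist l i (w i))
    simp only [natDegree_X] at h3
    simp only [Nat.add_eq_zero_iff, one_ne_zero, and_false, if_false, Nat.add_sub_cancel]
    omega

end Eval

/-- The functions on a family of parameters which are rational in `μ`, `ν`, with a denominator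
that does not vanish at any admissible value. -/
def regularFunctions (μ : ι → ℂ) (ν : ι → ℝ) (h : ∀ x, Admissible (μ x) (ν x)) :
    Subalgebra ℂ (ι → ℂ) where
  carrier := {f | ∃ P Q : MvPolynomial (Fin 2) ℂ,
    (∀ μ ν, Admissible μ ν → MvPolynomial.eval ![μ, (ν : ℂ)] Q ≠ 0) ∧
    ∀ x, f x = MvPolynomial.eval ![μ x, (ν x : ℂ)] P / MvPolynomial.eval ![μ x, (ν x : ℂ)] Q}
  mul_mem' := by
    rintro f g ⟨P, Q, hQ, hf⟩ ⟨P', Q', hQ', hg⟩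
    refine ⟨P * P', Q * Q', fun μ ν h => ?_, fun x => ?_⟩
    · rw [map_mul]
      exact mul_ne_zero (hQ μ ν h) (hQ' μ ν h)
    · rw [Pi.mul_apply, hf, hg, map_mul, map_mul, div_mul_div_comm]
  add_mem' := by
    rintro f g ⟨P, Q, hQ, hf⟩ ⟨P', Q', hQ', hg⟩
    refine ⟨P * Q' + Q * P', Q * Q', fun μ ν h => ?_, fun x => ?_⟩
    · rw [map_mul]
      exact mul_ne_zero (hQ μ ν h) (hQ' μ ν h)
    · rw [Pi.add_apply, hf, hg, map_mul, map_add, map_mul, map_mul,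
        div_add_div _ _ (hQ _ _ (h x)) (hQ' _ _ (h x))]
  algebraMap_mem' c := ⟨MvPolynomial.C c, 1, by simp, by simp⟩

variable {μ : ι → ℂ} {ν : ι → ℝ} {h : ∀ x, Admissible (μ x) (ν x)}

lemma eval_mem_regularFunctions (P : MvPolynomial (Fin 2) ℂ) :
    (fun x => MvPolynomial.eval ![μ x, (ν x : ℂ)] P) ∈ regularFunctions μ ν h :=
  ⟨P, 1, by simp, by simp⟩

lemma inv_eval_mem_regularFunctions {P : MvPolynomial (Fin 2) ℂ}
    (hP : ∀ μ ν, Admissible μ ν → MvPolynomial.eval ![μ, (ν : ℂ)] P ≠ 0) :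
    (fun x => (MvPolynomial.eval ![μ x, (ν x : ℂ)] P)⁻¹) ∈ regularFunctions μ ν h :=
  ⟨1, P, hP, by simp⟩

/-- The affine function `c₀ + c₁ (2μ - 1) + 2 c₂ iν`, as a polynomial in `μ` and `ν`. -/
noncomputable def affinePoly (c₀ c₁ c₂ : ℂ) : MvPolynomial (Fin 2) ℂ :=
  MvPolynomial.C c₀ + MvPolynomial.C c₁ * (MvPolynomial.C 2 * MvPolynomial.X 0 - 1)
    + MvPolynomial.C (c₂ * (2 * Complex.I)) * MvPolynomial.X 1

lemma eval_affinePoly (c₀ c₁ c₂ μ : ℂ) (ν : ℝ) : MvPolynomial.eval ![μ, (ν : ℂ)] (affinePoly c₀ c₁ c₂)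
    = c₀ + c₁ * (2 * μ - 1) + c₂ * (2 * Complex.I * ν) := by
  simp [affinePoly]
  ring

lemma affine_mem (c₀ c₁ c₂ : ℂ) : (fun x => c₀ + c₁ * (2 * μ x - 1) + c₂ * (2 * Complex.I * ν x))
    ∈ regularFunctions μ ν h := by
  simpa only [eval_affinePoly] using eval_mem_regularFunctions (h := h) (affinePoly c₀ c₁ c₂)

lemma inv_affine_mem {c₀ c₁ c₂ : ℂ}
    (hc : ∀ μ ν, Admissible μ ν → c₀ + c₁ * (2 * μ - 1) + c₂ * (2 * Complex.I * ν) ≠ 0) :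
    (fun x => (c₀ + c₁ * (2 * μ x - 1) + c₂ * (2 * Complex.I * ν x))⁻¹)
      ∈ regularFunctions μ ν h := by
  have := inv_eval_mem_regularFunctions (h := h) (P := affinePoly c₀ c₁ c₂)
    (by simpa only [eval_affinePoly] using hc)
  simpa only [eval_affinePoly] using this

/-- The second summand is purely imaginary, so the real part is i. For ν real there are no
resonances. -/
lemma resonance_ne_zero {i : ℕ} (hi : i ≠ 0) (j : ℕ) (ν : ℝ) :
    (i : ℂ) + ((j : ℂ) - i) * (2 * Complex.I * ν) ≠ 0 := by
  intro h
  have := congrArg Complex.re h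
  simp at this
  exact hi this

end Rational

/-! ### The expansion for all admissible parameters at once. -/

section Universal

open Polynomial

/-- The formal solutions of the equation, for all admissible parameters. -/
structure FormalSolution where
  μ : ℂ
  ν : ℝ
  admissible : Admissible μ ν
  w : ℕ → ℂ[X]
  lead : w 0 = leadPoly μ ν
  natDegree_le : ∀ i, (w i).natDegree ≤ 2 * (i + 1)
  formalODE_eq_zero : formalODE (2 * μ - 1) (2 * Complex.I * ν) w = 0

namespace FormalSolution

/-- The regular rational functions, as functions of the formal solutions. -/
noncomputable abbrev regular : Subalgebra ℂ (FormalSolution → ℂ) := regularFunctions μ ν admissible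

lemma l_ne_zero {ν : ℝ} (hν : 0 < ν) : 2 * Complex.I * (ν : ℂ) ≠ 0 :=
  mul_ne_zero (mul_ne_zero two_ne_zero Complex.I_ne_zero) (by exact_mod_cast hν.ne')

lemma a_mem : (fun x : FormalSolution => 2 * x.μ - 1) ∈ regular := by
  simpa using affine_mem (h := admissible) 0 1 0

lemma l_mem : (fun x : FormalSolution => 2 * Complex.I * (x.ν : ℂ)) ∈ regular := by
  simpa using affine_mem (h := admissible) 0 0 1

lemma inv_l_mem : (fun x : FormalSolution => (2 * Complex.I * (x.ν : ℂ))⁻¹) ∈ regular := by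
  have := inv_affine_mem (h := FormalSolution.admissible) (c₀ := 0) (c₁ := 0) (c₂ := 1) (by
    intro μ ν h
    simpa using h.1.ne')
  simpa only [zero_mul, zero_add, one_mul] using this

lemma inv_add_mem : (fun x : FormalSolution => (2 * x.μ - 1 + 2 * Complex.I * (x.ν : ℂ))⁻¹)
    ∈ regular := by
  have := inv_affine_mem (h := FormalSolution.admissible) (c₀ := 0) (c₁ := 1) (c₂ := 1) (by
    intro μ ν h
    simpa using h.add_ne_zero)
  simpa only [zero_add, one_mul] using this

lemma inv_resonance_mem {i : ℕ} (hi : i ≠ 0) (j : ℕ) :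
    (fun x : FormalSolution => ((i : ℂ) + ((j : ℂ) - i) * (2 * Complex.I * x.ν))⁻¹) ∈ regular := by
  have := inv_affine_mem (h := FormalSolution.admissible) (c₀ := i) (c₁ := 0) (c₂ := (j : ℂ) - i) (by
    intro μ ν h
    simpa using resonance_ne_zero hi j ν)
  simpa only [zero_mul, add_zero] using this

lemma w_zero (x : FormalSolution) : x.w 0 = quadPoly (2 * x.μ - 1) (2 * Complex.I * x.ν) :=
  x.lead.trans (leadPoly_eq _ x.admissible.1)

lemma quadPoly_eq (a l : ℂ) : quadPoly a l = C (-(a + l) ^ 2 * (4⁻¹ * l⁻¹ ^ 2))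
    + C ((a ^ 2 + l ^ 2) * (2⁻¹ * l⁻¹ ^ 2)) * X + C (-(a - l) ^ 2 * (4⁻¹ * l⁻¹ ^ 2)) * X ^ 2 := by
  simp only [quadPoly, div_eq_mul_inv, mul_inv, inv_pow]

lemma w_mem (i : ℕ) : (fun x : FormalSolution => x.w i) ∈ regPoly regular := by
  have c0 : ∀ x : FormalSolution, (x.w 0).coeff 0
      = -(2 * x.μ - 1 + 2 * Complex.I * x.ν) ^ 2 / (4 * (2 * Complex.I * x.ν) ^ 2) := by
    intro x
    rw [w_zero, quadPoly]
    simp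
  refine formalSolution_mem a_mem l_mem ?_ ?_ ?_ (fun x => x.formalODE_eq_zero) i
  · simp only [w_zero, quadPoly_eq]
    have hsq : ∀ {f : FormalSolution → ℂ}, f ∈ regular → (fun x => f x ^ 2) ∈ regular :=
      fun hf => regular.pow_mem hf 2
    have i4 := regular.mul_mem (const_mem (4⁻¹ : ℂ)) (hsq inv_l_mem)
    have i2 := regular.mul_mem (const_mem (2⁻¹ : ℂ)) (hsq inv_l_mem)
    have e1 := regular.mul_mem (regular.neg_mem (hsq (regular.add_mem a_mem l_mem))) i4
    have e2 := regular.mul_mem (regular.add_mem (hsq a_mem) (hsq l_mem)) i2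
    have e3 := regular.mul_mem (regular.neg_mem (hsq (regular.sub_mem a_mem l_mem))) i4
    exact (regPoly regular).add_mem ((regPoly regular).add_mem (C_mem_regPoly e1)
      ((regPoly regular).mul_mem (C_mem_regPoly e2) X_mem_regPoly))
      ((regPoly regular).mul_mem (C_mem_regPoly e3) ((regPoly regular).pow_mem X_mem_regPoly 2))
  · intro i j hi
    -- Since w_0(0) = -(a + l)²/(4 l²), the inverse pivot is 8 l⁴ (a + l)⁻⁴ (i + (j - i) l)⁻².
    have := regular.mul_mem (regular.mul_mem (regular.mul_mem (const_mem (8 : ℂ))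
      (regular.pow_mem inv_add_mem 4)) (regular.pow_mem l_mem 4))
      (regular.pow_mem (inv_resonance_mem hi j) 2)
    convert this using 1
    ext x
    simp only [c0, Pi.mul_apply, Pi.pow_apply]
    have h1 := x.admissible.add_ne_zero
    have h2 := l_ne_zero x.admissible.1
    have h3 := resonance_ne_zero hi j x.ν
    set u := 2 * x.μ - 1 + 2 * Complex.I * x.ν
    set l := 2 * Complex.I * (x.ν : ℂ)
    set m := (i : ℂ) + ((j : ℂ) - i) * l
    field_simp
    norm_num
  · intro x i j hi
    rw [c0]
    have h1 := x.admissible.add_ne_zero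
    have h2 := l_ne_zero x.admissible.1
    have h3 := resonance_ne_zero hi j x.ν
    exact mul_ne_zero (mul_ne_zero two_ne_zero (pow_ne_zero 2 (div_ne_zero
      (neg_ne_zero.2 (pow_ne_zero 2 h1)) (mul_ne_zero (by norm_num) (pow_ne_zero 2 h2)))))
      (pow_ne_zero 2 h3)

/-- The coefficients of the implicit equation for `ω = ln ξ_k(1) - ln x_k(1)`. -/
noncomputable def v (x : FormalSolution) : ℕ → ℕ → ℂ :=
  serCoeff (2 * Complex.I * x.ν) (zeroPoly (2 * x.μ - 1) (2 * Complex.I * x.ν) x.w)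

lemma v_mem (i j : ℕ) : (fun x : FormalSolution => x.v i j) ∈ regular :=
  serCoeff_mem l_mem (zeroPoly_mem a_mem l_mem w_mem i)
    (fun x => natDegree_zeroPoly_le _ _ x.natDegree_le i) j

/-- The derivative of the implicit equation at the origin is l a + (a² + l²)/2, a perfect square
that does not vanish for admissible parameters, not even for a = 0. -/
lemma v_zero_one (x : FormalSolution) :
    x.v 0 1 = (2 * x.μ - 1 + 2 * Complex.I * x.ν) ^ 2 / 2 := by
  have h2 := l_ne_zero x.admissible.1
  have e1 := eval_twist_quadPoly_one (a := 2 * x.μ - 1) h2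
  have e2 := eval_twist_twist_quadPoly_one (a := 2 * x.μ - 1) h2
  have e0 := eval_quadPoly_one (a := 2 * x.μ - 1) h2
  set l := 2 * Complex.I * (x.ν : ℂ)
  set a := 2 * x.μ - 1
  have hz : zeroPoly a l x.w 0 = C l * quadPoly a l - twist l 0 (quadPoly a l) + C a * X := by
    rw [zeroPoly, if_pos rfl, w_zero]
  have ht : twist l 0 (zeroPoly a l x.w 0) = C l * twist l 0 (quadPoly a l)
      - twist l 0 (twist l 0 (quadPoly a l)) := by
    rw [hz]
    simp only [twist, derivative_add, derivative_sub, derivative_mul, derivative_C, derivative_X]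
    simp
    ring
  rw [v, serCoeff, Function.iterate_one, ht, eval_sub, eval_mul, eval_C, e1, e2]
  simp
  ring

/-- The index set ι is the type of all formal solutions, so membership in `regular` yields a single
pair P, Q valid for every parameter that carries a solution. -/
theorem exists_regular_expansion : ∃ D : ℕ → ℂ → ℝ → ℂ,
    (∀ n, ∃ P Q : MvPolynomial (Fin 2) ℂ, ∀ μ ν, Admissible μ ν →
      MvPolynomial.eval ![μ, (ν : ℂ)] Q ≠ 0 ∧
      D n μ ν = MvPolynomial.eval ![μ, (ν : ℂ)] P / MvPolynomial.eval ![μ, (ν : ℂ)] Q) ∧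
    ∀ (x : FormalSolution) (X ω : ℕ → ℂ), Tendsto X atTop (𝓝 0) → (∀ᶠ k in atTop, X k ≠ 0) →
      ω =O[atTop] X →
      (∀ M, (fun k => ∑ i ∈ Finset.range M, ∑ j ∈ Finset.range M,
        x.v i j * X k ^ i * ω k ^ j) =O[atTop] fun k => X k ^ M) →
      ∃ δ : PowerSeries ℂ, PowerSeries.coeff 0 δ = 0 ∧ HasExpansion X ω δ ∧
        ∀ n, PowerSeries.coeff n (expSeries δ) = D n x.μ x.ν := by
  have hne : ∀ x : FormalSolution, x.v 0 1 ≠ 0 := fun x => by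
    rw [v_zero_one]
    exact div_ne_zero (pow_ne_zero 2 x.admissible.add_ne_zero) two_ne_zero
  obtain ⟨δ, h0, hδ, hex⟩ := exists_implicit_expansion v_mem hne (by
    have := regular.mul_mem (const_mem (2 : ℂ)) (regular.pow_mem inv_add_mem 2)
    convert this using 1
    ext x
    rw [v_zero_one]
    simp [div_eq_mul_inv])
  choose P Q hQ hD using fun n => coeff_expSeries_mem hδ n
  refine ⟨fun n μ ν => MvPolynomial.eval ![μ, (ν : ℂ)] (P n) / MvPolynomial.eval ![μ, (ν : ℂ)] (Q n),
    fun n => ⟨P n, Q n, fun μ ν h => ⟨hQ n μ ν h, rfl⟩⟩, fun x X ω hX hX0 hω hv => ?_⟩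
  exact ⟨δ x, h0 x, hex x X ω hX hX0 hω hv, fun n => hD n x⟩

end FormalSolution

end Universal

/-! ### Conditions on a formal solution up to order 3. -/

section Explicit

open Polynomial

section Twist

variable (l : ℂ)

lemma twist_add (i : ℕ) (p q : ℂ[X]) : twist l i (p + q) = twist l i p + twist l i q := by
  simp only [twist, derivative_add]
  ring

lemma twist_smul (i : ℕ) (c : ℂ) (p : ℂ[X]) : twist l i (c • p) = c • twist l i p := by
  simp only [twist, smul_eq_C_mul, derivative_mul, derivative_C]
  ring

lemma twist_sub (i : ℕ) (p q : ℂ[X]) : twist l i (p - q) = twist l i p - twist l i q := by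
  simp only [twist, derivative_sub]
  ring

lemma twist_zero_X : twist l 0 X = 0 := by
  simp [twist]

/-- The operator `twist` of index k is D acting on ξ^k p/s. As ξ^(k+1) p q/s = x (ξ^k p/s)(q/s) and
D x = x, this is the Leibniz rule with a third term from x. -/
lemma twist_succ_mul (k : ℕ) (p q : ℂ[X]) :
    twist l (k + 1) (p * q) = twist l k p * q + p * twist l 0 q + p * q := by
  simp only [twist, derivative_mul, Nat.cast_add, Nat.cast_one, Nat.cast_zero, map_sub, map_add,
    map_mul, map_one, map_zero]
  ring

/-- The polynomial with the first `N` coefficients `b 0, b 1, …`. -/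
noncomputable def ofCoeffs (N : ℕ) (b : ℕ → ℂ) : ℂ[X] := ∑ j ∈ Finset.range N, b j • X ^ j

lemma twist_ofCoeffs (i N : ℕ) (b : ℕ → ℂ) :
    twist l i (ofCoeffs N b) = ofCoeffs N fun j => (i + ((j : ℂ) - i - 1) * l) * b j := by
  ext n
  simp only [coeff_twist, ofCoeffs, finsetSum_coeff, coeff_smul, coeff_X_pow, smul_eq_mul, mul_ite,
    mul_one, mul_zero, Finset.sum_ite_eq]

lemma eval_ofCoeffs (N : ℕ) (b : ℕ → ℂ) (s : ℂ) :
    (ofCoeffs N b).eval s = ∑ j ∈ Finset.range N, b j * s ^ j := by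
  simp [ofCoeffs, eval_finsetSum]

end Twist

section Coefficients

variable {R : Type*} [CommRing R]

lemma coeff_ofNat_two (n : ℕ) :
    PowerSeries.coeff n (2 : PowerSeries R) = if n = 0 then 2 else 0 := by
  rw [← map_ofNat (PowerSeries.C (R := R)) 2, PowerSeries.coeff_C]

lemma coeff_zero_mul_eq (f g : PowerSeries R) : PowerSeries.coeff 0 (f * g)
    = PowerSeries.coeff 0 f * PowerSeries.coeff 0 g := by
  simp

lemma coeff_one_mul_eq (f g : PowerSeries R) : PowerSeries.coeff 1 (f * g)
    = PowerSeries.coeff 0 f * PowerSeries.coeff 1 g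
      + PowerSeries.coeff 1 f * PowerSeries.coeff 0 g := by
  rw [PowerSeries.coeff_mul, show Finset.HasAntidiagonal.antidiagonal 1 = {(0, 1), (1, 0)} from rfl]
  simp

lemma coeff_two_mul (f g : PowerSeries R) : PowerSeries.coeff 2 (f * g)
    = PowerSeries.coeff 0 f * PowerSeries.coeff 2 g + PowerSeries.coeff 1 f * PowerSeries.coeff 1 g
      + PowerSeries.coeff 2 f * PowerSeries.coeff 0 g := by
  rw [PowerSeries.coeff_mul,
    show Finset.HasAntidiagonal.antidiagonal 2 = {(0, 2), (1, 1), (2, 0)} from rfl]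
  simp [add_assoc]

lemma coeff_three_mul (f g : PowerSeries R) : PowerSeries.coeff 3 (f * g)
    = PowerSeries.coeff 0 f * PowerSeries.coeff 3 g + PowerSeries.coeff 1 f * PowerSeries.coeff 2 g
      + PowerSeries.coeff 2 f * PowerSeries.coeff 1 g
      + PowerSeries.coeff 3 f * PowerSeries.coeff 0 g := by
  rw [PowerSeries.coeff_mul,
    show Finset.HasAntidiagonal.antidiagonal 3 = {(0, 3), (1, 2), (2, 1), (3, 0)} from rfl]
  simp [add_assoc]

end Coefficients

lemma homODE_map {R S : Type*} [CommRing R] [CommRing S] (f : R →+* S) (ξ s a2 W W1 W2 : R) :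
    f (homODE ξ s a2 W W1 W2) = homODE (f ξ) (f s) (f a2) (f W) (f W1) (f W2) := by
  simp only [homODE, map_sub, map_add, map_mul, map_pow, map_one, map_ofNat]

lemma eval_coeff_formalODE (a l s : ℂ) (w : ℕ → ℂ[X]) (n : ℕ) :
    (PowerSeries.coeff n (formalODE a l w)).eval s = PowerSeries.coeff n
      (homODE PowerSeries.X (PowerSeries.C s) (PowerSeries.C (a ^ 2))
        (PowerSeries.mk fun i => (w i).eval s)
        (PowerSeries.mk fun i => (twist l i (w i)).eval s)
        (PowerSeries.mk fun i => (twist l i (twist l i (w i))).eval s)) := by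
  have h : ∀ f : ℕ → ℂ[X], PowerSeries.map (evalRingHom s) (PowerSeries.mk f)
      = PowerSeries.mk fun i => (f i).eval s := fun f => by
    ext i
    simp
  rw [← coe_evalRingHom, ← PowerSeries.coeff_map, formalODE, homODE_map]
  simp only [h, PowerSeries.map_X, PowerSeries.map_C, coe_evalRingHom, eval_X, eval_C]

section Jets

/-- The condition of order `2` on the jet `(g, g1, g2)` of `s³ û₁`, where `W` is the value of
`s u₀` and `V` the value of its derivative. -/
noncomputable def residueTwo (s l B W V g g1 g2 : ℂ) : ℂ :=
    1/2 * W ^ 5 * l ^ 2 + 1/2 * W ^ 5 + W ^ 4 * V - W ^ 4 * l ^ 2 * B * s - 5/4 * W ^ 4 * l ^ 2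
    * s - 1/4 * W ^ 4 * s - W ^ 3 * V * s + 2 * W ^ 3 * l ^ 2 * B * s ^ 2 + W ^ 3 * l ^ 2 * s ^
    2 - W ^ 3 * s ^ 2 - W ^ 2 * l ^ 2 * B * s ^ 3 + 2 * W ^ 2 * l ^ 2 * g - 1/4 * W ^ 2 * l ^ 2
    * s ^ 3 + 8 * W ^ 2 * g + 8 * W ^ 2 * g1 + 2 * W ^ 2 * g2 + 3/4 * W ^ 2 * s ^ 3 - 8 * W * V
    * g - 4 * W * V * g1 - 8 * W * l ^ 2 * B * g * s - 4 * W * l ^ 2 * g * s - 8 * W * g * s - 8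
    * W * g1 * s - 2 * W * g2 * s + 4 * V * g * s + 2 * V * g1 * s + 4 * l ^ 2 * B * g * s ^ 2 +
    2 * l ^ 2 * g * s ^ 2

/-- The derivative of `residueTwo`. -/
noncomputable def residueThree (s l B W V g g1 g2 g3 : ℂ) : ℂ :=
    5 * W ^ 5 * l ^ 2 + 5/2 * W ^ 4 * V * l ^ 2 + 5/2 * W ^ 4 * V - 18 * W ^ 4 * l ^ 2 * B * s -
    13 * W ^ 4 * l ^ 2 * s - 4 * W ^ 3 * V * l ^ 2 * B * s - 5 * W ^ 3 * V * l ^ 2 * s - W ^ 3 *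
    V * s + 30 * W ^ 3 * l ^ 2 * B * s ^ 2 + 11 * W ^ 3 * l ^ 2 * s ^ 2 + 6 * W ^ 2 * V * l ^ 2
    * B * s ^ 2 + 3 * W ^ 2 * V * l ^ 2 * s ^ 2 - 3 * W ^ 2 * V * s ^ 2 - 12 * W ^ 2 * l ^ 2 * B
    * s ^ 3 - 16 * W ^ 2 * l ^ 2 * g - 6 * W ^ 2 * l ^ 2 * g1 - 3 * W ^ 2 * l ^ 2 * s ^ 3 + 8 *
    W ^ 2 * g1 + 8 * W ^ 2 * g2 + 2 * W ^ 2 * g3 - 2 * W * V * l ^ 2 * B * s ^ 3 + 4 * W * V * l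
    ^ 2 * g - 1/2 * W * V * l ^ 2 * s ^ 3 + 16 * W * V * g + 8 * W * V * g1 + 3/2 * W * V * s ^
    3 + 48 * W * l ^ 2 * B * g * s + 16 * W * l ^ 2 * B * g1 * s + 28 * W * l ^ 2 * g * s + 10 *
    W * l ^ 2 * g1 * s - 8 * W * g1 * s - 8 * W * g2 * s - 2 * W * g3 * s - 8 * V * l ^ 2 * B *
    g * s - 4 * V * l ^ 2 * g * s - 8 * V * g * s - 4 * V * g1 * s - 40 * l ^ 2 * B * g * s ^ 2
    - 16 * l ^ 2 * B * g1 * s ^ 2 - 12 * l ^ 2 * g * s ^ 2 - 4 * l ^ 2 * g1 * s ^ 2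

/-- The values at `s` of the coefficients of a formal solution up to order `3` and of their first
and second derivatives, in terms of the jet of the free function `g` in the coefficient of order `2`. -/
structure FormalJet (s l m n W V V2 V3 V4 V5 g g1 g2 g3 w1 w1' w1'' e2 e2' e2'' w2 w2' w2''
    w3 w3' w3'' : ℂ) : Prop where
  eq_W : W = s + 2 * m * n * s - m ^ 2 * s ^ 2 - n ^ 2
  eq_V : V = l * n ^ 2 - l * m ^ 2 * s ^ 2
  eq_V2 : V2 = -l ^ 2 * (m ^ 2 * s ^ 2 + n ^ 2)
  eq_V3 : V3 = l ^ 2 * V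
  eq_V4 : V4 = l ^ 2 * V2
  eq_V5 : V5 = l ^ 2 * V3
  eq_w1 : w1 = V * s / 2 - W * (W - s) / 2
  eq_w1' : w1' = (V2 + V) * s / 2 - (V * (W - s) + W * V + W * (W - s)) / 2
  eq_w1'' : w1'' = (V3 + V2 + V2 + V) * s / 2 - (V2 * (W - s) + V * V + V * (W - s) + V * V
    + W * V2 + W * V + V * (W - s) + W * V + W * (W - s)) / 2
  eq_e2 : e2 = s ^ 2 * (V / 4 + V2 / 8) + g
  eq_e2' : e2' = 2 * e2 + s ^ 2 * (V2 / 4 + V3 / 8) + g1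
  eq_e2'' : e2'' = 4 * e2 + 4 * (s ^ 2 * (V2 / 4 + V3 / 8) + g1) + s ^ 2 * (V3 / 4 + V4 / 8) + g2
  eq_w2 : w2 = e2 - w1 * (W - s) / 2 - W * (s / 2 * V) / 2
  eq_w2' : w2' = e2' - (w1' * (W - s) + w1 * V + w1 * (W - s)
    + V * (s / 2 * V) + W * (s / 2 * (V + V2)) + W * (s / 2 * V)) / 2
  eq_w2'' : w2'' = e2'' - (w1'' * (W - s) + w1' * V + w1' * (W - s) + w1' * V + w1 * V2 + w1 * V
    + w1' * (W - s) + w1 * V + w1 * (W - s) + V2 * (s / 2 * V) + V * (s / 2 * (V + V2))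
    + V * (s / 2 * V) + V * (s / 2 * (V + V2)) + W * (s / 2 * (V + 2 * V2 + V3))
    + W * (s / 2 * (V + V2)) + V * (s / 2 * V) + W * (s / 2 * (V + V2)) + W * (s / 2 * V)) / 2
  eq_w3 : w3 = s ^ 3 * (V / 6 + V2 / 8 + V3 / 48) + s * (g + g1 / 2) - w2 * (W - s) / 2
    - w1 * (s / 2 * V) / 2 - W * e2 / 2
  eq_w3' : w3' = 3 * (s ^ 3 * (V / 6 + V2 / 8 + V3 / 48) + s * (g + g1 / 2))
    + s ^ 3 * (V2 / 6 + V3 / 8 + V4 / 48) + s * (g1 + g2 / 2) - (w2' * (W - s) + w2 * V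
    + w2 * (W - s) + w1' * (s / 2 * V) + w1 * (s / 2 * (V + V2)) + w1 * (s / 2 * V)
    + V * e2 + W * e2' + W * e2) / 2
  eq_w3'' : w3'' = 9 * (s ^ 3 * (V / 6 + V2 / 8 + V3 / 48) + s * (g + g1 / 2))
    + 6 * (s ^ 3 * (V2 / 6 + V3 / 8 + V4 / 48) + s * (g1 + g2 / 2))
    + s ^ 3 * (V3 / 6 + V4 / 8 + V5 / 48) + s * (g2 + g3 / 2) - (w2'' * (W - s) + w2' * V
    + w2' * (W - s) + w2' * V + w2 * V2 + w2 * V + w2' * (W - s) + w2 * V + w2 * (W - s)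
    + w1'' * (s / 2 * V) + w1' * (s / 2 * (V + V2)) + w1' * (s / 2 * V)
    + w1' * (s / 2 * (V + V2)) + w1 * (s / 2 * (V + 2 * V2 + V3)) + w1 * (s / 2 * (V + V2))
    + w1' * (s / 2 * V) + w1 * (s / 2 * (V + V2)) + w1 * (s / 2 * V)
    + V2 * e2 + V * e2' + V * e2 + V * e2' + W * e2'' + W * e2' + V * e2 + W * e2' + W * e2) / 2

namespace FormalJet

variable {s l m n W V V2 V3 V4 V5 g g1 g2 g3 w1 w1' w1'' e2 e2' e2'' w2 w2' w2'' w3 w3' w3'' : ℂ}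
  {c c' c'' : ℕ → ℂ}

lemma coeff_zero (h : FormalJet s l m n W V V2 V3 V4 V5 g g1 g2 g3 w1 w1' w1'' e2 e2' e2''
    w2 w2' w2'' w3 w3' w3'') (h0 : c 0 = W) (h0' : c' 0 = V) (h0'' : c'' 0 = V2) :
    PowerSeries.coeff 0 (homODE PowerSeries.X (PowerSeries.C s)
      (PowerSeries.C (l ^ 2 * (4 * (m * n) + 1))) (PowerSeries.mk c) (PowerSeries.mk c')
      (PowerSeries.mk c'')) = 0 := by
  simp only [homODE, pow_two, map_add, map_sub, coeff_zero_mul_eq,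
    coeff_ofNat_two, PowerSeries.coeff_mk, PowerSeries.coeff_X,
    PowerSeries.coeff_C, PowerSeries.coeff_one]
  simp only [h0, h0', h0'',
    zero_ne_one, if_true, if_false, zero_mul,
    add_zero, one_mul, mul_one, mul_zero, sub_zero, zero_sub]
  rw [h.eq_V2, h.eq_V, h.eq_W]
  ring1

lemma coeff_one (h : FormalJet s l m n W V V2 V3 V4 V5 g g1 g2 g3 w1 w1' w1'' e2 e2' e2''
    w2 w2' w2'' w3 w3' w3'') (h0 : c 0 = W) (h0' : c' 0 = V) (h0'' : c'' 0 = V2) (h1 : c 1 = w1) (h1' : c' 1 = w1') (h1''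
    : c'' 1 = w1'') :
    PowerSeries.coeff 1 (homODE PowerSeries.X (PowerSeries.C s)
      (PowerSeries.C (l ^ 2 * (4 * (m * n) + 1))) (PowerSeries.mk c) (PowerSeries.mk c')
      (PowerSeries.mk c'')) = 0 := by
  simp only [homODE, pow_two, map_add, map_sub, coeff_one_mul_eq,
    coeff_zero_mul_eq, coeff_ofNat_two, PowerSeries.coeff_mk, PowerSeries.coeff_X,
    PowerSeries.coeff_C, PowerSeries.coeff_one]
  simp only [h0, h0', h0'', h1, h1', h1'',
    zero_ne_one, one_ne_zero, if_true, if_false, zero_mul,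
    add_zero, zero_add, one_mul, mul_one, mul_zero, sub_zero, zero_sub]
  rw [h.eq_w1'', h.eq_w1', h.eq_w1, h.eq_V3, h.eq_V2, h.eq_V, h.eq_W]
  ring1

-- The form of the jet comes from u = E/(1 - x/2 + xE/2), where s E = ∑ ξ^i e_i, and from E = u₀(t)
-- + t² û₁(t) + ⋯ with ln t = ln x + x/2 + x²/4 + x³/6 + ⋯. This produces the weights 1/2, then 1/4
-- and 1/8, then 1/6, 1/8 and 1/48. At order 2 there remains a linear inhomogeneous equation for g =
-- s³ û₁.
set_option maxHeartbeats 1000000 in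
lemma coeff_two (h : FormalJet s l m n W V V2 V3 V4 V5 g g1 g2 g3 w1 w1' w1'' e2 e2' e2''
    w2 w2' w2'' w3 w3' w3'') (h0 : c 0 = W) (h0' : c' 0 = V) (h0'' : c'' 0 = V2) (h1 : c 1 = w1) (h1' : c' 1 = w1') (h1''
    : c'' 1 = w1'') (h2 : c 2 = w2) (h2' : c' 2 = w2') (h2'' : c'' 2 = w2'') :
    PowerSeries.coeff 2 (homODE PowerSeries.X (PowerSeries.C s)
      (PowerSeries.C (l ^ 2 * (4 * (m * n) + 1))) (PowerSeries.mk c) (PowerSeries.mk c')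
      (PowerSeries.mk c'')) = residueTwo s l (m * n) W V g g1 g2 := by
  simp only [homODE, pow_two, map_add, map_sub, coeff_two_mul, coeff_one_mul_eq,
    coeff_zero_mul_eq, coeff_ofNat_two, PowerSeries.coeff_mk, PowerSeries.coeff_X,
    PowerSeries.coeff_C, PowerSeries.coeff_one]
  simp only [h0, h0', h0'', h1, h1', h1'', h2, h2', h2'',
    zero_ne_one, one_ne_zero, if_true, if_false, OfNat.ofNat_ne_zero, OfNat.ofNat_ne_one, zero_mul,
    add_zero, zero_add, one_mul, mul_one, mul_zero, sub_zero, zero_sub]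
  rw [residueTwo, h.eq_w2'', h.eq_w2', h.eq_w2, h.eq_e2'', h.eq_e2', h.eq_e2, h.eq_w1'', h.eq_w1',
    h.eq_w1, h.eq_V4, h.eq_V3, h.eq_V2, h.eq_V, h.eq_W]
  ring1

-- Evenness in t leaves no new unknown at order 3: the condition is a combination of the condition
-- of order 2 and its derivative.
set_option maxRecDepth 20000 in
set_option maxHeartbeats 4000000 in
lemma coeff_three (h : FormalJet s l m n W V V2 V3 V4 V5 g g1 g2 g3 w1 w1' w1'' e2 e2' e2''
    w2 w2' w2'' w3 w3' w3'') (h0 : c 0 = W) (h0' : c' 0 = V) (h0'' : c'' 0 = V2) (h1 : c 1 = w1) (h1' : c' 1 = w1') (h1''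
    : c'' 1 = w1'') (h2 : c 2 = w2) (h2' : c' 2 = w2') (h2'' : c'' 2 = w2'') (h3 : c 3 = w3)
    (h3' : c' 3 = w3') (h3'' : c'' 3 = w3'') :
    PowerSeries.coeff 3 (homODE PowerSeries.X (PowerSeries.C s)
      (PowerSeries.C (l ^ 2 * (4 * (m * n) + 1))) (PowerSeries.mk c) (PowerSeries.mk c')
      (PowerSeries.mk c'')) =
      s / 2 * residueThree s l (m * n) W V g g1 g2 g3
        + (s - 3 * W) * residueTwo s l (m * n) W V g g1 g2 := by
  simp only [homODE, pow_two, map_add, map_sub, coeff_three_mul, coeff_two_mul, coeff_one_mul_eq,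
    coeff_zero_mul_eq, coeff_ofNat_two, PowerSeries.coeff_mk, PowerSeries.coeff_X,
    PowerSeries.coeff_C, PowerSeries.coeff_one]
  simp only [h0, h0', h0'', h1, h1', h1'', h2, h2', h2'', h3, h3', h3'',
    zero_ne_one, one_ne_zero, if_true, if_false, OfNat.ofNat_ne_zero, OfNat.ofNat_ne_one, zero_mul,
    add_zero, zero_add, one_mul, mul_one, mul_zero, sub_zero, zero_sub]
  rw [residueTwo, residueThree, h.eq_w3'', h.eq_w3', h.eq_w3, h.eq_w2'', h.eq_w2', h.eq_w2, h.eq_e2'',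
    h.eq_e2', h.eq_e2, h.eq_w1'', h.eq_w1', h.eq_w1, h.eq_V5, h.eq_V4, h.eq_V3, h.eq_V2, h.eq_V, h.eq_W]
  ring1

end FormalJet

end Jets

end Explicit

/-! ### The free function of order 2. -/

section Correction

open Polynomial

variable (l m n : ℂ)

/-- The numerators of the coefficients of the free function in the coefficient of order `2` of the
formal solution. -/
noncomputable def correctionNum : ℕ → ℂ
  | 0 => n ^ 6 * (1 - l ^ 2 / 2 + l ^ 4 / 16)
  | 1 => n ^ 4 * (-7 / 2 + 13 / 8 * l ^ 2 - l ^ 3 / 8 - l ^ 4 / 4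
      + m * n * (-6 + 5 / 2 * l ^ 2 - l ^ 3 / 2 - l ^ 4 / 2))
  | 2 => n ^ 2 * (5 / 2 - 3 / 4 * l - 9 / 8 * l ^ 2 + 7 / 16 * l ^ 3 + l ^ 4 / 8 - l ^ 5 / 16
      + m * n * (14 - 6 * l ^ 2 + l ^ 3 / 2 + 5 / 8 * l ^ 4 - l ^ 5 / 8)
      + (m * n) ^ 2 * (15 - 11 / 2 * l ^ 2 + l ^ 3 + 7 / 16 * l ^ 4 - l ^ 5 / 4))
  | 3 => m * n * (-5 + 9 / 4 * l ^ 2 - l ^ 4 / 4 + m * n * (-21 + 35 / 4 * l ^ 2 - 3 / 4 * l ^ 4)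
      + (m * n) ^ 2 * (-20 + 7 * l ^ 2))
  | 4 => m ^ 2 * (5 / 2 + 3 / 4 * l - 9 / 8 * l ^ 2 - 7 / 16 * l ^ 3 + l ^ 4 / 8 + l ^ 5 / 16
      + m * n * (14 - 6 * l ^ 2 - l ^ 3 / 2 + 5 / 8 * l ^ 4 + l ^ 5 / 8)
      + (m * n) ^ 2 * (15 - 11 / 2 * l ^ 2 - l ^ 3 + 7 / 16 * l ^ 4 + l ^ 5 / 4))
  | 5 => m ^ 4 * (-7 / 2 + 13 / 8 * l ^ 2 + l ^ 3 / 8 - l ^ 4 / 4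
      + m * n * (-6 + 5 / 2 * l ^ 2 + l ^ 3 / 2 - l ^ 4 / 2))
  | 6 => m ^ 6 * (1 - l ^ 2 / 2 + l ^ 4 / 16)
  | _ => 0

/-- The value at `s` of the `k`-th derivative of the free function. -/
noncomputable def correctionJet (k : ℕ) (s : ℂ) : ℂ :=
  ∑ j ∈ Finset.range 7, (((j : ℂ) - 3) * l) ^ k * (correctionNum l m n j / (4 - l ^ 2) ^ 2) * s ^ j

variable {l}

lemma mul_correctionJet (hl : 4 - l ^ 2 ≠ 0) (k : ℕ) (s : ℂ) :
    (4 - l ^ 2) ^ 2 * correctionJet l m n k s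
      = ∑ j ∈ Finset.range 7, (((j : ℂ) - 3) * l) ^ k * correctionNum l m n j * s ^ j := by
  rw [correctionJet, Finset.mul_sum]
  refine Finset.sum_congr rfl fun j _ => ?_
  field_simp

set_option maxHeartbeats 1000000 in
lemma residueTwo_eq_zero (hl : 4 - l ^ 2 ≠ 0) {s W V : ℂ}
    (hW : W = s + 2 * m * n * s - m ^ 2 * s ^ 2 - n ^ 2) (hV : V = l * n ^ 2 - l * m ^ 2 * s ^ 2) :
    residueTwo s l (m * n) W V (correctionJet l m n 0 s) (correctionJet l m n 1 s)
      (correctionJet l m n 2 s) = 0 := by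
  have h0 := mul_correctionJet m n hl 0 s
  have h1 := mul_correctionJet m n hl 1 s
  have h2 := mul_correctionJet m n hl 2 s
  have ht : (4 - l ^ 2) ^ 2 ≠ 0 := pow_ne_zero 2 hl
  generalize correctionJet l m n 0 s = g at *
  generalize correctionJet l m n 1 s = g1 at *
  generalize correctionJet l m n 2 s = g2 at *
  -- The residue is affine in the jet of g, so clearing the denominator (4 - l²)² rescales the
  -- linear part and corrects the inhomogeneous part. What remains is a polynomial identity.
  have key : (4 - l ^ 2) ^ 2 * residueTwo s l (m * n) W V g g1 g2
      = residueTwo s l (m * n) W V ((4 - l ^ 2) ^ 2 * g) ((4 - l ^ 2) ^ 2 * g1)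
        ((4 - l ^ 2) ^ 2 * g2)
        + ((4 - l ^ 2) ^ 2 - 1) * residueTwo s l (m * n) W V 0 0 0 := by
    unfold residueTwo
    ring1
  refine (mul_eq_zero.1 (key.trans ?_)).resolve_left ht
  rw [h0, h1, h2, hW, hV]
  simp only [Finset.sum_range_succ, Finset.sum_range_zero, correctionNum, residueTwo]
  push_cast
  ring1

set_option maxHeartbeats 1000000 in
lemma residueThree_eq_zero (hl : 4 - l ^ 2 ≠ 0) {s W V : ℂ}
    (hW : W = s + 2 * m * n * s - m ^ 2 * s ^ 2 - n ^ 2) (hV : V = l * n ^ 2 - l * m ^ 2 * s ^ 2) :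
    residueThree s l (m * n) W V (correctionJet l m n 0 s) (correctionJet l m n 1 s)
      (correctionJet l m n 2 s) (correctionJet l m n 3 s) = 0 := by
  have h0 := mul_correctionJet m n hl 0 s
  have h1 := mul_correctionJet m n hl 1 s
  have h2 := mul_correctionJet m n hl 2 s
  have h3 := mul_correctionJet m n hl 3 s
  have ht : (4 - l ^ 2) ^ 2 ≠ 0 := pow_ne_zero 2 hl
  generalize correctionJet l m n 0 s = g at *
  generalize correctionJet l m n 1 s = g1 at *
  generalize correctionJet l m n 2 s = g2 at *
  generalize correctionJet l m n 3 s = g3 at *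
  have key : (4 - l ^ 2) ^ 2 * residueThree s l (m * n) W V g g1 g2 g3
      = residueThree s l (m * n) W V ((4 - l ^ 2) ^ 2 * g) ((4 - l ^ 2) ^ 2 * g1)
        ((4 - l ^ 2) ^ 2 * g2) ((4 - l ^ 2) ^ 2 * g3)
        + ((4 - l ^ 2) ^ 2 - 1) * residueThree s l (m * n) W V 0 0 0 0 := by
    unfold residueThree
    ring1
  refine (mul_eq_zero.1 (key.trans ?_)).resolve_left ht
  rw [h0, h1, h2, h3, hW, hV]
  simp only [Finset.sum_range_succ, Finset.sum_range_zero, correctionNum, residueThree]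
  push_cast
  ring1

end Correction

/-! ### The explicit polynomials of orders 0 to 3. -/

section ExplicitSolution

open Polynomial

variable (l m n : ℂ)

/-- The free function in the coefficient of order `2` of the formal solution. -/
noncomputable def correction : ℂ[X] :=
  ofCoeffs 7 fun j => correctionNum l m n j / (4 - l ^ 2) ^ 2

/-- The leading coefficient of the formal solution. -/
noncomputable def explicitLead : ℂ[X] := C (-n ^ 2) + C (1 + 2 * m * n) * X - C (m ^ 2) * X ^ 2

/-- The logarithmic derivative of the leading coefficient. -/
noncomputable def explicitLeadDeriv : ℂ[X] := C (l * n ^ 2) - C (l * m ^ 2) * X ^ 2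

/-- The second logarithmic derivative of the leading coefficient. -/
noncomputable def explicitLeadDeriv2 : ℂ[X] := C (-l ^ 2 * n ^ 2) - C (l ^ 2 * m ^ 2) * X ^ 2

/-- The coefficient of order `1` of the formal solution. -/
noncomputable def explicitOne : ℂ[X] := (1 / 2 : ℂ) • (explicitLeadDeriv l m n * X)
  - (1 / 2 : ℂ) • (explicitLead m n * (explicitLead m n - X))

/-- The part of the coefficient of order `2` that does not come from the lower orders. -/
noncomputable def explicitTwoMain : ℂ[X] := ((1 / 4 : ℂ) • explicitLeadDeriv l m n
  + (1 / 8 : ℂ) • explicitLeadDeriv2 l m n) * X * X + correction l m n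

/-- The coefficient of order `2` of the formal solution. -/
noncomputable def explicitTwo : ℂ[X] := explicitTwoMain l m n
  - (1 / 2 : ℂ) • (explicitOne l m n * (explicitLead m n - X))
  - (1 / 4 : ℂ) • (explicitLeadDeriv l m n * explicitLead m n * X)

/-- The coefficient of order `3` of the formal solution. -/
noncomputable def explicitThree : ℂ[X] := ((1 / 6 + l ^ 2 / 48 : ℂ) • explicitLeadDeriv l m n
    + (1 / 8 : ℂ) • explicitLeadDeriv2 l m n) * X * X * X
  + (1 / 2 : ℂ) • (twist l 2 (correction l m n) * X)
  - (1 / 2 : ℂ) • (explicitTwo l m n * (explicitLead m n - X))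
  - (1 / 4 : ℂ) • (explicitOne l m n * explicitLeadDeriv l m n * X)
  - (1 / 2 : ℂ) • (explicitTwoMain l m n * explicitLead m n)

lemma twist_explicitLead : twist l 0 (explicitLead m n) = explicitLeadDeriv l m n := by
  simp only [twist, explicitLead, explicitLeadDeriv, derivative_add, derivative_sub, derivative_mul,
    derivative_C, derivative_X, derivative_X_sq]
  simp only [map_mul, map_add, map_sub, map_neg, map_pow, map_one, map_zero, Nat.cast_zero,
    map_ofNat]
  ring

lemma twist_explicitLeadDeriv :
    twist l 0 (explicitLeadDeriv l m n) = explicitLeadDeriv2 l m n := by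
  simp only [twist, explicitLeadDeriv, explicitLeadDeriv2, derivative_sub, derivative_mul,
    derivative_C, derivative_X_sq]
  simp only [map_mul, map_sub, map_add, map_neg, map_pow, map_one, map_zero, Nat.cast_zero,
    map_ofNat]
  ring

lemma twist_explicitLeadDeriv2 :
    twist l 0 (explicitLeadDeriv2 l m n) = l ^ 2 • explicitLeadDeriv l m n := by
  simp only [twist, explicitLeadDeriv, explicitLeadDeriv2, derivative_sub, derivative_mul,
    derivative_C, derivative_X_sq, smul_eq_C_mul]
  simp only [map_mul, map_sub, map_add, map_neg, map_pow, map_one, map_zero, Nat.cast_zero,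
    map_ofNat]
  ring

lemma eval_correction (s : ℂ) : (correction l m n).eval s = correctionJet l m n 0 s := by
  simp only [correction, eval_ofCoeffs, correctionJet, pow_zero, one_mul]

lemma eval_twist_correction (s : ℂ) : (twist l 2 (correction l m n)).eval s
    = 2 * correctionJet l m n 0 s + correctionJet l m n 1 s := by
  simp only [correction, twist_ofCoeffs, eval_ofCoeffs, correctionJet, Finset.mul_sum,
    ← Finset.sum_add_distrib]
  refine Finset.sum_congr rfl fun j _ => ?_
  push_cast
  ring

lemma eval_twist_twist_correction (s : ℂ) : (twist l 2 (twist l 2 (correction l m n))).eval s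
    = 4 * correctionJet l m n 0 s + 4 * correctionJet l m n 1 s + correctionJet l m n 2 s := by
  simp only [correction, twist_ofCoeffs, eval_ofCoeffs, correctionJet, Finset.mul_sum,
    ← Finset.sum_add_distrib]
  refine Finset.sum_congr rfl fun j _ => ?_
  push_cast
  ring

lemma eval_twist_twist_twist_correction (s : ℂ) :
    (twist l 2 (twist l 2 (twist l 2 (correction l m n)))).eval s
      = 8 * correctionJet l m n 0 s + 12 * correctionJet l m n 1 s + 6 * correctionJet l m n 2 s
        + correctionJet l m n 3 s := by
  simp only [correction, twist_ofCoeffs, eval_ofCoeffs, correctionJet, Finset.mul_sum,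
    ← Finset.sum_add_distrib]
  refine Finset.sum_congr rfl fun j _ => ?_
  push_cast
  ring

lemma formalJet_explicit (s : ℂ) : FormalJet s l m n ((explicitLead m n).eval s)
    ((explicitLeadDeriv l m n).eval s) ((explicitLeadDeriv2 l m n).eval s)
    (l ^ 2 * (explicitLeadDeriv l m n).eval s) (l ^ 2 * (explicitLeadDeriv2 l m n).eval s)
    (l ^ 2 * (l ^ 2 * (explicitLeadDeriv l m n).eval s))
    (correctionJet l m n 0 s) (correctionJet l m n 1 s) (correctionJet l m n 2 s)
    (correctionJet l m n 3 s)
    ((explicitOne l m n).eval s) ((twist l 1 (explicitOne l m n)).eval s)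
    ((twist l 1 (twist l 1 (explicitOne l m n))).eval s)
    ((explicitTwoMain l m n).eval s) ((twist l 2 (explicitTwoMain l m n)).eval s)
    ((twist l 2 (twist l 2 (explicitTwoMain l m n))).eval s)
    ((explicitTwo l m n).eval s) ((twist l 2 (explicitTwo l m n)).eval s)
    ((twist l 2 (twist l 2 (explicitTwo l m n))).eval s)
    ((explicitThree l m n).eval s) ((twist l 3 (explicitThree l m n)).eval s)
    ((twist l 3 (twist l 3 (explicitThree l m n))).eval s) := by
  have t2 : ∀ p q : ℂ[X], twist l 2 (p * q) = twist l 1 p * q + p * twist l 0 q + p * q :=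
    twist_succ_mul l 1
  have t3 : ∀ p q : ℂ[X], twist l 3 (p * q) = twist l 2 p * q + p * twist l 0 q + p * q :=
    twist_succ_mul l 2
  have t1 : ∀ p q : ℂ[X], twist l 1 (p * q) = twist l 0 p * q + p * twist l 0 q + p * q :=
    twist_succ_mul l 0
  constructor
  · simp [explicitLead]
    ring
  · simp [explicitLeadDeriv]
  · simp [explicitLeadDeriv2]
    ring
  · rfl
  · rfl
  · rfl
  all_goals
    first
    | simp only [explicitOne, explicitTwoMain, t1, t2, twist_add, twist_sub, twist_smul,
        twist_explicitLead, twist_explicitLeadDeriv, twist_explicitLeadDeriv2, twist_zero_X,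
        eval_add, eval_sub, eval_smul, eval_mul, eval_X, smul_eq_mul, mul_zero, add_zero, sub_zero,
        eval_correction, eval_twist_correction, eval_twist_twist_correction]; ring1
    | simp only [explicitTwo, t1, t2, twist_add, twist_sub, twist_smul, twist_explicitLead,
        twist_explicitLeadDeriv, twist_explicitLeadDeriv2, twist_zero_X, eval_add, eval_sub,
        eval_smul, eval_mul, eval_X, smul_eq_mul, mul_zero, add_zero, sub_zero]; ring1
    | simp only [explicitThree, t1, t2, t3, twist_add, twist_sub, twist_smul, twist_explicitLead,
        twist_explicitLeadDeriv, twist_explicitLeadDeriv2, twist_zero_X, eval_add, eval_sub,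
        eval_smul, eval_mul, eval_X, smul_eq_mul, mul_zero, add_zero, sub_zero,
        eval_twist_correction, eval_twist_twist_correction, eval_twist_twist_twist_correction]
      ring1

end ExplicitSolution

/-! ### Identification with the actual formal solution. -/

section ExplicitSolution

open Polynomial

/-- The formal solution up to order `3`. -/
noncomputable def explicitSolution (l m n : ℂ) : ℕ → ℂ[X]
  | 0 => explicitLead m n
  | 1 => explicitOne l m n
  | 2 => explicitTwo l m n
  | 3 => explicitThree l m n
  | _ => 0

/-- Polynomials over ℂ are compared through their values at every s, which reduces the equation to
the scalar identities between jets. -/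
lemma coeff_formalODE_explicitSolution {a l m n : ℂ} (hl : 4 - l ^ 2 ≠ 0)
    (ha : a ^ 2 = l ^ 2 * (4 * (m * n) + 1)) :
    ∀ i < 4, PowerSeries.coeff i (formalODE a l (explicitSolution l m n)) = 0 := by
  intro i hi
  refine Polynomial.funext fun s => ?_
  rw [eval_coeff_formalODE, ha, eval_zero]
  have hJ := formalJet_explicit l m n s
  have e0 := twist_explicitLead l m n
  have e1 := twist_explicitLeadDeriv l m n
  have r2 := residueTwo_eq_zero m n hl hJ.eq_W hJ.eq_V
  have r3 := residueThree_eq_zero m n hl hJ.eq_W hJ.eq_V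
  have h0' : (twist l 0 (explicitSolution l m n 0)).eval s = (explicitLeadDeriv l m n).eval s := by
    rw [explicitSolution, e0]
  have h0'' : (twist l 0 (twist l 0 (explicitSolution l m n 0))).eval s
      = (explicitLeadDeriv2 l m n).eval s := by
    rw [explicitSolution, e0, e1]
  interval_cases i
  · exact hJ.coeff_zero rfl h0' h0''
  · exact hJ.coeff_one rfl h0' h0'' rfl rfl rfl
  · rw [hJ.coeff_two rfl h0' h0'' rfl rfl rfl rfl rfl rfl, r2]
  · rw [hJ.coeff_three rfl h0' h0'' rfl rfl rfl rfl rfl rfl rfl rfl rfl, r2, r3]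
    ring

/-- The parameter m is (a - l)/(2l), and n = m + 1 is (a + l)/(2l). Then w_0 has outer coefficients
-n² and -m² and a²/l² = 4mn + 1, which removes the denominators in l. Uniqueness of formal solutions
up to order 3 does the rest. -/
lemma FormalSolution.w_eq (x : FormalSolution) {m : ℂ}
    (hm : 2 * x.μ - 1 = 2 * Complex.I * x.ν * (2 * m + 1)) :
    ∀ i < 4, x.w i = explicitSolution (2 * Complex.I * x.ν) m (m + 1) i := by
  have hl := l_ne_zero x.admissible.1
  have hI : (2 * Complex.I * (x.ν : ℂ)) ^ 2 = -(4 * x.ν ^ 2) := by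
    rw [mul_pow, mul_pow, Complex.I_sq]
    ring
  have hl4 : 4 - (2 * Complex.I * (x.ν : ℂ)) ^ 2 ≠ 0 := by
    rw [hI]
    have : (0 : ℝ) < 4 + 4 * x.ν ^ 2 := by positivity
    have h : ((4 + 4 * x.ν ^ 2 : ℝ) : ℂ) ≠ 0 := by exact_mod_cast this.ne'
    push_cast at h
    rwa [sub_neg_eq_add]
  have hne := x.admissible.add_ne_zero
  rw [hm] at hne
  have h0 : x.w 0 = explicitSolution (2 * Complex.I * x.ν) m (m + 1) 0 := by
    rw [w_zero, hm, explicitSolution, explicitLead, quadPoly]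
    set l := 2 * Complex.I * (x.ν : ℂ)
    have c0 : -(l * (2 * m + 1) + l) ^ 2 / (4 * l ^ 2) = -(m + 1) ^ 2 := by
      field_simp
      ring
    have c1 : ((l * (2 * m + 1)) ^ 2 + l ^ 2) / (2 * l ^ 2) = 1 + 2 * m * (m + 1) := by
      field_simp
      ring
    have c2 : -(l * (2 * m + 1) - l) ^ 2 / (4 * l ^ 2) = -m ^ 2 := by
      field_simp
      ring
    rw [c0, c1, c2, map_neg C (m ^ 2)]
    ring
  refine formalODE_unique (a := 2 * x.μ - 1) (l := 2 * Complex.I * x.ν) (n := 4) ?_ ?_ h0 ?_ ?_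
  · rw [h0, explicitSolution, explicitLead]
    simp only [coeff_add, coeff_sub, coeff_C_zero, coeff_C_mul, coeff_X_zero, coeff_X_pow]
    intro h
    apply hne
    have : (m + 1) ^ 2 = 0 := by simpa using h
    have := pow_eq_zero_iff two_ne_zero |>.1 this
    linear_combination (2 * (2 * Complex.I * (x.ν : ℂ))) * this
  · exact fun i j hi => resonance_ne_zero hi j x.ν
  · intro i _
    rw [x.formalODE_eq_zero, map_zero]
  · refine coeff_formalODE_explicitSolution hl4 ?_
    rw [hm]
    ring

end ExplicitSolution

/-! ### The implicit equation up to order 3. -/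

section ImplicitCoefficients

open Polynomial

section

variable {l m W V V2 V3 V4 V5 g g1 g2 g3 w1 w1' w1'' e2 e2' e2'' w2 w2' w2'' w3 w3' w3'' f1 K : ℂ}

/-- The point s = 1 is ω = 0, where the leading term vanishes. With W = 0 most products in the jet
disappear. -/
lemma FormalJet.at_one (h : FormalJet 1 l m (m + 1) W V V2 V3 V4 V5 g g1 g2 g3 w1 w1' w1'' e2 e2' e2'' w2 w2'
      w2'' w3 w3' w3'') :
    W = 0 ∧ V = l * (2 * m + 1) ∧ V2 = -l ^ 2 * (m ^ 2 + (m + 1) ^ 2) := by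
  refine ⟨?_, ?_, ?_⟩
  · rw [h.eq_W]
    ring1
  · rw [h.eq_V]
    ring1
  · rw [h.eq_V2]
    ring1

/-- The first order part of the implicit equation. -/
lemma FormalJet.implicit_one (h : FormalJet 1 l m (m + 1) W V V2 V3 V4 V5 g g1 g2 g3 w1 w1' w1'' e2 e2' e2'' w2 w2'
      w2'' w3 w3' w3'') :
    l * w1 - w1' + V + (l * V - V2) * (-1 / 2) = 0 := by
  obtain ⟨hW, hV, hV2⟩ := h.at_one
  rw [h.eq_w1', h.eq_w1, hW, hV, hV2]
  ring1

/-- The second order part of the implicit equation. -/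
lemma FormalJet.implicit_two (h : FormalJet 1 l m (m + 1) W V V2 V3 V4 V5 g g1 g2 g3 w1 w1' w1'' e2 e2' e2'' w2 w2'
      w2'' w3 w3' w3'')
    (hl : 4 - l ^ 2 ≠ 0)
    (h0 : (4 - l ^ 2) ^ 2 * g = ∑ j ∈ Finset.range 7, correctionNum l m (m + 1) j)
    (h1 : (4 - l ^ 2) ^ 2 * g1
      = ∑ j ∈ Finset.range 7, ((j : ℂ) - 3) * l * correctionNum l m (m + 1) j)
    (hK : 64 * (4 - l ^ 2) ^ 2 * K = (l * (2 * m + 1)) ^ 2 * (l * (2 * m + 1) + 2) ^ 2) :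
    l * w2 - w2' + w1' + (l * w1' - w1'' + (V2 + V)) * (-1 / 2)
      + (l * V2 - V3) / 2 * (-1 / 2) ^ 2 + (l * V - V2) * (3 / 64 + K) = 0 := by
  obtain ⟨hW, hV, hV2⟩ := h.at_one
  rw [h.eq_w2', h.eq_w2, h.eq_e2', h.eq_e2, h.eq_w1'', h.eq_w1', h.eq_w1, h.eq_V3, hW, hV, hV2]
  refine (mul_eq_zero.1 ?_).resolve_left (pow_ne_zero 2 hl)
  simp only [Finset.sum_range_succ, Finset.sum_range_zero, correctionNum] at h0 h1
  push_cast at h0 h1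
  linear_combination (l - 2) * h0 - h1
    + (l * (l * (2 * m + 1)) + l ^ 2 * (m ^ 2 + (m + 1) ^ 2)) / 64 * hK

/-- The third order part of the implicit equation. -/
lemma FormalJet.implicit_three (h : FormalJet 1 l m (m + 1) W V V2 V3 V4 V5 g g1 g2 g3 w1 w1' w1'' e2 e2' e2'' w2 w2'
      w2'' w3 w3' w3'')
    (hl : 4 - l ^ 2 ≠ 0)
    (h0 : (4 - l ^ 2) ^ 2 * g = ∑ j ∈ Finset.range 7, correctionNum l m (m + 1) j)
    (hK : 64 * (4 - l ^ 2) ^ 2 * K = (l * (2 * m + 1)) ^ 2 * (l * (2 * m + 1) + 2) ^ 2)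
    (hf : f1 = (V4 + 3 * V3 + 3 * V2 + V) / 2
      - (6 * V * V2 + 6 * V ^ 2 - V3 - 3 * V2 - 3 * V) / 2) :
    l * w3 - w3' + w2' + (l * w2' - w2'' + (w1'' + w1')) * (-1 / 2)
      + (l * w1'' - f1 + (V3 + 2 * V2 + V)) / 2 * (-1 / 2) ^ 2
      + (l * V3 - V4) / 6 * (-1 / 2) ^ 3 + (l * w1' - w1'' + (V2 + V)) * (3 / 64 + K)
      + 2 * ((l * V2 - V3) / 2) * (-1 / 2) * (3 / 64 + K)
      + (l * V - V2) * (-1 / 384 - K / 2) = 0 := by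
  obtain ⟨hW, hV, hV2⟩ := h.at_one
  rw [h.eq_w3', h.eq_w3, h.eq_w2'', h.eq_w2', h.eq_w2, h.eq_e2'', h.eq_e2', h.eq_e2, hf, h.eq_w1'',
    h.eq_w1', h.eq_w1, h.eq_V4, h.eq_V3, hW, hV, hV2]
  refine (mul_eq_zero.1 ?_).resolve_left (pow_ne_zero 2 hl)
  simp only [Finset.sum_range_succ, Finset.sum_range_zero, correctionNum] at h0
  linear_combination (l / 2 - 1 / 2 + l * (2 * m + 1)) * (h0 + l * (2 * m + 1) / 64 * hK)

end

/-- The first coefficients of the implicit equation, in terms of the derivatives of the coefficients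
of the formal solution. -/
lemma serCoeff_zeroPoly (a l : ℂ) (w : ℕ → ℂ[X]) {D : ℕ → ℕ → ℂ}
    (hD : ∀ i j, D i j = ((twist l i)^[j] (w i)).eval 1) :
    serCoeff l (zeroPoly a l w) 0 0 = l * D 0 0 - D 0 1 + a ∧
    serCoeff l (zeroPoly a l w) 0 1 = l * D 0 1 - D 0 2 ∧
    serCoeff l (zeroPoly a l w) 0 2 = (l * D 0 2 - D 0 3) / 2 ∧
    serCoeff l (zeroPoly a l w) 0 3 = (l * D 0 3 - D 0 4) / 6 ∧
    serCoeff l (zeroPoly a l w) 1 0 = l * D 1 0 - D 1 1 + D 0 1 ∧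
    serCoeff l (zeroPoly a l w) 1 1 = l * D 1 1 - D 1 2 + (D 0 2 + D 0 1) ∧
    serCoeff l (zeroPoly a l w) 1 2 = (l * D 1 2 - D 1 3 + (D 0 3 + 2 * D 0 2 + D 0 1)) / 2 ∧
    serCoeff l (zeroPoly a l w) 2 0 = l * D 2 0 - D 2 1 + D 1 1 ∧
    serCoeff l (zeroPoly a l w) 2 1 = l * D 2 1 - D 2 2 + (D 1 2 + D 1 1) ∧
    serCoeff l (zeroPoly a l w) 3 0 = l * D 3 0 - D 3 1 + D 2 1 := by
  have tX : ∀ (k : ℕ) (p : ℂ[X]), twist l (k + 1) (X * p) = X * (twist l k p + p) := fun k p => by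
    rw [mul_comm X p, twist_succ_mul, twist_zero_X]
    ring
  have tC : ∀ (i : ℕ) (c : ℂ) (p : ℂ[X]), twist l i (C c * p) = C c * twist l i p := fun i c p => by
    rw [← smul_eq_C_mul, twist_smul, smul_eq_C_mul]
  have t1 := tX 0
  have t2 := tX 1
  norm_num at t1 t2
  refine ⟨?_, ?_, ?_, ?_, ?_, ?_, ?_, ?_, ?_, ?_⟩ <;>
  · simp only [serCoeff, zeroPoly, hD, Function.iterate_succ_apply', Function.iterate_zero_apply,
      if_true, one_ne_zero, OfNat.ofNat_ne_zero, if_false, twist_add, twist_sub, tC, t1, t2,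
      twist_zero_X, eval_add, eval_sub, eval_mul, eval_C, eval_X, mul_zero, add_zero,
      Nat.factorial, Nat.reduceSub]
    push_cast
    ring1

/-- The solution of the implicit equation up to order `3`. -/
lemma implicit_equations {l m K : ℂ} (hl : 4 - l ^ 2 ≠ 0) (v : ℕ → ℕ → ℂ)
    (hv : ∀ i < 4, ∀ j, v i j = serCoeff l (zeroPoly (l * (2 * m + 1)) l
      (explicitSolution l m (m + 1))) i j)
    (hK : 64 * (4 - l ^ 2) ^ 2 * K = (l * (2 * m + 1)) ^ 2 * (l * (2 * m + 1) + 2) ^ 2) :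
    v 1 0 + v 0 1 * (-1 / 2) = 0 ∧
    v 2 0 + v 1 1 * (-1 / 2) + v 0 2 * (-1 / 2) ^ 2 + v 0 1 * (3 / 64 + K) = 0 ∧
    v 3 0 + v 2 1 * (-1 / 2) + v 1 2 * (-1 / 2) ^ 2 + v 0 3 * (-1 / 2) ^ 3
      + v 1 1 * (3 / 64 + K) + 2 * v 0 2 * (-1 / 2) * (3 / 64 + K)
      + v 0 1 * (-1 / 384 - K / 2) = 0 := by
  have hJ := formalJet_explicit l m (m + 1) 1
  have h0 : (4 - l ^ 2) ^ 2 * correctionJet l m (m + 1) 0 1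
      = ∑ j ∈ Finset.range 7, correctionNum l m (m + 1) j := by
    simpa using mul_correctionJet m (m + 1) hl 0 1
  have h1 : (4 - l ^ 2) ^ 2 * correctionJet l m (m + 1) 1 1
      = ∑ j ∈ Finset.range 7, ((j : ℂ) - 3) * l * correctionNum l m (m + 1) j := by
    simpa using mul_correctionJet m (m + 1) hl 1 1
  obtain ⟨D, hD⟩ : ∃ D : ℕ → ℕ → ℂ, ∀ i j, D i j
      = ((twist l i)^[j] (explicitSolution l m (m + 1) i)).eval 1 := ⟨_, fun _ _ => rfl⟩
  have d01 : D 0 1 = (explicitLeadDeriv l m (m + 1)).eval 1 := by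
    simp only [hD, Function.iterate_succ_apply', Function.iterate_zero_apply, explicitSolution,
      twist_explicitLead]
  have d02 : D 0 2 = (explicitLeadDeriv2 l m (m + 1)).eval 1 := by
    simp only [hD, Function.iterate_succ_apply', Function.iterate_zero_apply, explicitSolution,
      twist_explicitLead, twist_explicitLeadDeriv]
  have d03 : D 0 3 = l ^ 2 * (explicitLeadDeriv l m (m + 1)).eval 1 := by
    simp only [hD, Function.iterate_succ_apply', Function.iterate_zero_apply, explicitSolution,
      twist_explicitLead, twist_explicitLeadDeriv, twist_explicitLeadDeriv2, eval_smul, smul_eq_mul]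
  have d04 : D 0 4 = l ^ 2 * (explicitLeadDeriv2 l m (m + 1)).eval 1 := by
    simp only [hD, Function.iterate_succ_apply', Function.iterate_zero_apply, explicitSolution,
      twist_explicitLead, twist_explicitLeadDeriv, twist_explicitLeadDeriv2, twist_smul, eval_smul,
      smul_eq_mul]
  have d13 : D 1 3 = (D 0 4 + 3 * D 0 3 + 3 * D 0 2 + D 0 1) / 2
      - (6 * D 0 1 * D 0 2 + 6 * D 0 1 ^ 2 - D 0 3 - 3 * D 0 2 - 3 * D 0 1) / 2 := by
    have t1 : ∀ p q : ℂ[X], twist l 1 (p * q) = twist l 0 p * q + p * twist l 0 q + p * q :=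
      twist_succ_mul l 0
    rw [d01, d02, d03, d04]
    simp only [hD, Function.iterate_succ_apply', Function.iterate_zero_apply, explicitSolution,
      explicitOne, t1, twist_add, twist_sub, twist_smul, twist_explicitLead,
      twist_explicitLeadDeriv, twist_explicitLeadDeriv2, twist_zero_X, eval_add, eval_sub,
      eval_smul, eval_mul, eval_X, smul_eq_mul, mul_zero, add_zero, sub_zero, hJ.at_one.1]
    ring1
  obtain ⟨-, s01, s02, s03, s10, s11, s12, s20, s21, s30⟩ :=
    serCoeff_zeroPoly (l * (2 * m + 1)) l (explicitSolution l m (m + 1)) hD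
  rw [← hv 0 (by norm_num)] at s01 s02 s03
  rw [← hv 1 (by norm_num)] at s10 s11 s12
  rw [← hv 2 (by norm_num)] at s20 s21
  rw [← hv 3 (by norm_num)] at s30
  rw [← d04, ← d03, ← d02, ← d01] at hJ
  have a1 : (explicitOne l m (m + 1)).eval 1 = D 1 0 := (hD 1 0).symm
  have a2 : (explicitTwo l m (m + 1)).eval 1 = D 2 0 := (hD 2 0).symm
  have a3 : (explicitThree l m (m + 1)).eval 1 = D 3 0 := (hD 3 0).symm
  have b1 : (twist l 1 (explicitOne l m (m + 1))).eval 1 = D 1 1 := (hD 1 1).symm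
  have b2 : (twist l 2 (explicitTwo l m (m + 1))).eval 1 = D 2 1 := (hD 2 1).symm
  have b3 : (twist l 3 (explicitThree l m (m + 1))).eval 1 = D 3 1 := (hD 3 1).symm
  have c1 : (twist l 1 (twist l 1 (explicitOne l m (m + 1)))).eval 1 = D 1 2 := (hD 1 2).symm
  have c2 : (twist l 2 (twist l 2 (explicitTwo l m (m + 1)))).eval 1 = D 2 2 := (hD 2 2).symm
  rw [a1, a2, a3, b1, b2, b3, c1, c2] at hJ
  rw [s01, s02, s03, s10, s11, s12, s20, s21, s30]
  exact ⟨hJ.implicit_one, hJ.implicit_two hl h0 h1 hK, hJ.implicit_three hl h0 hK d13⟩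

end ImplicitCoefficients

/-! ### Reading off the first coefficients. -/

section Uniqueness

/-- The expansion of a solution of the implicit equation, up to order `3`. -/
lemma HasExpansion.coeff_eq_of_implicit {X ω : ℕ → ℂ} (hX : Tendsto X atTop (𝓝 0))
    (hX0 : ∀ᶠ k in atTop, X k ≠ 0) {δ : PowerSeries ℂ} (h : HasExpansion X ω δ)
    (h0 : PowerSeries.coeff 0 δ = 0) {v : ℕ → ℕ → ℂ} (h01 : v 0 1 ≠ 0) {d1 d2 d3 : ℂ}
    (hv : (fun k => ∑ i ∈ Finset.range 4, ∑ j ∈ Finset.range 4, v i j * X k ^ i * ω k ^ j)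
      =O[atTop] fun k => X k ^ 4)
    (e1 : v 1 0 + v 0 1 * d1 = 0)
    (e2 : v 2 0 + v 1 1 * d1 + v 0 2 * d1 ^ 2 + v 0 1 * d2 = 0)
    (e3 : v 3 0 + v 2 1 * d1 + v 1 2 * d1 ^ 2 + v 0 3 * d1 ^ 3 + v 1 1 * d2
      + 2 * v 0 2 * d1 * d2 + v 0 1 * d3 = 0) :
    PowerSeries.coeff 1 δ = d1 ∧ PowerSeries.coeff 2 δ = d2 ∧ PowerSeries.coeff 3 δ = d3 := by
  set F : PowerSeries ℂ := ∑ i ∈ Finset.range 4, ∑ j ∈ Finset.range 4,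
    PowerSeries.C (v i j) * PowerSeries.X ^ i * δ ^ j with hF
  have hE : HasExpansion X (∑ i ∈ Finset.range 4, ∑ j ∈ Finset.range 4,
      (fun _ => v i j) * X ^ i * ω ^ j) F := by
    have := (expansionRing hX).sum_mem (t := Finset.range 4)
      (f := fun i => ∑ j ∈ Finset.range 4, (((fun _ => v i j, PowerSeries.C (v i j))
        * (X, PowerSeries.X) ^ i * (ω, δ) ^ j : (ℕ → ℂ) × PowerSeries ℂ))) fun i _ =>
      (expansionRing hX).sum_mem fun j _ => (expansionRing hX).mul_mem
        ((expansionRing hX).mul_mem (HasExpansion.const hX _)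
          ((expansionRing hX).pow_mem (x := (X, PowerSeries.X)) (HasExpansion.id hX) i))
        ((expansionRing hX).pow_mem (x := (ω, δ)) h j)
    have e : (∑ i ∈ Finset.range 4, ∑ j ∈ Finset.range 4, (((fun _ => v i j, PowerSeries.C (v i j))
        * (X, PowerSeries.X) ^ i * (ω, δ) ^ j : (ℕ → ℂ) × PowerSeries ℂ)))
        = (∑ i ∈ Finset.range 4, ∑ j ∈ Finset.range 4, (fun _ => v i j) * X ^ i * ω ^ j, F) := by
      refine Prod.ext ?_ ?_ <;> simp [hF, Prod.fst_sum, Prod.snd_sum]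
    rw [e] at this
    exact this
  have hz := hE.eq_zero hX hX0 (M := 4) (hv.congr_left fun k => by simp)
  have z1 := hz 1 (by norm_num)
  have z2 := hz 2 (by norm_num)
  have z3 := hz 3 (by norm_num)
  simp only [hF, Finset.sum_range_succ, Finset.sum_range_zero, zero_add, pow_succ, pow_zero,
    one_mul, mul_one, map_add, coeff_three_mul, coeff_two_mul, coeff_one_mul_eq, coeff_zero_mul_eq,
    PowerSeries.coeff_X, PowerSeries.coeff_C, h0] at z1 z2 z3
  norm_num at z1 z2 z3
  have r1 : PowerSeries.coeff 1 δ = d1 :=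
    mul_left_cancel₀ h01 (by linear_combination z1 - e1)
  rw [r1] at z2 z3
  have r2 : PowerSeries.coeff 2 δ = d2 :=
    mul_left_cancel₀ h01 (by linear_combination z2 - e2)
  rw [r2] at z3
  exact ⟨r1, r2, mul_left_cancel₀ h01 (by linear_combination z3 - e3)⟩

lemma coeff_expSeries {δ : PowerSeries ℂ} {d1 d2 d3 : ℂ} (h0 : PowerSeries.coeff 0 δ = 0)
    (h1 : PowerSeries.coeff 1 δ = d1) (h2 : PowerSeries.coeff 2 δ = d2)
    (h3 : PowerSeries.coeff 3 δ = d3) : PowerSeries.coeff 0 (expSeries δ) = 1 ∧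
      PowerSeries.coeff 1 (expSeries δ) = d1 ∧
      PowerSeries.coeff 2 (expSeries δ) = d2 + d1 ^ 2 / 2 ∧
      PowerSeries.coeff 3 (expSeries δ) = d3 + d1 * d2 + d1 ^ 3 / 6 := by
  simp only [expSeries, PowerSeries.coeff_mk, Finset.sum_range_succ, Finset.sum_range_zero,
    zero_add, pow_succ, pow_zero, one_mul, coeff_three_mul, coeff_two_mul, coeff_one_mul_eq,
    coeff_zero_mul_eq, h0, h1, h2, h3, PowerSeries.coeff_one]
  norm_num [Nat.factorial]
  ring_nf

end Uniqueness

/-! ### Reduction of the second sequence to the first. -/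

section Reflection

lemma Admissible.sub_ne_zero {μ : ℂ} {ν : ℝ} (h : Admissible μ ν) :
    2 * μ - 1 - 2 * Complex.I * ν ≠ 0 := fun e => h.2.1 (sub_eq_zero.1 e)

lemma Admissible.reflect {μ : ℂ} {ν : ℝ} (h : Admissible μ ν) : Admissible (1 - μ) ν :=
  ⟨h.1, fun e => h.2.2 (by linear_combination -e), fun e => h.2.1 (by linear_combination -e)⟩

lemma Admissible.ratio_ne_zero {μ : ℂ} {ν : ℝ} (h : Admissible μ ν) : ratio μ ν ≠ 0 :=
  div_ne_zero h.add_ne_zero h.sub_ne_zero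

/-- The value of `d` for the parameter `1 - μ`. -/
noncomputable def reflectD (μ : ℂ) (ν : ℝ) (d : ℂ) : ℂ := d + Complex.I * Complex.log (ratio μ ν)

lemma zeroPt_reflect (μ : ℂ) {ν : ℝ} (d : ℂ) (k : ℕ) :
    zeroPt μ ν d 1 k = zeroPt (1 - μ) ν (reflectD μ ν d) 0 k := by
  rw [zeroPt, zeroPt, reflectD, ← Complex.exp_add]
  congr 1
  ring

lemma rayAngle_reflect (μ : ℂ) (ν : ℝ) (d : ℂ) :
    rayAngle μ ν d 1 = rayAngle (1 - μ) ν (reflectD μ ν d) 0 := by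
  rw [rayAngle, rayAngle, reflectD, Complex.add_im, Complex.I_mul_im, Complex.log_re]
  ring

lemma pviRHS_reflect (μ : ℂ) : pviRHS (1 - μ) = pviRHS μ := by
  ext x y y'
  rw [pviRHS, pviRHS, show (2 * (1 - μ) - 1) ^ 2 = (2 * μ - 1) ^ 2 by ring]

/-- The equation sees μ only through (2μ - 1)², so the same y is a branch for 1 - μ. The shift of d
multiplies e^{2imd} by `ratio`^(-2m), which the new coefficients A_{nm} `ratio`^(2m) compensate. In
y_1 this exchanges (a + l)² and (a - l)², as the sign change of a requires. -/
lemma IsBranch.reflect {μ : ℂ} {ν : ℝ} {d : ℂ} {φ r : ℝ} {y : ℂ → ℂ} (hμ : Admissible μ ν)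
    (h : IsBranch μ ν d φ r y) : IsBranch (1 - μ) ν (reflectD μ ν d) φ r y := by
  obtain ⟨hr, hs, A, h1, h2, h3, Y, hY, hy⟩ := h
  have hν : (ν : ℂ) ≠ 0 := by exact_mod_cast hμ.1.ne'
  have ha := hμ.add_ne_zero
  have hb := hμ.sub_ne_zero
  refine ⟨hr, ?_, fun n m => A n m * ratio μ ν ^ (2 * m), ?_, ?_, ?_, Y, ?_, hy⟩
  · rwa [SolvesPVI, pviRHS_reflect]
  · beta_reduce
    rw [h1, ratio, show (2 * (-1) : ℤ) = -(2 : ℕ) by norm_num, zpow_neg, zpow_natCast]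
    field_simp
    ring
  · beta_reduce
    rw [h2, mul_zero, zpow_zero, mul_one]
    ring
  · beta_reduce
    rw [h3, ratio, show (2 * 1 : ℤ) = (2 : ℕ) by norm_num, zpow_natCast]
    field_simp
    ring
  · suffices hc : ∀ n x, yCoeff (fun n m => A n m * ratio μ ν ^ (2 * m)) ν (reflectD μ ν d) φ n x
        = yCoeff A ν d φ n x by simpa only [hc] using hY
    intro n x
    rw [yCoeff, yCoeff]
    refine Finset.sum_congr rfl fun m _ => ?_
    have e : Complex.exp (2 * Complex.I * m * reflectD μ ν d)
        = Complex.exp (2 * Complex.I * m * d) * ratio μ ν ^ (-(2 * m)) := by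
      conv_rhs => rw [← Complex.exp_log hμ.ratio_ne_zero]
      rw [← Complex.exp_int_mul, ← Complex.exp_add, reflectD]
      congr 1
      push_cast
      linear_combination (2 * m * Complex.log (ratio μ ν)) * Complex.I_mul_I
    rw [e, zpow_neg]
    have := zpow_ne_zero (2 * m) hμ.ratio_ne_zero
    field_simp

end Reflection

/-! ### Asymptotics of the poles. -/

section Asymptotics

open Polynomial

/-- The distribution of the poles near the sequence of points `X`, with the coefficients `D`. -/
structure PolesNear (μ : ℂ) (φ r : ℝ) (y : ℂ → ℂ) (X : ℕ → ℂ) (α : ℝ) (D : ℕ → ℂ)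
    (ξ : ℕ → ℂ) : Prop where
  eventually : ∀ᶠ k in atTop, ξ k ∈ sheet φ r ∧ ‖ξ k - X k‖ < ‖X k‖ ^ 2 ∧
    meromorphicOrderAt y (ξ k) < 0 ∧
    (μ = 1 / 2 → meromorphicOrderAt y (ξ k) = ((-2 : ℤ) : WithTop ℤ))
  isBigO : ∀ M : ℕ, (fun k => ξ k - X k - ∑ N ∈ Finset.Icc 2 M, D N * X k ^ N)
    =O[atTop] fun k => X k ^ (M + 1)
  tendsto : Tendsto ξ atTop (𝓝 0)
  tendsto_div : Tendsto (fun k => ξ k / (‖ξ k‖ : ℂ)) atTop (𝓝 (Complex.exp (Complex.I * (α : ℂ))))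

/-- The expansion of ξ/x is multiplied by x; this shifts the index, so Δ_N is the coefficient of
order N - 1. -/
lemma isBigO_of_hasExpansion {X e : ℕ → ℂ} (hX : Tendsto X atTop (𝓝 0)) {E : PowerSeries ℂ}
    (h : HasExpansion X e E) (h0 : PowerSeries.coeff 0 E = 1) (M : ℕ) :
    (fun k => X k * e k - X k - ∑ N ∈ Finset.Icc 2 M, PowerSeries.coeff (N - 1) E * X k ^ N)
      =O[atTop] fun k => X k ^ (M + 1) := by
  have step : ∀ M, (fun k => X k * e k - X k
      - ∑ N ∈ Finset.Icc 2 (M + 1), PowerSeries.coeff (N - 1) E * X k ^ N)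
      =O[atTop] fun k => X k ^ (M + 2) := by
    intro M
    have h1 := (isBigO_refl X atTop).mul (h (M + 1))
    refine (h1.congr_left fun k => ?_).congr_right fun k => (pow_succ' _ _).symm
    have : ∀ M, X k * ∑ i ∈ Finset.range (M + 1), PowerSeries.coeff i E * X k ^ i
        = X k + ∑ N ∈ Finset.Icc 2 (M + 1), PowerSeries.coeff (N - 1) E * X k ^ N := by
      intro M
      induction M with
      | zero => simp [h0]
      | succ M ih =>
        rw [Finset.sum_range_succ, mul_add, ih, Finset.sum_Icc_succ_top (a := 2) (b := M + 1) (by omega)]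
        simp only [Nat.add_sub_cancel]
        ring
    rw [eval_trunc, mul_sub, this]
    ring
  rcases M with _ | M
  · simpa using (step 0).trans (pow_isBigO_pow hX (show 1 ≤ 2 by norm_num))
  · exact step M

lemma exp_logZero_div_norm {μ : ℂ} {ν : ℝ} {d : ℂ} (k : ℕ) :
    Complex.exp (logZero ν d k) / (‖Complex.exp (logZero ν d k)‖ : ℂ)
      = Complex.exp (Complex.I * (rayAngle μ ν d 0 : ℂ)) := by
  have him : (logZero ν d k).im = rayAngle μ ν d 0 := by
    have : ((k : ℂ) * Real.pi / ν) = ((k * Real.pi / ν : ℝ) : ℂ) := by push_cast; rfl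
    rw [logZero, this, Complex.sub_im, Complex.ofReal_im]
    simp [rayAngle]
  rw [Complex.norm_exp, Complex.ofReal_exp, ← Complex.exp_sub, ← him]
  congr 1
  rw [sub_eq_iff_eq_add, add_comm, mul_comm]
  exact (Complex.re_add_im _).symm

/-- The coefficients of the asymptotic representation for the first sequence of poles. -/
noncomputable def poleCoeff (D : ℕ → ℂ → ℝ → ℂ) (N : ℕ) (μ : ℂ) (ν : ℝ) : ℂ :=
  if N = 2 then -(1 / 2)
  else if N = 3 then (16 * μ ^ 4 - 8 * μ ^ 2 + 176 * (ν : ℂ) ^ 4 + 352 * (ν : ℂ) ^ 2 + 177)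
    / (1024 * ((ν : ℂ) ^ 2 + 1) ^ 2)
  else if N = 4 then -((16 * μ ^ 4 - 8 * μ ^ 2 + 49 + 48 * (ν : ℂ) ^ 4 + 96 * (ν : ℂ) ^ 2)
    / (1024 * ((ν : ℂ) ^ 2 + 1) ^ 2))
  else D (N - 1) μ ν

lemma sq_add_one_ne_zero (ν : ℝ) : (ν : ℂ) ^ 2 + 1 ≠ 0 := by
  have h : (0 : ℝ) < ν ^ 2 + 1 := by positivity
  exact_mod_cast h.ne'

/-- The first coefficients of the expansion of `ξ_k(1) / x_k(1)`. -/
lemma FormalSolution.coeff_exp_eq (x : FormalSolution) {X ω : ℕ → ℂ}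
    (hX : Tendsto X atTop (𝓝 0)) (hX0 : ∀ᶠ k in atTop, X k ≠ 0)
    (hv : ∀ M, (fun k => ∑ i ∈ Finset.range M, ∑ j ∈ Finset.range M,
      x.v i j * X k ^ i * ω k ^ j) =O[atTop] fun k => X k ^ M)
    {δ : PowerSeries ℂ} (h0 : PowerSeries.coeff 0 δ = 0) (hδ : HasExpansion X ω δ)
    {D : ℕ → ℂ → ℝ → ℂ} (hD : ∀ n, PowerSeries.coeff n (expSeries δ) = D n x.μ x.ν) :
    PowerSeries.coeff 0 (expSeries δ) = 1 ∧
      ∀ N, 2 ≤ N → PowerSeries.coeff (N - 1) (expSeries δ) = poleCoeff D N x.μ x.ν := by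
  have hl0 := l_ne_zero x.admissible.1
  have hI : (2 * Complex.I * (x.ν : ℂ)) ^ 2 = -(4 * x.ν ^ 2) := by
    rw [mul_pow, mul_pow, Complex.I_sq]
    ring
  have hν := sq_add_one_ne_zero x.ν
  have hl4 : 4 - (2 * Complex.I * (x.ν : ℂ)) ^ 2 = 4 * ((x.ν : ℂ) ^ 2 + 1) := by
    rw [hI]
    ring
  obtain ⟨m, hm⟩ : ∃ m, 2 * x.μ - 1 = 2 * Complex.I * x.ν * (2 * m + 1) :=
    ⟨((2 * x.μ - 1) / (2 * Complex.I * x.ν) - 1) / 2, by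
      rw [mul_div_cancel₀ _ two_ne_zero, sub_add_cancel, mul_div_cancel₀ _ hl0]⟩
  have h01 : x.v 0 1 ≠ 0 := by
    rw [v_zero_one]
    exact div_ne_zero (pow_ne_zero 2 x.admissible.add_ne_zero) two_ne_zero
  -- Here a(a + 2) = 4μ² - 1 and 4 - l² = 4(ν² + 1). The three coefficients -1/2, 3/64 + K, -1/384 -
  -- K/2 of ω express that ln(ξ/√(1 - ξ)) = ln x_k + (3/64 + K) x_k² + O(x_k⁴), so K is the only
  -- nontrivial constant up to this order.
  set K : ℂ := (4 * x.μ ^ 2 - 1) ^ 2 / (1024 * ((x.ν : ℂ) ^ 2 + 1) ^ 2) with hK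
  have hv' : ∀ i < 4, ∀ j, x.v i j = serCoeff (2 * Complex.I * x.ν)
      (zeroPoly (2 * Complex.I * x.ν * (2 * m + 1)) (2 * Complex.I * x.ν)
        (explicitSolution (2 * Complex.I * x.ν) m (m + 1))) i j := by
    intro i hi j
    have hw := x.w_eq hm
    have hz : zeroPoly (2 * x.μ - 1) (2 * Complex.I * x.ν) x.w i
        = zeroPoly (2 * Complex.I * x.ν * (2 * m + 1)) (2 * Complex.I * x.ν)
          (explicitSolution (2 * Complex.I * x.ν) m (m + 1)) i := by
      rw [hm, zeroPoly, zeroPoly, hw i hi, hw (i - 1) (by omega)]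
    rw [FormalSolution.v, serCoeff, serCoeff, hz]
  obtain ⟨q1, q2, q3⟩ := implicit_equations (K := K) (by
    rw [hl4]
    exact mul_ne_zero (by norm_num) hν) x.v hv' (by
    rw [← hm, hl4, hK]
    field_simp
    ring)
  obtain ⟨r1, r2, r3⟩ := hδ.coeff_eq_of_implicit hX hX0 h0 h01 (hv 4) q1 q2 q3
  obtain ⟨s0, s1, s2, s3⟩ := coeff_expSeries h0 r1 r2 r3
  refine ⟨s0, fun N hN => ?_⟩
  rw [poleCoeff]
  split_ifs with e2 e3 e4
  · rw [e2]
    refine s1.trans (by norm_num)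
  · rw [e3]
    refine s2.trans ?_
    rw [hK]
    field_simp
    ring
  · rw [e4]
    refine s3.trans ?_
    rw [hK]
    field_simp
    ring
  · exact hD _

theorem exists_poleCoeff : ∃ D : ℕ → ℂ → ℝ → ℂ,
    (∀ n, ∃ P Q : MvPolynomial (Fin 2) ℂ, ∀ μ ν, Admissible μ ν →
      MvPolynomial.eval ![μ, (ν : ℂ)] Q ≠ 0 ∧
      D n μ ν = MvPolynomial.eval ![μ, (ν : ℂ)] P / MvPolynomial.eval ![μ, (ν : ℂ)] Q) ∧
    ∀ (μ : ℂ) (ν : ℝ) (d : ℂ) (φ r : ℝ) (y : ℂ → ℂ), Admissible μ ν → IsBranch μ ν d φ r y →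
      |rayAngle μ ν d 0 - φ| < Real.pi → ∃ ξ, PolesNear μ φ r y (zeroPt μ ν d 0)
        (rayAngle μ ν d 0) (fun N => poleCoeff D N μ ν) ξ := by
  obtain ⟨D, hD, hex⟩ := FormalSolution.exists_regular_expansion
  refine ⟨D, hD, fun μ ν d φ r y hμ hb hα => ?_⟩
  obtain ⟨w, Y, η, ρ, B, hS⟩ := exists_series hμ.1 hb hα
  obtain ⟨ω, hω, hev, hv⟩ := hS.exists_poles hμ hb.solves
  set X : ℕ → ℂ := fun k => Complex.exp (logZero ν d k) with hXdef
  have hX : Tendsto X atTop (𝓝 0) := tendsto_exp_logZero hμ.1 d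
  have hX0 : ∀ k, X k ≠ 0 := fun k => Complex.exp_ne_zero _
  have hX0' : ∀ᶠ k in atTop, X k ≠ 0 := Eventually.of_forall hX0
  let x : FormalSolution := ⟨μ, ν, hμ, w, hS.lead, hS.natDegree_le, hS.formalODE_eq_zero hμ.1 hb.solves⟩
  obtain ⟨δ, h0, hδ, hc⟩ := hex x X ω hX hX0' hω hv
  obtain ⟨s0, sN⟩ := x.coeff_exp_eq hX hX0' hv h0 hδ hc
  have hz : zeroPt μ ν d 0 = X := rfl
  have hO : ∀ M : ℕ, (fun k => X k * Complex.exp (ω k) - X k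
      - ∑ N ∈ Finset.Icc 2 M, poleCoeff D N μ ν * X k ^ N) =O[atTop] fun k => X k ^ (M + 1) := by
    intro M
    refine (isBigO_of_hasExpansion hX (hδ.exp hX hω h0) s0 M).congr_left fun k => ?_
    congr 1
    refine Finset.sum_congr rfl fun N hN => ?_
    rw [sN N (Finset.mem_Icc.1 hN).1]
  have hexp : Tendsto (fun k => Complex.exp (ω k)) atTop (𝓝 1) := by
    have := (Complex.continuous_exp.tendsto 0).comp (hω.trans_tendsto hX)
    rwa [Complex.exp_zero] at this
  refine ⟨fun k => X k * Complex.exp (ω k), ?_, ?_, ?_, ?_⟩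
  -- As Δ_2 = -1/2, the distance to x_k is at most |x_k|²/2 + C|x_k|³, below |x_k|² once C|x_k| <
  -- 1/2.
  · obtain ⟨C, hC⟩ := (hO 2).bound
    have hsm : ∀ᶠ k in atTop, C * ‖X k‖ < 1 / 2 := by
      have := (tendsto_norm_zero.comp hX).const_mul C
      rw [mul_zero] at this
      exact this.eventually_lt_const (by norm_num)
    filter_upwards [hev, hC, hsm] with k hk hCk hs
    refine ⟨hk.1, ?_, hk.2.1, hk.2.2⟩
    rw [hz]
    have hp : poleCoeff D 2 μ ν = -(1 / 2) := by simp [poleCoeff]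
    simp only [Finset.Icc_self, Finset.sum_singleton, hp, norm_pow] at hCk
    have hpos : 0 < ‖X k‖ := norm_pos_iff.2 (hX0 k)
    have n1 := norm_add_le (X k * Complex.exp (ω k) - X k - -(1 / 2) * X k ^ 2)
      (-(1 / 2) * X k ^ 2)
    rw [sub_add_cancel] at n1
    have n2 : ‖-(1 / 2) * X k ^ 2‖ = 1 / 2 * ‖X k‖ ^ 2 := by
      rw [norm_mul, norm_neg, norm_pow]
      norm_num
    have n3 : C * ‖X k‖ ^ (2 + 1) < 1 / 2 * ‖X k‖ ^ 2 := by
      have : C * ‖X k‖ ^ (2 + 1) = C * ‖X k‖ * ‖X k‖ ^ 2 := by ring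
      rw [this]
      gcongr
    linarith
  · intro M
    exact hO M
  · simpa using hX.mul hexp
  · have h1 : Tendsto (fun k => Complex.exp (ω k) / (‖Complex.exp (ω k)‖ : ℂ)) atTop (𝓝 1) := by
      have h2 : Tendsto (fun k => (‖Complex.exp (ω k)‖ : ℂ)) atTop (𝓝 1) := by
        have := (Complex.continuous_ofReal.tendsto _).comp hexp.norm
        simpa using! this
      simpa using! hexp.div h2 one_ne_zero
    have h3 := h1.const_mul (Complex.exp (Complex.I * (rayAngle μ ν d 0 : ℂ)))
    rw [mul_one] at h3
    refine h3.congr fun k => ?_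
    rw [← exp_logZero_div_norm (μ := μ) (ν := ν) (d := d) k, norm_mul, Complex.ofReal_mul,
      div_mul_div_comm]

end Asymptotics

/-! ### Regularity of the coefficients of both sequences. -/

section Rational

open MvPolynomial

/-- The function of `μ` and `ν` is a rational function, regular at all admissible values. -/
def IsRegular (f : ℂ → ℝ → ℂ) : Prop :=
  ∃ P Q : MvPolynomial (Fin 2) ℂ, ∀ (μ : ℂ) (ν : ℝ), Admissible μ ν →
    eval ![μ, (ν : ℂ)] Q ≠ 0 ∧ f μ ν = eval ![μ, (ν : ℂ)] P / eval ![μ, (ν : ℂ)] Q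

lemma IsRegular.reflect {f : ℂ → ℝ → ℂ} (hf : IsRegular f) : IsRegular fun μ ν => f (1 - μ) ν := by
  obtain ⟨P, Q, h⟩ := hf
  have e : ∀ (p : MvPolynomial (Fin 2) ℂ) (μ : ℂ) (ν : ℝ),
      eval ![μ, (ν : ℂ)] (bind₁ ![1 - X 0, X 1] p) = eval ![1 - μ, (ν : ℂ)] p := by
    intro p μ ν
    have h : (fun i => aeval ![μ, (ν : ℂ)] ((![1 - X 0, X 1] : Fin 2 → MvPolynomial _ ℂ) i))
        = ![1 - μ, (ν : ℂ)] := by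
      ext i
      fin_cases i <;> simp
    rw [← coe_aeval_eq_eval, ← coe_aeval_eq_eval, RingHom.coe_coe, RingHom.coe_coe, aeval_bind₁, h]
  refine ⟨bind₁ ![1 - X 0, X 1] P, bind₁ ![1 - X 0, X 1] Q, fun μ ν hμ => ?_⟩
  rw [e, e]
  exact h _ _ hμ.reflect

/-- The orders 2, 3, 4 are given by closed formulas and not by D, because D is tied to the true
coefficients only at parameters that carry a formal solution, while the closed formulas are needed
at every admissible value. -/
lemma isRegular_poleCoeff {D : ℕ → ℂ → ℝ → ℂ} (hD : ∀ n, IsRegular (D n)) (N : ℕ) :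
    IsRegular (poleCoeff D N) := by
  have hQ : ∀ (μ : ℂ) (ν : ℝ), eval ![μ, (ν : ℂ)]
      (C 1024 * (X 1 ^ 2 + 1) ^ 2 : MvPolynomial (Fin 2) ℂ) = 1024 * ((ν : ℂ) ^ 2 + 1) ^ 2 := by
    simp
  have hQ0 : ∀ ν : ℝ, 1024 * ((ν : ℂ) ^ 2 + 1) ^ 2 ≠ 0 := fun ν =>
    mul_ne_zero (by norm_num) (pow_ne_zero 2 (sq_add_one_ne_zero ν))
  by_cases h2 : N = 2
  · exact ⟨C (-(1 / 2)), 1, fun μ ν _ => by simp [poleCoeff, h2]⟩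
  by_cases h3 : N = 3
  · refine ⟨C 16 * X 0 ^ 4 - C 8 * X 0 ^ 2 + C 176 * X 1 ^ 4 + C 352 * X 1 ^ 2 + C 177,
      C 1024 * (X 1 ^ 2 + 1) ^ 2, fun μ ν _ => ?_⟩
    rw [hQ]
    refine ⟨hQ0 ν, ?_⟩
    simp [poleCoeff, h3]
  by_cases h4 : N = 4
  · refine ⟨-(C 16 * X 0 ^ 4 - C 8 * X 0 ^ 2 + C 49 + C 48 * X 1 ^ 4 + C 96 * X 1 ^ 2),
      C 1024 * (X 1 ^ 2 + 1) ^ 2, fun μ ν _ => ?_⟩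
    rw [hQ]
    refine ⟨hQ0 ν, ?_⟩
    rw [map_neg, neg_div]
    simp [poleCoeff, h4]
  · obtain ⟨P, Q, h⟩ := hD (N - 1)
    refine ⟨P, Q, fun μ ν hμ => ?_⟩
    simpa only [poleCoeff, h2, h3, h4, if_false] using h μ ν hμ

/-- The coefficients of the asymptotic representations for both sequences of poles. -/
noncomputable def poleCoeffs (D : ℕ → ℂ → ℝ → ℂ) : Fin 2 → ℕ → ℂ → ℝ → ℂ
  | 0, N, μ, ν => poleCoeff D N μ ν
  | 1, N, μ, ν => poleCoeff D N (1 - μ) ν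

end Rational

/-- The case j = 2 is the first sequence for the reflected data. The condition for double poles is
unaffected, as 1 - μ = 1/2 exactly when μ = 1/2. -/
lemma exists_poles_near {D : ℕ → ℂ → ℝ → ℂ}
    (hD : ∀ (μ : ℂ) (ν : ℝ) (d : ℂ) (φ r : ℝ) (y : ℂ → ℂ), Admissible μ ν →
      IsBranch μ ν d φ r y → |rayAngle μ ν d 0 - φ| < Real.pi →
      ∃ ξ, PolesNear μ φ r y (zeroPt μ ν d 0) (rayAngle μ ν d 0) (fun N => poleCoeff D N μ ν) ξ)
    {μ : ℂ} {ν : ℝ} {d : ℂ} {φ r : ℝ} {y : ℂ → ℂ} (hμ : Admissible μ ν)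
    (hb : IsBranch μ ν d φ r y) (j : Fin 2) (hj : |rayAngle μ ν d j - φ| < Real.pi) :
    ∃ ξ, PolesNear μ φ r y (zeroPt μ ν d j) (rayAngle μ ν d j)
      (fun N => poleCoeffs D j N μ ν) ξ := by
  fin_cases j
  · exact hD μ ν d φ r y hμ hb hj
  · obtain ⟨ξ, h⟩ := hD (1 - μ) ν (reflectD μ ν d) φ r y hμ.reflect (hb.reflect hμ)
      (by rw [← rayAngle_reflect]; exact hj)
    have hz : zeroPt (1 - μ) ν (reflectD μ ν d) 0 = zeroPt μ ν d 1 :=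
      funext fun k => (zeroPt_reflect μ d k).symm
    rw [hz, ← rayAngle_reflect] at h
    refine ⟨ξ, ⟨?_, h.isBigO, h.tendsto, h.tendsto_div⟩⟩
    filter_upwards [h.eventually] with k hk
    exact ⟨hk.1, hk.2.1, hk.2.2.1, fun e => hk.2.2.2 (by rw [e]; norm_num)⟩

end PainleveVI

theorem proposition7 :
    ∃ Δ : Fin 2 → ℕ → ℂ → ℝ → ℂ,
      -- each coefficient is a rational function of `μ` and `ν`, regular at all admissible values
      (∀ j : Fin 2, ∀ N : ℕ, 2 ≤ N → ∃ P Q : MvPolynomial (Fin 2) ℂ,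
        ∀ (μ : ℂ) (ν : ℝ), PainleveVI.Admissible μ ν →
          MvPolynomial.eval ![μ, (ν : ℂ)] Q ≠ 0 ∧
          Δ j N μ ν = MvPolynomial.eval ![μ, (ν : ℂ)] P / MvPolynomial.eval ![μ, (ν : ℂ)] Q) ∧
      -- the first coefficients
      (∀ (μ : ℂ) (ν : ℝ), PainleveVI.Admissible μ ν →
        Δ 0 2 μ ν = -(1 / 2) ∧ Δ 1 2 μ ν = -(1 / 2) ∧
        Δ 0 3 μ ν = (16 * μ ^ 4 - 8 * μ ^ 2 + 176 * (ν : ℂ) ^ 4 + 352 * (ν : ℂ) ^ 2 + 177)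
            / (1024 * ((ν : ℂ) ^ 2 + 1) ^ 2) ∧
        Δ 1 3 μ ν = (16 * μ ^ 4 - 64 * μ ^ 3 + 88 * μ ^ 2 - 48 * μ + 176 * (ν : ℂ) ^ 4
              + 352 * (ν : ℂ) ^ 2 + 185)
            / (1024 * ((ν : ℂ) ^ 2 + 1) ^ 2) ∧
        Δ 0 4 μ ν = -((16 * μ ^ 4 - 8 * μ ^ 2 + 49 + 48 * (ν : ℂ) ^ 4 + 96 * (ν : ℂ) ^ 2)
            / (1024 * ((ν : ℂ) ^ 2 + 1) ^ 2)) ∧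
        Δ 1 4 μ ν = -((16 * μ ^ 4 - 64 * μ ^ 3 + 88 * μ ^ 2 - 48 * μ + 57 + 48 * (ν : ℂ) ^ 4
              + 96 * (ν : ℂ) ^ 2)
            / (1024 * ((ν : ℂ) ^ 2 + 1) ^ 2))) ∧
      -- for `μ = 1/2` the two sequences have the same coefficients
      (∀ ν : ℝ, 0 < ν → ∀ N : ℕ, 2 ≤ N → Δ 0 N (1 / 2) ν = Δ 1 N (1 / 2) ν) ∧
      -- the poles and their asymptotic distribution
      (∀ (μ : ℂ) (ν : ℝ) (d : ℂ) (φ r : ℝ) (y : ℂ → ℂ),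
        PainleveVI.Admissible μ ν → PainleveVI.IsBranch μ ν d φ r y →
        ∀ k₀ : ℕ, (∀ j : Fin 2, ∀ k : ℕ, k₀ ≤ k → ‖PainleveVI.zeroPt μ ν d j k‖ < r) →
        ∃ (K : ℕ) (ξ : Fin 2 → ℕ → ℂ),
          ∀ j : Fin 2, |PainleveVI.rayAngle μ ν d j - φ| < Real.pi →
            (∀ k : ℕ, max K k₀ ≤ k →
              ξ j k ∈ PainleveVI.sheet φ r ∧
              ‖ξ j k - PainleveVI.zeroPt μ ν d j k‖ < ‖PainleveVI.zeroPt μ ν d j k‖ ^ 2 ∧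
              meromorphicOrderAt y (ξ j k) < 0 ∧
              (μ = 1 / 2 → meromorphicOrderAt y (ξ j k) = ((-2 : ℤ) : WithTop ℤ))) ∧
            (∀ M : ℕ,
              (fun k : ℕ => ξ j k - PainleveVI.zeroPt μ ν d j k
                  - ∑ N ∈ Finset.Icc 2 M, Δ j N μ ν * PainleveVI.zeroPt μ ν d j k ^ N)
                =O[atTop] (fun k : ℕ => PainleveVI.zeroPt μ ν d j k ^ (M + 1))) ∧
            Tendsto (ξ j) atTop (𝓝 0) ∧
            Tendsto (fun k : ℕ => ξ j k / (‖ξ j k‖ : ℂ)) atTop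
              (𝓝 (Complex.exp (Complex.I * (PainleveVI.rayAngle μ ν d j : ℂ))))) := by
  obtain ⟨D, hD, hex⟩ := PainleveVI.exists_poleCoeff
  have hreg := PainleveVI.isRegular_poleCoeff hD
  refine ⟨PainleveVI.poleCoeffs D, ?_, ?_, ?_, ?_⟩
  · intro j N _
    fin_cases j
    · exact hreg N
    · exact (hreg N).reflect
  · intro μ ν _
    simp only [PainleveVI.poleCoeffs, PainleveVI.poleCoeff]
    norm_num
    constructor <;> ring
  · intro ν _ N _
    simp only [PainleveVI.poleCoeffs]
    norm_num
  · intro μ ν d φ r y hμ hb k₀ _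
    have h : ∀ j : Fin 2, ∃ ξ, |PainleveVI.rayAngle μ ν d j - φ| < Real.pi →
        PainleveVI.PolesNear μ φ r y (PainleveVI.zeroPt μ ν d j) (PainleveVI.rayAngle μ ν d j)
          (fun N => PainleveVI.poleCoeffs D j N μ ν) ξ := by
      intro j
      by_cases hj : |PainleveVI.rayAngle μ ν d j - φ| < Real.pi
      · obtain ⟨ξ, hξ⟩ := PainleveVI.exists_poles_near hex hμ hb j hj
        exact ⟨ξ, fun _ => hξ⟩
      · exact ⟨0, fun h => absurd h hj⟩
    choose ξ hξ using h
    have hev : ∀ᶠ k in atTop, ∀ j : Fin 2, |PainleveVI.rayAngle μ ν d j - φ| < Real.pi →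
        ξ j k ∈ PainleveVI.sheet φ r ∧
        ‖ξ j k - PainleveVI.zeroPt μ ν d j k‖ < ‖PainleveVI.zeroPt μ ν d j k‖ ^ 2 ∧
        meromorphicOrderAt y (ξ j k) < 0 ∧
        (μ = 1 / 2 → meromorphicOrderAt y (ξ j k) = ((-2 : ℤ) : WithTop ℤ)) := by
      rw [eventually_all]
      intro j
      by_cases hj : |PainleveVI.rayAngle μ ν d j - φ| < Real.pi
      · exact (hξ j hj).eventually.mono fun k hk _ => hk
      · exact Eventually.of_forall fun k h => absurd h hj
    obtain ⟨K, hK⟩ := eventually_atTop.1 hev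
    exact ⟨K, ξ, fun j hj => ⟨fun k hk => hK k (le_of_max_le_left hk) j hj, (hξ j hj).isBigO,
      (hξ j hj).tendsto, (hξ j hj).tendsto_div⟩⟩
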